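/- For each integer $k\ge -1$ define elements $a_k,b_k,c_k,d_k,p_k,q_k$ of the field of fractions of $\mathbb{Z}[n]$ by \[ (a_{-1},b_{-1},c_{-1},d_{-1},p_{-1},q_{-1})=(-1,\ 1,\ 1,\ 1,\ 0,\ n+1) \] and, for all $k\ge 0$, \[ (a_k,b_k,c_k,d_k)=\left(d_{k-1},\ \frac{q_{k-1}-1}{d_{k-1}},\ b_{k-1},\ \frac{q_{k-1}+1}{b_{k-1}}\right),\qquad (p_k,q_k)=\left(q_{k-1},\ \frac{b_k^2d_k^2-1}{q_{k-1}}\right). \] Then each of $a_k,b_k,c_k,d_k,p_k,q_k$ lies in $\mathbb{Z}[n]$, and for $k\ge 0$ they are monic of degrees $k$, $k+1$, $k$, $k+1$, $2k+1$ and $2k+3$ respectively. Moreover, for every $k\ge 1$ we have $a_k\ne c_k$ and $b_k\ne d_k$ as polynomials; and for every $k\ge 1$ and every integer $n\ge 2$, writing $a_k,\dots,p_k$ for the values at $n$, the following holds. (i) $a_k,b_k\ge 2$ are coprime, $c_k,d_k\ge 2$ are coprime, and the torus knots $T_{a_k,b_k}$ and $T_{c_k,d_k}$ in $S^3$ are nontrivial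 (not equivalent to the unknot); furthermore $a_k\neq c_k$, $b_k\ne d_k$ and $\{a_k,b_k\}\neq\{c_k,d_k\}$. (ii) There is an orientation-preserving diffeomorphism \[ S^3_{p_k}(T_{a_k,b_k})\cong S^3_{p_k}(T_{c_k,d_k}) \] between the results of $p_k$-framed Dehn surgery on the two knots. (iii) These manifolds are a common lens space: $p_k\ge 2$, and for some integer $q$ coprime to $p_k$ both are orientation-preservingly diffeomorphic to $L(p_k,q)=S^3/\bigl((z,w)\sim(\zeta z,\zeta^{q}w),\ \zeta^{p_k}=1\bigr)$. Here $S^3\subset\mathbb{C}^2$ is the unit sphere, oriented as the boundary of the ball, and $T_{a,b}$ is the curve $t\mapsto (t^a,t^b)/\sqrt2$, $|t|=1$. -/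

import Mathlib

open scoped Polynomial ContDiff Topology

/-! ### The recursively defined tuples -/

/-- A tuple `(a, b, c, d, p, q)` of elements of `R`. -/
structure Tuple (R : Type*) where
  a : R
  b : R
  c : R
  d : R
  p : R
  q : R

/-- Apply a map to all six entries. -/
def Tuple.map {R S : Type*} (f : R → S) (T : Tuple R) : Tuple S :=
  ⟨f T.a, f T.b, f T.c, f T.d, f T.p, f T.q⟩

/-- The passage from the tuple with index `k - 1` to the one with index `k`. -/
def Tuple.next {F : Type*} [Field F] (T : Tuple F) : Tuple F where
  a := T.d
  b := (T.q - 1) / T.d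
  c := T.b
  d := (T.q + 1) / T.b
  p := T.q
  q := (((T.q - 1) / T.d) ^ 2 * ((T.q + 1) / T.b) ^ 2 - 1) / T.q

/-- The sequence of tuples of rational functions in the variable `n` (here `X`), in the fraction
field of `ℤ[X]`. The index is shifted by one: `ratTuple (k + 1)` is
`(a_k, b_k, c_k, d_k, p_k, q_k)` for `k ≥ -1`. -/
noncomputable def ratTuple : ℕ → Tuple (FractionRing ℤ[X])
  | 0 => ⟨-1, 1, 1, 1, 0, algebraMap ℤ[X] (FractionRing ℤ[X]) (Polynomial.X + 1)⟩
  | j + 1 => (ratTuple j).next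

/-! ### The 3-sphere, knots in it, orientations -/

/-- The unit sphere of `ℂ²`. -/
abbrev S3 : Type := {x : ℂ × ℂ // ‖x.1‖ ^ 2 + ‖x.2‖ ^ 2 = 1}

/-- The torus knot `T_{a,b}` (a knot if `a`, `b` are coprime): the curve
`t ↦ (t ^ a, t ^ b) / √2`, `|t| = 1`. -/
def torusKnot (a b : ℤ) : Set S3 :=
  {x | ∃ t : Circle, x.1.1 = ((t ^ a : Circle) : ℂ) / (√2 : ℝ) ∧
    x.1.2 = ((t ^ b : Circle) : ℂ) / (√2 : ℝ)}

/-- A knot is trivial if a homeomorphism of the sphere carries it to a great circle. -/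
def IsTrivialKnot (K : Set S3) : Prop :=
  ∃ h : S3 ≃ₜ S3, h '' K = {x : S3 | x.1.2 = 0}

/-- The real coordinates of a point of `ℂ² = ℝ⁴`. -/
def realCoords (x : ℂ × ℂ) : Fin 4 → ℝ := ![x.1.re, x.1.im, x.2.re, x.2.im]

/-- The vector `N`, followed by the images under `L` of the standard basis of `ℝ × ℂ = ℝ³`, is a
positive basis of `ℂ² = ℝ⁴`. If `L` is the derivative of a map from `ℝ³` to an oriented
hypersurface of `ℂ²` with outward normal `N`, this says that the map is a local diffeomorphism
at that point and preserves the orientation there. -/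
def IsPositiveFrame (N : ℂ × ℂ) (L : ℝ × ℂ →L[ℝ] ℂ × ℂ) : Prop :=
  0 < Matrix.det (Matrix.of ![realCoords N, realCoords (L (1, 0)), realCoords (L (0, 1)),
    realCoords (L (0, Complex.I))])

/-- Near the origin, `α` is a smooth, orientation-preserving parametrization of a part of the
3-sphere, which is oriented as the boundary of the ball. -/
def IsPositiveInS3 (α : ℝ × ℂ → S3) : Prop :=
  ContDiffAt ℝ ∞ (fun x => (α x).1) 0 ∧
    IsPositiveFrame (α 0).1 (fderiv ℝ (fun x => (α x).1) 0)

/-- Near the origin, `β` is a smooth, orientation-preserving parametrization of a part of the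
open solid torus `ℂ × S¹` with its product orientation (it is the hypersurface `|w| = 1` of `ℂ²`,
and `(0, w)` is its outward normal). -/
def IsPositiveInSolidTorus (β : ℝ × ℂ → ℂ × Circle) : Prop :=
  ContDiffAt ℝ ∞ (fun x => ((β x).1, ((β x).2 : ℂ))) 0 ∧
    IsPositiveFrame (0, ((β 0).2 : ℂ)) (fderiv ℝ (fun x => ((β x).1, ((β x).2 : ℂ))) 0)

/-- The data that make a space an oriented smooth 3-manifold: for a map from `ℝ × ℂ = ℝ³`,
the property that its germ at the origin is a smooth, orientation-preserving parametrization of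
a neighbourhood of its value at the origin. Only the instances below are used. -/
class OrientedSmooth (Y : Type*) where
  IsPositive : (ℝ × ℂ → Y) → Prop

/-- There is an orientation-preserving diffeomorphism from `Y` to `Z`: a homeomorphism that, near
every point, carries an oriented local parametrization of `Y` to one of `Z`. -/
def OrientedDiffeomorphic (Y Z : Type*) [TopologicalSpace Y] [OrientedSmooth Y]
    [TopologicalSpace Z] [OrientedSmooth Z] : Prop :=
  ∃ h : Y ≃ₜ Z, ∀ y : Y, ∃ φ : ℝ × ℂ → Y, φ 0 = y ∧
    OrientedSmooth.IsPositive φ ∧ OrientedSmooth.IsPositive (h ∘ φ)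

/-! ### Lens spaces -/

/-- The relation `(z, w) ∼ (ζ z, ζ ^ q w)`, where `ζ ^ p = 1`. -/
def lensRel (p q : ℤ) (x y : S3) : Prop :=
  ∃ ζ : Circle, ζ ^ p = 1 ∧ y.1.1 = (ζ : ℂ) * x.1.1 ∧ y.1.2 = ((ζ ^ q : Circle) : ℂ) * x.1.2

/-- The lens space `L(p, q)`, the quotient of the 3-sphere by that relation (for `p > 1` and
`q` coprime to `p`). -/
def LensSpace (p q : ℤ) : Type := Quot (lensRel p q)

instance (p q : ℤ) : TopologicalSpace (LensSpace p q) :=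
  inferInstanceAs (TopologicalSpace (Quot (lensRel p q)))

instance (p q : ℤ) : OrientedSmooth (LensSpace p q) where
  IsPositive φ := ∃ α : ℝ × ℂ → S3, IsPositiveInS3 α ∧ φ =ᶠ[𝓝 0] fun x => Quot.mk _ (α x)

/-! ### Integral Dehn surgery -/

/-- A framed open tubular neighbourhood of `K`: a smooth, orientation-preserving embedding of
`S¹ × ℂ` in the 3-sphere that maps `S¹ × 0` onto `K`. -/
structure FramedNhd (K : Set S3) where
  toFun : Circle × ℂ → S3
  injective : Function.Injective toFun
  smooth : ContDiff ℝ ∞ (fun x : ℝ × ℂ => (toFun (Circle.exp x.1, x.2)).1)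
  positive : ∀ x : ℝ × ℂ, IsPositiveFrame (toFun (Circle.exp x.1, x.2)).1
    (fderiv ℝ (fun x : ℝ × ℂ => (toFun (Circle.exp x.1, x.2)).1) x)
  core : Set.range (fun t : Circle => toFun (t, 0)) = K

namespace FramedNhd

variable {K : Set S3} (ν : FramedNhd K)

theorem notMem_core (t : Circle) {v : ℂ} (hv : v ≠ 0) : ν.toFun (t, v) ∉ K := by
  intro hK
  obtain ⟨s, hs⟩ := (Set.ext_iff.mp ν.core _).mpr hK
  have h := ν.injective hs
  exact hv (congrArg Prod.snd h).symm

theorem continuous_lift :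
    Continuous (fun x : ℝ × ℂ => ν.toFun (Circle.exp x.1, x.2)) :=
  Continuous.subtype_mk ν.smooth.continuous _

/-- A point of the complement of `K`, on the boundary of the tubular neighbourhood of radius 1. -/
noncomputable def basePoint : {x : S3 // x ∉ K} := ⟨ν.toFun (1, 1), ν.notMem_core 1 one_ne_zero⟩

/-- The push-off of `K` that the framing defines, `t ↦ ν(t, 1)`. -/
noncomputable def longitude : Path ν.basePoint ν.basePoint where
  toFun s := ⟨ν.toFun (Circle.exp (2 * Real.pi * s), 1), ν.notMem_core _ one_ne_zero⟩
  continuous_toFun := by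
    refine Continuous.subtype_mk ?_ _
    exact ν.continuous_lift.comp
      (by fun_prop : Continuous fun s : unitInterval => ((2 * Real.pi * (s : ℝ), 1) : ℝ × ℂ))
  source' := by simp [basePoint]
  target' := by simp [basePoint]

/-- The meridian of `K`, `t ↦ ν(1, t)`. -/
noncomputable def meridian : Path ν.basePoint ν.basePoint where
  toFun s := ⟨ν.toFun (1, Circle.exp (2 * Real.pi * s)), ν.notMem_core _ (Circle.coe_ne_zero _)⟩
  continuous_toFun := by
    refine Continuous.subtype_mk ?_ _
    have h := ν.continuous_lift.comp
      (by fun_prop : Continuous fun s : unitInterval =>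
        (((0 : ℝ), ((Circle.exp (2 * Real.pi * (s : ℝ)) : Circle) : ℂ)) : ℝ × ℂ))
    simpa [Function.comp_def] using h
  source' := by simp [basePoint]
  target' := by simp [basePoint]

/-- The framing is `p`: the push-off has linking number `p` with `K`, which means that its class
in the first homology group of the complement of `K` (the abelianized fundamental group)
is `p` times the class of the meridian. -/
def HasFraming (p : ℤ) : Prop :=
  Abelianization.of (FundamentalGroup.fromPath (Path.Homotopic.Quotient.mk ν.longitude)) =
    Abelianization.of (FundamentalGroup.fromPath (Path.Homotopic.Quotient.mk ν.meridian)) ^ p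

/-- The gluing for the surgery: the point `ν(t, r u)` of the complement of `K` is identified
with the point `(r t, u⁻¹)` of an open solid torus `ℂ × S¹` (for `t`, `u` in `S¹` and `r > 0`).
So the push-off `t ↦ ν(t, r)` becomes a meridian, which bounds a disk in the
solid torus; and the identification preserves the orientations. -/
inductive SurgeryRel : ({x : S3 // x ∉ K} ⊕ (ℂ × Circle)) → ({x : S3 // x ∉ K} ⊕ (ℂ × Circle)) →
    Prop
  | glue (t u : Circle) (r : ℝ) (hr : 0 < r) : SurgeryRel
      (Sum.inl ⟨ν.toFun (t, (r : ℂ) * (u : ℂ)), ν.notMem_core t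
        (mul_ne_zero (Complex.ofReal_ne_zero.mpr hr.ne') (Circle.coe_ne_zero u))⟩)
      (Sum.inr ((r : ℂ) * (t : ℂ), u⁻¹))

/-- The closed 3-manifold that surgery along the framed knot produces. -/
def Surgery : Type := Quot ν.SurgeryRel

instance : TopologicalSpace ν.Surgery := inferInstanceAs (TopologicalSpace (Quot ν.SurgeryRel))

instance : OrientedSmooth ν.Surgery where
  IsPositive φ :=
    (∃ α : ℝ × ℂ → {x : S3 // x ∉ K}, IsPositiveInS3 (fun x => (α x).1) ∧
      φ =ᶠ[𝓝 0] fun x => Quot.mk _ (Sum.inl (α x))) ∨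
    (∃ β : ℝ × ℂ → ℂ × Circle, IsPositiveInSolidTorus β ∧
      φ =ᶠ[𝓝 0] fun x => Quot.mk _ (Sum.inr (β x)))

end FramedNhd

/-- The oriented manifold `Y` is `S³_p(K)`, up to orientation-preserving diffeomorphism. -/
def IsSurgery (p : ℤ) (K : Set S3) (Y : Type*) [TopologicalSpace Y] [OrientedSmooth Y] : Prop :=
  ∃ ν : FramedNhd K, ν.HasFraming p ∧ OrientedDiffeomorphic ν.Surgery Y

/-- `S³_p(K) ≅ S³_p(J)`, by an orientation-preserving diffeomorphism. -/
def SurgeriesDiffeomorphic (p : ℤ) (K J : Set S3) : Prop :=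
  ∃ ν : FramedNhd J, ν.HasFraming p ∧ IsSurgery p K ν.Surgery

/-! Arithmetic. The sequences `b` and `d` both solve u_{j+2} = (n+1) u_{j+1} - u_j. The determinant
formed from consecutive terms of the two is constant, which gives p = ab + 1 = cd - 1
(`polyB_mul_polyD_sub`); conserved quadratic forms give pq = b²d² - 1 and coprimality. Since cd ≡ 1
and b²d² ≡ 1 modulo p, it follows that c² ≡ b² modulo p.

Surgery. Let e = ±1 and p = ab + e. The circle acts by t·(z,w) = (t^a z, t^b w), and f = (√2 z)^b -
(√2 w)^a (`knotPoly`) vanishes on the sphere exactly along T_{a,b} and satisfies f(t·x) = t^{ab}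
f(x). With φ = f/|f|, the map x ↦ φ(x)^e · x of the knot complement to itself (`phaseRot`) is
invariant under the group μ_p of p-th roots of unity, because 1 + e·ab = e·p, and it identifies the
quotient of the complement by μ_p with the complement. So T_{a,b} has the same complement as its
image in S³/μ_p, a lens space. A tubular neighbourhood on whose slices f is a positive multiple of
the coordinate (`exists_knotPoly_knotSlice`) extends this over the solid torus glued in by the
surgery. For e = -1 the map reverses orientation, and a reflection of the sphere corrects this. The
outcome is L(ab+1, -b²) for e = 1 and L(ab-1, -a²) for e = -1 (`isSurgery_add_one`,
`isSurgery_sub_one`); by c² ≡ b² the two lens spaces agree. That the framing is ab + e rests on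
`segChar_longitude`: the push-off along the orbits is ab times the meridian in homology.

Nontriviality. In the complement of a trivial knot two loops with the same base point always span a
torus (`IsTrivialKnot.exists_torus`). For T_{a,b} with a, b ≥ 2 some pair does not: over the plane
covering such a torus take a b-th root v of Z^b - W^a, factor W^a = Z^b - v^b into Z - v and its
cofactor, and take a-th roots of the two factors simultaneously. Comparing the monodromy along two
opposite edges forces a ∣ b (`dvd_of_torus`). -/

/-! ### The tuples as polynomials -/

/-- The solution of `u (j + 2) = (X + 1) * u (j + 1) - u j` with `u 0 = 1` and given `u 1`. -/
noncomputable def recPoly (u : ℤ[X]) : ℕ → ℤ[X]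
  | 0 => 1
  | 1 => u
  | j + 2 => (Polynomial.X + 1) * recPoly u (j + 1) - recPoly u j

/-- `b_{j-1}`, as a polynomial. -/
noncomputable def polyB : ℕ → ℤ[X] := recPoly Polynomial.X

/-- `d_{j-1}`, as a polynomial. -/
noncomputable def polyD : ℕ → ℤ[X] := recPoly (Polynomial.X + 2)

theorem recPoly_monic (r : ℤ) (j : ℕ) :
    ((recPoly (Polynomial.X + Polynomial.C r) j).Monic ∧
      (recPoly (Polynomial.X + Polynomial.C r) j).natDegree = j) ∧
    ((recPoly (Polynomial.X + Polynomial.C r) (j + 1)).Monic ∧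
      (recPoly (Polynomial.X + Polynomial.C r) (j + 1)).natDegree = j + 1) := by
  induction j with
  | zero => exact ⟨⟨Polynomial.monic_one, Polynomial.natDegree_one⟩,
      Polynomial.monic_X_add_C r, Polynomial.natDegree_X_add_C r⟩
  | succ j ih =>
    refine ⟨ih.2, ?_⟩
    obtain ⟨⟨h1, h2⟩, h3, h4⟩ := ih
    have hX : (Polynomial.X + 1 : ℤ[X]).Monic := Polynomial.monic_X_add_C 1
    have hXd : (Polynomial.X + 1 : ℤ[X]).natDegree = 1 := Polynomial.natDegree_X_add_C 1
    have hd : ((Polynomial.X + 1) * recPoly (Polynomial.X + Polynomial.C r) (j + 1)).natDegree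
        = j + 1 + 1 := by
      rw [hX.natDegree_mul h3, hXd, h4]; ring
    have hlt : (recPoly (Polynomial.X + Polynomial.C r) j).natDegree <
        ((Polynomial.X + 1) * recPoly (Polynomial.X + Polynomial.C r) (j + 1)).natDegree := by
      omega
    refine ⟨(hX.mul h3).sub_of_left (Polynomial.degree_lt_degree hlt), ?_⟩
    show ((Polynomial.X + 1) * recPoly (Polynomial.X + Polynomial.C r) (j + 1) -
      recPoly (Polynomial.X + Polynomial.C r) j).natDegree = _
    rw [Polynomial.natDegree_sub_eq_left_of_natDegree_lt hlt, hd]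

theorem polyB_monic (j : ℕ) : (polyB j).Monic ∧ (polyB j).natDegree = j := by
  have h := (recPoly_monic 0 j).1
  rwa [Polynomial.C_0, add_zero] at h

theorem polyD_monic (j : ℕ) : (polyD j).Monic ∧ (polyD j).natDegree = j :=
  (recPoly_monic 2 j).1

theorem polyB_add_two (j : ℕ) :
    polyB (j + 2) = (Polynomial.X + 1) * polyB (j + 1) - polyB j := rfl

theorem polyD_add_two (j : ℕ) :
    polyD (j + 2) = (Polynomial.X + 1) * polyD (j + 1) - polyD j := rfl

/-- Casoratian of two solutions of one recurrence whose last coefficient is -1, hence constant. It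
expresses a_k b_k + 1 = c_k d_k - 1. -/
theorem polyB_mul_polyD_sub (j : ℕ) :
    polyB (j + 1) * polyD j - polyB j * polyD (j + 1) = -2 := by
  induction j with
  | zero => simp only [polyB, polyD, recPoly]; ring
  | succ j ih => rw [polyB_add_two, polyD_add_two]; linear_combination ih

/-- The form x² + y² - (X+1)xy is invariant under the step (x, y) ↦ ((X+1)x - y, x), so its initial
value persists. -/
theorem polyD_sq_sub (j : ℕ) :
    polyD (j + 1) ^ 2 + polyD j ^ 2 - (Polynomial.X + 1) * polyD (j + 1) * polyD j =
      Polynomial.X + 3 := by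
  induction j with
  | zero => simp only [polyD, recPoly]; ring
  | succ j ih => rw [polyD_add_two]; linear_combination ih

theorem polyB_sq_sub (j : ℕ) :
    polyB (j + 1) ^ 2 + polyB j ^ 2 - (Polynomial.X + 1) * polyB (j + 1) * polyB j =
      1 - Polynomial.X := by
  induction j with
  | zero => simp only [polyB, recPoly]; ring
  | succ j ih => rw [polyB_add_two]; linear_combination ih

/-- Both sides solve the same recurrence, so two initial checks suffice. The index 0 is excluded
because `j - 1` truncates there. -/
theorem X_add_three_mul_polyB (j : ℕ) :
    (Polynomial.X + 1) * polyD j - 2 * polyD (j - 1) = (Polynomial.X + 3) * polyB j ∨ j = 0 := by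
  rcases j with _ | j
  · exact .inr rfl
  left
  suffices h : ∀ j, ((Polynomial.X + 1) * polyD (j + 1) - 2 * polyD j =
      (Polynomial.X + 3) * polyB (j + 1)) ∧ ((Polynomial.X + 1) * polyD (j + 2) -
      2 * polyD (j + 1) = (Polynomial.X + 3) * polyB (j + 2)) from (h j).1
  intro j
  induction j with
  | zero => constructor <;> simp only [polyB, polyD, recPoly] <;> ring
  | succ j ih =>
    refine ⟨ih.2, ?_⟩
    rw [polyD_add_two (j + 1), polyB_add_two (j + 1)]
    have h2 := polyD_add_two j
    linear_combination (Polynomial.X + 1) * ih.2 - ih.1 - 2 * h2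

/-- The tuples as polynomials. -/
noncomputable def polyTuple : ℕ → Tuple ℤ[X]
  | 0 => ⟨-1, 1, 1, 1, 0, Polynomial.X + 1⟩
  | k + 1 => ⟨polyD k, polyB (k + 1), polyB k, polyD (k + 1), polyB (k + 1) * polyD k + 1,
      polyB (k + 2) * polyD (k + 1) + 1⟩

/-- The division defining q_k is exact by this identity; it is also the source of b²d² ≡ 1 modulo p.
-/
theorem polyB_mul_polyD_relation (k : ℕ) :
    (polyB (k + 1) * polyD k + 1) * (polyB (k + 2) * polyD (k + 1) + 1) =
      polyB (k + 1) ^ 2 * polyD (k + 1) ^ 2 - 1 := by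
  have h1 := polyB_mul_polyD_sub k
  have h2 := polyD_sq_sub k
  have h3 := (X_add_three_mul_polyB (k + 1)).resolve_right k.succ_ne_zero
  rw [Nat.add_sub_cancel] at h3
  rw [polyB_add_two]
  linear_combination (polyB (k + 1) * polyD k + 1) * h1 - polyB (k + 1) ^ 2 * h2 +
    polyB (k + 1) * h3

/-- Injectivity of `f` keeps the denominators nonzero. The exactness of the divisions is the
Casoratian identity for d and `polyB_mul_polyD_relation` for q. -/
theorem next_polyTuple {F : Type*} [Field F] (f : ℤ[X] →+* F) (hf : Function.Injective f)
    (j : ℕ) : ((polyTuple j).map f).next = (polyTuple (j + 1)).map f := by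
  have hB (i) : f (polyB i) ≠ 0 := fun h =>
    (polyB_monic i).1.ne_zero (hf (by rw [h, map_zero]))
  have hD (i) : f (polyD i) ≠ 0 := fun h =>
    (polyD_monic i).1.ne_zero (hf (by rw [h, map_zero]))
  rcases j with _ | k
  -- The tuple of index -1 does not follow the general pattern and is checked by hand.
  · have hX : f Polynomial.X + 1 ≠ 0 := fun h =>
      (Polynomial.monic_X_add_C (1 : ℤ)).ne_zero (hf (by simpa using h))
    simp only [Tuple.map, Tuple.next, polyTuple, polyB, polyD, recPoly, map_one, map_add, map_sub,
      map_mul, map_ofNat, map_zero, Tuple.mk.injEq]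
    refine ⟨trivial, by ring, trivial, by ring, by ring, ?_⟩
    rw [div_eq_iff hX]
    ring
  · have hpos : polyB (k + 2) * polyD (k + 1) + 1 ≠ 0 := by
      refine Polynomial.Monic.ne_zero ?_
      refine ((polyB_monic _).1.mul (polyD_monic _).1).add_of_left ?_
      refine Polynomial.degree_lt_degree ?_
      rw [Polynomial.natDegree_one, (polyB_monic _).1.natDegree_mul (polyD_monic _).1,
        (polyB_monic _).2]
      omega
    have hq : f (polyB (k + 2)) * f (polyD (k + 1)) + 1 ≠ 0 := fun h =>
      hpos (hf (by simpa using h))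
    have e1 : (f (polyB (k + 2)) * f (polyD (k + 1)) + 1 - 1) / f (polyD (k + 1)) =
        f (polyB (k + 2)) := by
      rw [add_sub_cancel_right, mul_div_cancel_right₀ _ (hD _)]
    have e2 : (f (polyB (k + 2)) * f (polyD (k + 1)) + 1 + 1) / f (polyB (k + 1)) =
        f (polyD (k + 2)) := by
      rw [div_eq_iff (hB _)]
      have h := congrArg f (polyB_mul_polyD_sub (k + 1))
      simp only [map_sub, map_mul, map_neg, map_ofNat] at h
      linear_combination h
    simp only [Tuple.map, Tuple.next, polyTuple, map_one, map_add, map_mul, e1, e2,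
      Tuple.mk.injEq, true_and]
    rw [div_eq_iff hq]
    have h := congrArg f (polyB_mul_polyD_relation (k + 1))
    simp only [map_sub, map_mul, map_add, map_pow, map_one] at h
    linear_combination -h

theorem ratTuple_eq_map (j : ℕ) :
    ratTuple j = (polyTuple j).map (algebraMap ℤ[X] (FractionRing ℤ[X])) := by
  induction j with
  | zero => simp [ratTuple, polyTuple, Tuple.map]
  | succ j ih =>
    rw [ratTuple, ih]
    exact next_polyTuple _ (IsFractionRing.injective ℤ[X] (FractionRing ℤ[X])) j

theorem polyTuple_p_monic (k : ℕ) : (polyB (k + 1) * polyD k + 1).Monic ∧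
    (polyB (k + 1) * polyD k + 1).natDegree = 2 * k + 1 := by
  have hd : (polyB (k + 1) * polyD k).natDegree = 2 * k + 1 := by
    rw [(polyB_monic _).1.natDegree_mul (polyD_monic _).1, (polyB_monic _).2, (polyD_monic _).2]
    ring
  have hlt : (1 : ℤ[X]).natDegree < (polyB (k + 1) * polyD k).natDegree := by
    rw [Polynomial.natDegree_one, hd]; omega
  refine ⟨((polyB_monic _).1.mul (polyD_monic _).1).add_of_left
    (Polynomial.degree_lt_degree hlt), ?_⟩
  rw [Polynomial.natDegree_add_eq_left_of_natDegree_lt hlt, hd]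

/-! ### The values at an integer -/

theorem recPoly_eval_lt {u : ℤ[X]} {n : ℤ} (hn : 2 ≤ n) (hu : 1 < u.eval n) (j : ℕ) :
    1 ≤ (recPoly u j).eval n ∧ (recPoly u j).eval n < (recPoly u (j + 1)).eval n := by
  induction j with
  | zero => simpa [recPoly] using hu
  | succ j ih =>
    refine ⟨by linarith [ih.1, ih.2], ?_⟩
    simp only [recPoly, Polynomial.eval_sub, Polynomial.eval_mul, Polynomial.eval_add,
      Polynomial.eval_X, Polynomial.eval_one]
    nlinarith [ih.1, ih.2]

/-- The difference d - b solves the same recurrence, starts at 0 and 2, and therefore increases. -/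
theorem polyB_eval_lt_polyD_eval {n : ℤ} (hn : 2 ≤ n) (j : ℕ) :
    (polyB (j + 1)).eval n < (polyD (j + 1)).eval n := by
  suffices h : (polyB j).eval n ≤ (polyD j).eval n ∧
      (polyD j).eval n - (polyB j).eval n <
        (polyD (j + 1)).eval n - (polyB (j + 1)).eval n by linarith [h.1, h.2]
  induction j with
  | zero => simp [polyB, polyD, recPoly]
  | succ j ih =>
    refine ⟨by linarith [ih.1, ih.2], ?_⟩
    simp only [polyB_add_two, polyD_add_two, Polynomial.eval_sub, Polynomial.eval_mul,
      Polynomial.eval_add, Polynomial.eval_X, Polynomial.eval_one]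
    nlinarith [ih.1, ih.2]

/-- Modulo n + 1 the recurrence is u_{j+2} = -u_j with initial values 1 and -1, so every term is ±1.
-/
theorem isCoprime_polyB_eval (n : ℤ) (j : ℕ) : IsCoprime ((polyB j).eval n) (n + 1) := by
  suffices h : IsCoprime ((polyB j).eval n) (n + 1) ∧
      IsCoprime ((polyB (j + 1)).eval n) (n + 1) from h.1
  induction j with
  | zero => exact ⟨by simpa [polyB, recPoly] using isCoprime_one_left,
      by simpa [polyB, recPoly] using ⟨-1, 1, by ring⟩⟩
  | succ j ih =>
    refine ⟨ih.2, ?_⟩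
    have h : (polyB (j + 2)).eval n = -(polyB j).eval n + (polyB (j + 1)).eval n * (n + 1) := by
      simp [polyB_add_two]; ring
    rw [h]
    exact (IsCoprime.neg_left ih.1).add_mul_right_left _

/-- Modulo a common divisor of x and w one has z² ≡ 1 - n, y² ≡ n + 3 and (yz)² ≡ 4. Since
(1-n)(n+3) = 4 - (n+1)², the divisor divides (n+1)², which is prime to x. The Bézout coefficients
below record this. -/
theorem isCoprime_of_sq_relations {x y z w n δ : ℤ} (hδ : δ ^ 2 = 4) (h1 : y * z - w * x = δ)
    (h2 : x ^ 2 + z ^ 2 - (n + 1) * x * z = 1 - n) (h3 : y ^ 2 + w ^ 2 - (n + 1) * y * w = n + 3)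
    (hx : IsCoprime x (n + 1)) : IsCoprime x w := by
  obtain ⟨r, s, hrs⟩ : IsCoprime x ((n + 1) ^ 2) := hx.pow_right
  refine ⟨r + s * (-(x - (n + 1) * z) * (n + 3) - 2 * δ * w - w ^ 2 * x),
    -s * z ^ 2 * (w - (n + 1) * y), ?_⟩
  linear_combination hrs - s * (-hδ + z ^ 2 * h3 + (n + 3) * h2 -
    (y * z + w * x + δ) * h1)

/-- The arithmetic of the values of the tuples. -/
theorem polyTuple_eval_facts {n : ℤ} (hn : 2 ≤ n) (k : ℕ) :
    ∃ a b c d : ℕ, (polyD (k + 1)).eval n = a ∧ (polyB (k + 2)).eval n = b ∧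
      (polyB (k + 1)).eval n = c ∧ (polyD (k + 2)).eval n = d ∧
      2 ≤ a ∧ 2 ≤ b ∧ 2 ≤ c ∧ 2 ≤ d ∧ c < a ∧ c < b ∧ b < d ∧
      IsCoprime (a : ℤ) b ∧ IsCoprime (c : ℤ) d ∧ (a * b + 1 : ℤ) = c * d - 1 ∧
      ∃ q : ℤ, (a * b + 1) * q = (b : ℤ) ^ 2 * (d : ℤ) ^ 2 - 1 := by
  have hB := recPoly_eval_lt (u := Polynomial.X) hn (by simpa using by omega)
  have hD := recPoly_eval_lt (u := Polynomial.X + 2) hn (by simpa using by omega)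
  have hB' (j : ℕ) : 2 ≤ (polyB (j + 1)).eval n := by have := hB j; unfold polyB; omega
  have hD' (j : ℕ) : 2 ≤ (polyD (j + 1)).eval n := by have := hD j; unfold polyD; omega
  have hBD := polyB_eval_lt_polyD_eval hn
  have hBB : (polyB (k + 1)).eval n < (polyB (k + 2)).eval n := (hB (k + 1)).2
  have h1 := congrArg (Polynomial.eval n) (polyB_mul_polyD_sub (k + 1))
  have h2 := congrArg (Polynomial.eval n) (polyB_sq_sub (k + 1))
  have h3 := congrArg (Polynomial.eval n) (polyD_sq_sub (k + 1))
  have h4 := congrArg (Polynomial.eval n) (polyB_mul_polyD_relation (k + 1))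
  simp only [Polynomial.eval_sub, Polynomial.eval_mul, Polynomial.eval_neg, Polynomial.eval_ofNat,
    Polynomial.eval_add, Polynomial.eval_X, Polynomial.eval_one, Polynomial.eval_pow,
    show k + 1 + 1 = k + 2 from rfl] at h1 h2 h3 h4
  obtain ⟨a, ha⟩ := Int.eq_ofNat_of_zero_le (by linarith [hD' k] : 0 ≤ (polyD (k + 1)).eval n)
  obtain ⟨b, hb⟩ := Int.eq_ofNat_of_zero_le
    (by linarith [hB' (k + 1)] : 0 ≤ (polyB (k + 2)).eval n)
  obtain ⟨c, hc⟩ := Int.eq_ofNat_of_zero_le (by linarith [hB' k] : 0 ≤ (polyB (k + 1)).eval n)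
  obtain ⟨d, hd⟩ := Int.eq_ofNat_of_zero_le
    (by linarith [hD' (k + 1)] : 0 ≤ (polyD (k + 2)).eval n)
  have e1 := hB' k
  have e2 := hB' (k + 1)
  have e3 := hD' k
  have e4 := hD' (k + 1)
  have e5 := hBD k
  have e6 := hBD (k + 1)
  have cb := isCoprime_polyB_eval n (k + 1)
  have cb' := isCoprime_polyB_eval n (k + 2)
  simp only [show k + 1 + 1 = k + 2 from rfl] at e2 e4 e6
  rw [hb, ha, hc, hd] at h1
  rw [hb, hc] at h2 hBB
  rw [hd, ha] at h3
  rw [hb, ha, hd] at h4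
  rw [hc] at e1 e5 cb
  rw [hb] at e2 e6 cb'
  rw [ha] at e3 e5
  rw [hd] at e4 e6
  refine ⟨a, b, c, d, ha, hb, hc, hd, by omega, by omega, by omega, by omega, by omega,
    by omega, by omega, ?_, ?_, by linarith, _, by rw [mul_comm (a : ℤ) b]; exact h4⟩
  -- The pairs (x, z) and (y, w) are consecutive values of `b` and of `d`; the second application
  -- reverses both pairs, which changes the sign of δ.
  · exact (isCoprime_of_sq_relations (x := b) (w := a) (y := d) (z := c) (n := n) (δ := 2)
      (by norm_num) (by linarith) (by linarith) (by linarith) cb').symm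
  · exact isCoprime_of_sq_relations (x := c) (w := d) (y := a) (z := b) (n := n) (δ := -2)
      (by norm_num) (by linarith) (by linarith) (by linarith) cb

/-! ### Frames -/

/-- The real coordinates of `ℂ²`, as a linear equivalence. -/
def realCoordsEquiv : (ℂ × ℂ) ≃ₗ[ℝ] (Fin 4 → ℝ) where
  toFun := realCoords
  invFun v := (⟨v 0, v 1⟩, ⟨v 2, v 3⟩)
  map_add' x y := by ext i; fin_cases i <;> simp [realCoords]
  map_smul' r x := by ext i; fin_cases i <;> simp [realCoords]
  left_inv x := by simp [realCoords]
  right_inv v := by ext i; fin_cases i <;> simp [realCoords]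

/-- The real coordinates of `ℝ × ℂ`, as a linear equivalence. -/
def realCoordsEquiv₃ : (ℝ × ℂ) ≃ₗ[ℝ] (Fin 3 → ℝ) where
  toFun x := ![x.1, x.2.re, x.2.im]
  invFun v := (v 0, ⟨v 1, v 2⟩)
  map_add' x y := by ext i; fin_cases i <;> simp
  map_smul' r x := by ext i; fin_cases i <;> simp
  left_inv x := by simp
  right_inv v := by ext i; fin_cases i <;> simp

/-- The standard basis of `ℂ² = ℝ⁴`. -/
noncomputable def basisC2 : Module.Basis (Fin 4) ℝ (ℂ × ℂ) := .ofEquivFun realCoordsEquiv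

/-- The standard basis of `ℝ × ℂ = ℝ³`. -/
noncomputable def basisRC : Module.Basis (Fin 3) ℝ (ℝ × ℂ) := .ofEquivFun realCoordsEquiv₃

theorem coe_basisRC : (basisRC : Fin 3 → ℝ × ℂ) = ![(1, 0), (0, 1), (0, Complex.I)] := by
  ext i <;> fin_cases i <;>
    simp [basisRC, Module.Basis.coe_ofEquivFun, realCoordsEquiv₃, Complex.ext_iff]

/-- The standard volume form of `ℂ² = ℝ⁴`. -/
noncomputable def volC2 : (ℂ × ℂ) [⋀^Fin 4]→ₗ[ℝ] ℝ :=
  Matrix.detRowAlternating.compLinearMap realCoordsEquiv.toLinearMap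

theorem volC2_apply (v : Fin 4 → ℂ × ℂ) :
    volC2 v = Matrix.det (Matrix.of fun i => realCoords (v i)) := rfl

/-- The determinant that `IsPositiveFrame` requires to be positive. -/
noncomputable def frameDet (N : ℂ × ℂ) (L : ℝ × ℂ →L[ℝ] ℂ × ℂ) : ℝ :=
  volC2 ![N, L (1, 0), L (0, 1), L (0, Complex.I)]

theorem isPositiveFrame_iff (N : ℂ × ℂ) (L : ℝ × ℂ →L[ℝ] ℂ × ℂ) :
    IsPositiveFrame N L ↔ 0 < frameDet N L := by
  rw [IsPositiveFrame, frameDet, volC2_apply]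
  refine iff_of_eq (congrArg (fun A => 0 < Matrix.det A) ?_)
  ext i j
  fin_cases i <;> rfl

/-- For fixed `N` the determinant is an alternating 3-form on `ℝ × ℂ` evaluated on the standard
basis, so precomposition scales it by the determinant of `B`. -/
theorem frameDet_comp (N : ℂ × ℂ) (L : ℝ × ℂ →L[ℝ] ℂ × ℂ) (B : ℝ × ℂ →L[ℝ] ℝ × ℂ) :
    frameDet N (L.comp B) = LinearMap.det (B : ℝ × ℂ →ₗ[ℝ] ℝ × ℂ) * frameDet N L := by
  set Ω : (ℝ × ℂ) [⋀^Fin 3]→ₗ[ℝ] ℝ := (volC2.curryLeft N).compLinearMap L.toLinearMap with hΩ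
  have key (L' : ℝ × ℂ →L[ℝ] ℂ × ℂ) : frameDet N L' =
      (volC2.curryLeft N).compLinearMap L'.toLinearMap basisRC := by
    rw [coe_basisRC, frameDet, AlternatingMap.compLinearMap_apply,
      AlternatingMap.curryLeft_apply_apply]
    congr 1
    ext i <;> fin_cases i <;> rfl
  rw [key, key]
  have e1 : (volC2.curryLeft N).compLinearMap (L.comp B).toLinearMap basisRC =
      Ω ((B : ℝ × ℂ →ₗ[ℝ] ℝ × ℂ) ∘ basisRC) := rfl
  rw [e1, Ω.eq_smul_basis_det basisRC]
  simp only [AlternatingMap.smul_apply, smul_eq_mul]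
  rw [Module.Basis.det_comp, Module.Basis.det_self]
  ring

theorem volC2_map (T : ℂ × ℂ →ₗ[ℝ] ℂ × ℂ) (v : Fin 4 → ℂ × ℂ) :
    volC2 (T ∘ v) = LinearMap.det T * volC2 v := by
  rw [volC2.eq_smul_basis_det basisC2]
  simp only [AlternatingMap.smul_apply, smul_eq_mul]
  rw [Module.Basis.det_comp]
  ring

theorem frameDet_map (N : ℂ × ℂ) (L : ℝ × ℂ →L[ℝ] ℂ × ℂ) (T : ℂ × ℂ →L[ℝ] ℂ × ℂ) :
    frameDet (T N) (T.comp L) = LinearMap.det (T : ℂ × ℂ →ₗ[ℝ] ℂ × ℂ) * frameDet N L := by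
  rw [frameDet, frameDet, ← volC2_map]
  congr 1
  ext i <;> fin_cases i <;> rfl

/-- The map `(r, x) ↦ r N + L x`. -/
noncomputable def frameMap (N : ℂ × ℂ) (L : ℝ × ℂ →L[ℝ] ℂ × ℂ) : ℝ × (ℝ × ℂ) →L[ℝ] ℂ × ℂ :=
  ((ContinuousLinearMap.id ℝ ℝ).smulRight N).coprod L

theorem frameMap_apply (N : ℂ × ℂ) (L : ℝ × ℂ →L[ℝ] ℂ × ℂ) (x : ℝ × (ℝ × ℂ)) :
    frameMap N L x = x.1 • N + L x.2 := by
  simp [frameMap]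

theorem frameMap_bijective {N : ℂ × ℂ} {L : ℝ × ℂ →L[ℝ] ℂ × ℂ} (h : frameDet N L ≠ 0) :
    Function.Bijective (frameMap N L) := by
  have hd : Module.finrank ℝ (ℝ × (ℝ × ℂ)) = Module.finrank ℝ (ℂ × ℂ) := by
    simp [Module.finrank_prod, Complex.finrank_real_complex]
  suffices hs : Function.Surjective (frameMap N L).toLinearMap from
    ⟨(LinearMap.injective_iff_surjective_of_finrank_eq_finrank hd).mpr hs, hs⟩
  rw [← LinearMap.range_eq_top, eq_top_iff]
  have hu : IsUnit (basisC2.det ![N, L (1, 0), L (0, 1), L (0, Complex.I)]) := by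
    rw [isUnit_iff_ne_zero]
    intro h0
    apply h
    rw [frameDet, volC2.eq_smul_basis_det basisC2, AlternatingMap.smul_apply, h0, smul_zero]
  rw [← ((Module.Basis.is_basis_iff_det basisC2).mpr hu).2, Submodule.span_le]
  rintro _ ⟨i, rfl⟩
  fin_cases i
  · exact ⟨(1, 0), by simp [frameMap]⟩
  · exact ⟨(0, (1, 0)), by simp [frameMap]⟩
  · exact ⟨(0, (0, 1)), by simp [frameMap]⟩
  · exact ⟨(0, (0, Complex.I)), by simp [frameMap]⟩

/-! ### Local inverses of parametrizations of the sphere -/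

/-- The square of the Euclidean norm of `ℂ²`. -/
noncomputable def sqNorm (x : ℂ × ℂ) : ℝ := ‖x.1‖ ^ 2 + ‖x.2‖ ^ 2

theorem sqNorm_smul (r : ℝ) (x : ℂ × ℂ) : sqNorm (r • x) = r ^ 2 * sqNorm x := by
  simp [sqNorm, mul_pow]; ring

/-- Thicken α radially to (r, x) ↦ (1 + r) α(x). Its derivative at 0 is `frameMap`, which is
bijective because the frame is positive, so the inverse function theorem applies in `ℂ²`. -/
theorem IsPositiveInS3.exists_local_inverse {α : ℝ × ℂ → S3} (h : IsPositiveInS3 α) :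
    ∃ ρ : ℂ × ℂ → ℝ × ℂ, ContDiffAt ℝ ∞ ρ (α 0).1 ∧ ρ (α 0).1 = 0 ∧
      (∀ᶠ x in 𝓝 0, ρ (α x).1 = x) ∧ ∀ᶠ y : S3 in 𝓝 (α 0), α (ρ y.1) = y := by
  obtain ⟨hc, hp⟩ := h
  rw [isPositiveFrame_iff] at hp
  set L := fderiv ℝ (fun x => (α x).1) 0 with hL
  set E : ℝ × (ℝ × ℂ) → ℂ × ℂ := fun x => (1 + x.1) • (α x.2).1 with hE
  have hα0 : ContDiffAt ℝ ∞ (fun x : ℝ × (ℝ × ℂ) => (α x.2).1) 0 :=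
    ContDiffAt.comp (0 : ℝ × (ℝ × ℂ)) (g := fun x => (α x).1) hc contDiffAt_snd
  have hEc : ContDiffAt ℝ ∞ E 0 := by
    exact ContDiffAt.smul (contDiffAt_const.add contDiffAt_fst) hα0
  let e : (ℝ × (ℝ × ℂ)) ≃L[ℝ] (ℂ × ℂ) :=
    ContinuousLinearEquiv.ofBijective (frameMap (α 0).1 L)
      (LinearMap.ker_eq_bot.mpr (frameMap_bijective hp.ne').1)
      (LinearMap.range_eq_top.mpr (frameMap_bijective hp.ne').2)
  have hEd : HasFDerivAt E (e : ℝ × (ℝ × ℂ) →L[ℝ] ℂ × ℂ) 0 := by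
    have h1 : HasFDerivAt (fun x : ℝ × (ℝ × ℂ) => (α x.2).1)
        (L.comp (ContinuousLinearMap.snd ℝ ℝ (ℝ × ℂ))) 0 :=
      HasFDerivAt.comp (0 : ℝ × (ℝ × ℂ)) (g := fun x => (α x).1)
        (hc.differentiableAt (by simp)).hasFDerivAt hasFDerivAt_snd
    have h2 : HasFDerivAt (fun x : ℝ × (ℝ × ℂ) => 1 + x.1)
        (ContinuousLinearMap.fst ℝ ℝ (ℝ × ℂ)) 0 := hasFDerivAt_fst.const_add 1
    refine (h2.smul h1).congr_fderiv ?_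
    refine ContinuousLinearMap.ext fun x => ?_
    show _ = frameMap (α 0).1 L x
    rw [frameMap_apply]
    simp [add_comm]
  have hE0 : E 0 = (α 0).1 := by simp [hE]
  set G := hEc.toOpenPartialHomeomorph E hEd (by simp) with hG
  have hGE : ∀ x, G x = E x := fun x => rfl
  have h0 : (0 : ℝ × (ℝ × ℂ)) ∈ G.source :=
    hEc.mem_toOpenPartialHomeomorph_source hEd (by simp)
  have h0' : (α 0).1 ∈ G.target := by rw [← hE0, ← hGE]; exact G.map_source h0
  have hG0 : G.symm (α 0).1 = 0 := by
    rw [← hE0, ← hGE]; exact G.left_inv h0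
  have hinv : ContDiffAt ℝ ∞ G.symm (α 0).1 := by
    have := hEc.to_localInverse hEd (by simp)
    rwa [hE0] at this
  refine ⟨fun y => (G.symm y).2, contDiffAt_snd.comp _ hinv, congrArg Prod.snd hG0, ?_, ?_⟩
  · have hcont : Filter.Tendsto (fun x : ℝ × ℂ => ((0 : ℝ), x)) (𝓝 0) (𝓝 0) :=
      (by fun_prop : Continuous fun x : ℝ × ℂ => ((0 : ℝ), x)).tendsto' _ _ rfl
    filter_upwards [hcont (G.open_source.mem_nhds h0)] with x hx
    have h3 : G (0, x) = (α x).1 := by rw [hGE]; simp [hE]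
    rw [← h3, G.left_inv hx]
  · have hcont : ContinuousAt (fun y : S3 => (G.symm y.1)) (α 0) :=
      ContinuousAt.comp (g := G.symm) hinv.continuousAt continuous_subtype_val.continuousAt
    have hpos : ∀ᶠ y : S3 in 𝓝 (α 0), 0 < 1 + (G.symm y.1).1 := by
      refine (continuousAt_const.add (continuous_fst.continuousAt.comp hcont)).eventually
        (lt_mem_nhds ?_)
      simp [Function.comp_def, hG0]
    have htar : ∀ᶠ y : S3 in 𝓝 (α 0), y.1 ∈ G.target :=
      continuous_subtype_val.continuousAt (G.open_target.mem_nhds h0')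
    filter_upwards [hpos, htar] with y hy1 hy2
    have h3 : (1 + (G.symm y.1).1) • (α (G.symm y.1).2).1 = y.1 := G.right_inv hy2
    -- Both points have norm 1, so the radial factor, positive near the base point, equals 1.
    have h4 : (1 + (G.symm y.1).1) ^ 2 = 1 := by
      have h5 := congrArg sqNorm h3
      rw [sqNorm_smul] at h5
      have h6 : sqNorm y.1 = 1 := y.2
      have h7 : sqNorm (α (G.symm y.1).2).1 = 1 := (α (G.symm y.1).2).2
      rw [h6, h7, mul_one] at h5
      exact h5
    have h5 : 1 + (G.symm y.1).1 = 1 := by nlinarith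
    rw [h5, one_smul] at h3
    exact Subtype.ext h3

theorem IsPositiveInS3.map_nhds {α : ℝ × ℂ → S3} (h : IsPositiveInS3 α) :
    Filter.map α (𝓝 0) = 𝓝 (α 0) := by
  obtain ⟨ρ, h1, h2, -, h4⟩ := h.exists_local_inverse
  refine le_antisymm ?_ ?_
  · have : ContinuousAt α 0 :=
      Topology.IsInducing.subtypeVal.continuousAt_iff.mpr h.1.continuousAt
    exact this
  · have hρ : Filter.Tendsto (fun y : S3 => ρ y.1) (𝓝 (α 0)) (𝓝 0) := by
      have := ContinuousAt.comp (g := ρ) (f := fun y : S3 => y.1) (x := α 0) h1.continuousAt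
        continuous_subtype_val.continuousAt
      rw [ContinuousAt] at this
      simpa [Function.comp_def, h2] using this
    intro s hs
    filter_upwards [hρ hs, h4] with y hy1 hy2
    rw [← hy2]
    exact hy1

/-! ### Changes of parametrization -/

theorem frameDet_chain {F : ℝ × ℂ → ℂ × ℂ} {T : ℂ × ℂ →L[ℝ] ℂ × ℂ} {b : ℝ × ℂ → ℝ × ℂ}
    {u : ℝ × ℂ} (hF : DifferentiableAt ℝ F (b u)) (hb : DifferentiableAt ℝ b u) :
    frameDet (T (F (b u))) (fderiv ℝ (fun x => T (F (b x))) u) =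
      LinearMap.det (T : ℂ × ℂ →ₗ[ℝ] ℂ × ℂ) * (LinearMap.det (fderiv ℝ b u : ℝ × ℂ →ₗ[ℝ] ℝ × ℂ) *
        frameDet (F (b u)) (fderiv ℝ F (b u))) := by
  have h : HasFDerivAt (fun x => T (F (b x))) (T.comp ((fderiv ℝ F (b u)).comp (fderiv ℝ b u))) u :=
    T.hasFDerivAt.comp u (hF.hasFDerivAt.comp u hb.hasFDerivAt)
  rw [h.fderiv, frameDet_map, frameDet_comp]

theorem isPositiveInS3_of_eventuallyEq {α : ℝ × ℂ → S3} {F : ℝ × ℂ → ℂ × ℂ}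
    (T : ℂ × ℂ →L[ℝ] ℂ × ℂ) {b : ℝ × ℂ → ℝ × ℂ}
    (heq : (fun x => (α x).1) =ᶠ[𝓝 0] fun x => T (F (b x)))
    (hF : ContDiffAt ℝ ∞ F (b 0)) (hb : ContDiffAt ℝ ∞ b 0)
    (hdet : 0 < LinearMap.det (T : ℂ × ℂ →ₗ[ℝ] ℂ × ℂ) *
      (LinearMap.det (fderiv ℝ b 0 : ℝ × ℂ →ₗ[ℝ] ℝ × ℂ) *
        frameDet (F (b 0)) (fderiv ℝ F (b 0)))) : IsPositiveInS3 α := by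
  refine ⟨(T.contDiff.contDiffAt.comp (0 : ℝ × ℂ) (hF.comp (0 : ℝ × ℂ) hb)).congr_of_eventuallyEq
    heq, ?_⟩
  rw [isPositiveFrame_iff, heq.fderiv_eq, heq.eq_of_nhds, frameDet_chain
    (hF.differentiableAt (by simp)) (hb.differentiableAt (by simp))]
  exact hdet

/-- The germ at the origin of an orientation-preserving local diffeomorphism of `ℝ × ℂ` that
fixes the origin. -/
structure IsReparam (b : ℝ × ℂ → ℝ × ℂ) : Prop where
  contDiffAt : ContDiffAt ℝ ∞ b 0
  map_zero : b 0 = 0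
  det_pos : 0 < LinearMap.det (fderiv ℝ b 0 : ℝ × ℂ →ₗ[ℝ] ℝ × ℂ)

theorem IsReparam.tendsto {b : ℝ × ℂ → ℝ × ℂ} (hb : IsReparam b) :
    Filter.Tendsto b (𝓝 0) (𝓝 0) := by
  have h := hb.contDiffAt.continuousAt
  rwa [ContinuousAt, hb.map_zero] at h

theorem IsPositiveInS3.frameDet_pos {α : ℝ × ℂ → S3} (h : IsPositiveInS3 α) :
    0 < frameDet (α 0).1 (fderiv ℝ (fun x => (α x).1) 0) :=
  (isPositiveFrame_iff _ _).mp h.2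

theorem IsPositiveInS3.congr {α α' : ℝ × ℂ → S3} (h : IsPositiveInS3 α) (e : α' =ᶠ[𝓝 0] α) :
    IsPositiveInS3 α' := by
  have e' : (fun x => (α' x).1) =ᶠ[𝓝 0] fun x => (α x).1 := e.mono fun x hx => by simp only [hx]
  refine ⟨h.1.congr_of_eventuallyEq e', ?_⟩
  rw [e'.fderiv_eq, e.eq_of_nhds]
  exact h.2

theorem IsPositiveInS3.map {α α' : ℝ × ℂ → S3} (h : IsPositiveInS3 α) {T : ℂ × ℂ →L[ℝ] ℂ × ℂ}
    (hT : 0 < LinearMap.det (T : ℂ × ℂ →ₗ[ℝ] ℂ × ℂ)) (e : ∀ x, (α' x).1 = T (α x).1) :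
    IsPositiveInS3 α' := by
  refine isPositiveInS3_of_eventuallyEq (F := fun x => (α x).1) (b := id) T
    (Filter.Eventually.of_forall e) h.1 contDiffAt_id ?_
  rw [fderiv_id]
  have := h.frameDet_pos
  simpa using mul_pos hT this

theorem IsPositiveInS3.comp {α : ℝ × ℂ → S3} (h : IsPositiveInS3 α) {b : ℝ × ℂ → ℝ × ℂ}
    (hb : IsReparam b) : IsPositiveInS3 (α ∘ b) := by
  refine isPositiveInS3_of_eventuallyEq (F := fun x => (α x).1) (b := b)
    (ContinuousLinearMap.id ℝ _) Filter.EventuallyEq.rfl (by rw [hb.map_zero]; exact h.1)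
    hb.contDiffAt ?_
  rw [hb.map_zero]
  simpa using mul_pos hb.det_pos h.frameDet_pos

theorem IsPositiveInSolidTorus.comp {β : ℝ × ℂ → ℂ × Circle} (h : IsPositiveInSolidTorus β)
    {b : ℝ × ℂ → ℝ × ℂ} (hb : IsReparam b) : IsPositiveInSolidTorus (β ∘ b) := by
  have h1 : ContDiffAt ℝ ∞ (fun x => ((β x).1, ((β x).2 : ℂ))) (b 0) := by
    rw [hb.map_zero]; exact h.1
  refine ⟨h1.comp (0 : ℝ × ℂ) hb.contDiffAt, ?_⟩
  have h2 : HasFDerivAt (fun x => ((β (b x)).1, ((β (b x)).2 : ℂ))) _ 0 :=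
    (h1.differentiableAt (by simp)).hasFDerivAt.comp (0 : ℝ × ℂ)
      (hb.contDiffAt.differentiableAt (by simp)).hasFDerivAt
  simp only [Function.comp_apply]
  rw [isPositiveFrame_iff, h2.fderiv, frameDet_comp, hb.map_zero]
  exact mul_pos hb.det_pos ((isPositiveFrame_iff _ _).mp h.2)

/-- The change of parameters is the local inverse of `α'` applied to `α`; its determinant is
positive as the ratio of two positive frame determinants. -/
theorem IsPositiveInS3.exists_reparam {α α' : ℝ × ℂ → S3} (h : IsPositiveInS3 α)
    (h' : IsPositiveInS3 α') (h0 : α 0 = α' 0) :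
    ∃ b, IsReparam b ∧ α =ᶠ[𝓝 0] α' ∘ b := by
  obtain ⟨ρ, h1, h2, -, h4⟩ := h'.exists_local_inverse
  have hcont : Filter.Tendsto α (𝓝 0) (𝓝 (α' 0)) := by rw [← h0, ← h.map_nhds]; exact le_rfl
  have hb : ContDiffAt ℝ ∞ (fun x => ρ (α x).1) 0 := by
    refine ContDiffAt.comp (g := ρ) (0 : ℝ × ℂ) ?_ h.1
    rw [h0]; exact h1
  have hb0 : ρ (α 0).1 = 0 := by rw [h0, h2]
  have heq : α =ᶠ[𝓝 0] α' ∘ fun x => ρ (α x).1 := (hcont.eventually h4).mono fun x hx => hx.symm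
  refine ⟨fun x => ρ (α x).1, ⟨hb, hb0, ?_⟩, heq⟩
  have e' : (fun x => (α x).1) =ᶠ[𝓝 0]
      fun x => (ContinuousLinearMap.id ℝ (ℂ × ℂ)) ((fun x => (α' x).1) (ρ (α x).1)) :=
    heq.mono fun x hx => congrArg Subtype.val hx
  have hp := h.frameDet_pos
  rw [e'.fderiv_eq, e'.eq_of_nhds, frameDet_chain (b := fun x => ρ (α x).1)
    (F := fun x => (α' x).1) (T := ContinuousLinearMap.id ℝ (ℂ × ℂ))
    (by rw [hb0]; exact h'.1.differentiableAt (by simp)) (hb.differentiableAt (by simp)),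
    hb0] at hp
  have hp' := h'.frameDet_pos
  simp only [ContinuousLinearMap.coe_id, LinearMap.det_id, one_mul] at hp
  exact pos_of_mul_pos_left hp hp'.le

/-! ### A parametrization around each point of the sphere -/

/-- A local parametrization of the sphere at `(1, 0)`. -/
noncomputable def stdParam (x : ℝ × ℂ) : ℂ × ℂ :=
  (√(1 + x.1 ^ 2 + ‖x.2‖ ^ 2))⁻¹ • ((1 + x.1 * Complex.I, x.2) : ℂ × ℂ)

theorem sqNorm_stdParam (x : ℝ × ℂ) : sqNorm (stdParam x) = 1 := by
  have h : 0 < 1 + x.1 ^ 2 + ‖x.2‖ ^ 2 := by positivity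
  have h1 : ‖(1 + x.1 * Complex.I : ℂ)‖ ^ 2 = 1 + x.1 ^ 2 := by
    rw [Complex.sq_norm, Complex.normSq_apply]; simp; ring
  rw [stdParam, sqNorm_smul, sqNorm, h1, inv_pow, Real.sq_sqrt h.le, inv_mul_cancel₀ h.ne']

/-- Left multiplication by the unit quaternion `y`, as a map of `ℂ²`. -/
noncomputable def quatMul (y : ℂ × ℂ) : ℂ × ℂ →L[ℝ] ℂ × ℂ :=
  LinearMap.toContinuousLinearMap
    { toFun := fun x => (y.1 * x.1 - starRingEnd ℂ y.2 * x.2, y.2 * x.1 + starRingEnd ℂ y.1 * x.2)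
      map_add' := fun x x' => by ext1 <;> simp <;> ring
      map_smul' := fun r x => by ext1 <;> simp <;> ring }

theorem quatMul_apply (y x : ℂ × ℂ) : quatMul y x =
    (y.1 * x.1 - starRingEnd ℂ y.2 * x.2, y.2 * x.1 + starRingEnd ℂ y.1 * x.2) := rfl

theorem sqNorm_quatMul (y x : ℂ × ℂ) : sqNorm (quatMul y x) = sqNorm y * sqNorm x := by
  simp only [quatMul_apply, sqNorm, Complex.sq_norm, Complex.normSq_apply]
  simp
  ring

theorem det_eq_volC2 (T : ℂ × ℂ →ₗ[ℝ] ℂ × ℂ) : LinearMap.det T =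
    volC2 ![T (1, 0), T (Complex.I, 0), T (0, 1), T (0, Complex.I)] := by
  have h := volC2_map T ![(1, 0), (Complex.I, 0), (0, 1), (0, Complex.I)]
  have h1 : volC2 ![(1, 0), (Complex.I, 0), (0, 1), (0, Complex.I)] = 1 := by
    rw [volC2_apply]
    convert Matrix.det_one (n := Fin 4) (R := ℝ)
    ext i j
    fin_cases i <;> fin_cases j <;> simp [realCoords]
  rw [h1, mul_one] at h
  rw [← h]
  congr 1
  ext i <;> fin_cases i <;> rfl

theorem det_fin_four (A : Matrix (Fin 4) (Fin 4) ℝ) : A.det =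
    A 0 0 * (A 1 1 * (A 2 2 * A 3 3 - A 2 3 * A 3 2) - A 1 2 * (A 2 1 * A 3 3 - A 2 3 * A 3 1)
      + A 1 3 * (A 2 1 * A 3 2 - A 2 2 * A 3 1))
    - A 0 1 * (A 1 0 * (A 2 2 * A 3 3 - A 2 3 * A 3 2) - A 1 2 * (A 2 0 * A 3 3 - A 2 3 * A 3 0)
      + A 1 3 * (A 2 0 * A 3 2 - A 2 2 * A 3 0))
    + A 0 2 * (A 1 0 * (A 2 1 * A 3 3 - A 2 3 * A 3 1) - A 1 1 * (A 2 0 * A 3 3 - A 2 3 * A 3 0)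
      + A 1 3 * (A 2 0 * A 3 1 - A 2 1 * A 3 0))
    - A 0 3 * (A 1 0 * (A 2 1 * A 3 2 - A 2 2 * A 3 1) - A 1 1 * (A 2 0 * A 3 2 - A 2 2 * A 3 0)
      + A 1 2 * (A 2 0 * A 3 1 - A 2 1 * A 3 0)) := by
  rw [Matrix.det_succ_row_zero]
  simp only [Fin.sum_univ_four, Matrix.det_fin_three, Matrix.submatrix_apply]
  simp [Fin.succAbove, Fin.lt_def]
  ring

theorem volC2_vec (x y z w : ℂ × ℂ) : volC2 ![x, y, z, w] =
    Matrix.det (Matrix.of ![realCoords x, realCoords y, realCoords z, realCoords w]) := by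
  rw [volC2_apply]
  congr 1
  ext i j
  fin_cases i <;> rfl

/-- Unit quaternions thus preserve orientation, so one parametrization at (1, 0) can be carried to
every point of the sphere. -/
theorem det_quatMul (y : ℂ × ℂ) :
    LinearMap.det (quatMul y : ℂ × ℂ →ₗ[ℝ] ℂ × ℂ) = sqNorm y ^ 2 := by
  rw [det_eq_volC2, volC2_vec, det_fin_four]
  simp only [sqNorm, Complex.sq_norm, Complex.normSq_apply]
  simp [realCoords, quatMul_apply]
  ring

/-- A local parametrization of the sphere at the point `y`. -/
noncomputable def sphereParam (y : S3) (x : ℝ × ℂ) : S3 :=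
  ⟨quatMul y.1 (stdParam x), by
    have h : sqNorm (quatMul y.1 (stdParam x)) = 1 := by
      rw [sqNorm_quatMul, sqNorm_stdParam, mul_one]; exact y.2
    exact h⟩

theorem sphereParam_zero (y : S3) : sphereParam y 0 = y := by
  apply Subtype.ext
  ext1 <;> simp [sphereParam, stdParam, quatMul_apply]

theorem contDiff_stdParam : ContDiff ℝ ∞ stdParam := by
  have h (x : ℝ × ℂ) : 1 + x.1 ^ 2 + ‖x.2‖ ^ 2 ≠ 0 := by positivity
  have h1 : ContDiff ℝ ∞ fun x : ℝ × ℂ => 1 + x.1 ^ 2 + ‖x.2‖ ^ 2 :=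
    (contDiff_const.add (contDiff_fst.pow 2)).add (contDiff_snd.norm_sq ℝ)
  refine ContDiff.smul ((h1.sqrt h).inv fun x => ?_) ?_
  · exact (Real.sqrt_pos.mpr (by positivity)).ne'
  · refine ContDiff.prodMk (contDiff_const.add (ContDiff.mul ?_ contDiff_const)) contDiff_snd
    exact Complex.ofRealCLM.contDiff.comp contDiff_fst

theorem frameDet_stdParam : frameDet (stdParam 0) (fderiv ℝ stdParam 0) = 1 := by
  -- The normalizing factor is stationary at the origin, so only the affine numerator contributes to
  -- the derivative.
  have h1 : HasFDerivAt (fun x : ℝ × ℂ => (√(1 + x.1 ^ 2 + ‖x.2‖ ^ 2))⁻¹)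
      (0 : ℝ × ℂ →L[ℝ] ℝ) 0 := by
    have h2 : HasFDerivAt (fun x : ℝ × ℂ => 1 + x.1 ^ 2 + ‖x.2‖ ^ 2) (0 : ℝ × ℂ →L[ℝ] ℝ) 0 := by
      have h3 : HasFDerivAt (fun x : ℝ × ℂ => ‖x.2‖ ^ 2) _ 0 :=
        (hasFDerivAt_snd (𝕜 := ℝ) (p := (0 : ℝ × ℂ))).norm_sq
      refine (((hasFDerivAt_fst (𝕜 := ℝ) (p := (0 : ℝ × ℂ))).pow 2).const_add 1 |>.add
        h3).congr_fderiv ?_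
      ext <;> simp
    have h4 := (hasDerivAt_inv (by simp)).comp_hasFDerivAt (0 : ℝ × ℂ) (h2.sqrt (by simp))
    refine h4.congr_fderiv ?_
    ext <;> simp
  set l : ℝ × ℂ →L[ℝ] ℂ × ℂ :=
    ((ContinuousLinearMap.fst ℝ ℝ ℂ).smulRight Complex.I).prod (ContinuousLinearMap.snd ℝ ℝ ℂ)
  have h2 : HasFDerivAt (fun x : ℝ × ℂ => ((1 + x.1 * Complex.I, x.2) : ℂ × ℂ)) l 0 := by
    refine HasFDerivAt.prodMk ?_ hasFDerivAt_snd
    refine HasFDerivAt.const_add 1 ?_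
    exact ((ContinuousLinearMap.fst ℝ ℝ ℂ).smulRight Complex.I).hasFDerivAt.congr_of_eventuallyEq
      (Filter.Eventually.of_forall fun x => by simp)
  have h3 : HasFDerivAt stdParam l 0 := by
    refine (h1.smul h2).congr_fderiv ?_
    ext <;> simp
  rw [h3.fderiv, frameDet, volC2_vec, det_fin_four]
  simp [realCoords, stdParam, l]

theorem isPositiveInS3_sphereParam (y : S3) : IsPositiveInS3 (sphereParam y) := by
  refine isPositiveInS3_of_eventuallyEq (F := stdParam) (b := id) (quatMul y.1)
    Filter.EventuallyEq.rfl contDiff_stdParam.contDiffAt contDiffAt_id ?_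
  have hy : sqNorm y.1 = 1 := y.2
  rw [fderiv_id, id, frameDet_stdParam, det_quatMul, hy]
  simp

/-! ### The circle action on the sphere, and lens spaces -/

/-- The diagonal map with entries `u`, `v`. -/
noncomputable def diagMap (u v : Circle) : ℂ × ℂ →L[ℝ] ℂ × ℂ :=
  LinearMap.toContinuousLinearMap
    { toFun := fun x => ((u : ℂ) * x.1, (v : ℂ) * x.2)
      map_add' := fun x x' => by ext1 <;> simp <;> ring
      map_smul' := fun r x => by ext1 <;> simp <;> ring }

theorem diagMap_apply (u v : Circle) (x : ℂ × ℂ) :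
    diagMap u v x = ((u : ℂ) * x.1, (v : ℂ) * x.2) := rfl

theorem sqNorm_diagMap (u v : Circle) (x : ℂ × ℂ) : sqNorm (diagMap u v x) = sqNorm x := by
  simp [sqNorm, diagMap_apply, Circle.norm_coe]

theorem det_diagMap (u v : Circle) :
    LinearMap.det (diagMap u v : ℂ × ℂ →ₗ[ℝ] ℂ × ℂ) = 1 := by
  have hu : (u : ℂ).re * (u : ℂ).re + (u : ℂ).im * (u : ℂ).im = 1 := by
    rw [← Complex.normSq_apply]; simp
  have hv : (v : ℂ).re * (v : ℂ).re + (v : ℂ).im * (v : ℂ).im = 1 := by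
    rw [← Complex.normSq_apply]; simp
  rw [det_eq_volC2, volC2_vec, det_fin_four]
  simp [realCoords, diagMap_apply]
  linear_combination ((v : ℂ).re * (v : ℂ).re + (v : ℂ).im * (v : ℂ).im) * hu + hv

/-- The diagonal map with entries `u`, `v` on the sphere. -/
noncomputable def diagS3 (u v : Circle) (x : S3) : S3 :=
  ⟨diagMap u v x.1, (sqNorm_diagMap u v x.1).trans x.2⟩

theorem lensRel_iff {p q : ℤ} {x y : S3} :
    lensRel p q x y ↔ ∃ ζ : Circle, ζ ^ p = 1 ∧ y = diagS3 ζ (ζ ^ q) x := by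
  simp only [lensRel, Subtype.ext_iff, Prod.ext_iff]
  rfl

theorem diagS3_mul (u v u' v' : Circle) (x : S3) :
    diagS3 u v (diagS3 u' v' x) = diagS3 (u * u') (v * v') x := by
  apply Subtype.ext
  simp [diagS3, diagMap_apply, mul_assoc]

theorem diagS3_one (x : S3) : diagS3 1 1 x = x := by
  apply Subtype.ext
  simp [diagS3, diagMap_apply]

theorem lensRel_equivalence (p q : ℤ) : Equivalence (lensRel p q) where
  refl x := lensRel_iff.mpr ⟨1, by simp, by simp [diagS3_one]⟩
  symm := fun {x y} h => by
    obtain ⟨ζ, h1, rfl⟩ := lensRel_iff.mp h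
    refine lensRel_iff.mpr ⟨ζ⁻¹, by simp [h1], ?_⟩
    rw [diagS3_mul, inv_zpow, inv_mul_cancel, inv_mul_cancel, diagS3_one]
  trans := fun {x y z} h h' => by
    obtain ⟨ζ, h1, rfl⟩ := lensRel_iff.mp h
    obtain ⟨ξ, h2, rfl⟩ := lensRel_iff.mp h'
    exact lensRel_iff.mpr ⟨ξ * ζ, by rw [mul_zpow, h1, h2, one_mul],
      by rw [diagS3_mul, mul_zpow]⟩

theorem lensMk_eq_iff {p q : ℤ} {x y : S3} :
    Quot.mk (lensRel p q) x = Quot.mk (lensRel p q) y ↔ lensRel p q x y := by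
  rw [Quot.eq, (lensRel_equivalence p q).eqvGen_iff]

/-- Lifts of the two germs differ at the origin by a diagonal unitary map, which has determinant 1;
after applying it the statement is the one for the sphere. -/
theorem LensSpace.exists_reparam {p q : ℤ} {φ φ' : ℝ × ℂ → LensSpace p q}
    (h : OrientedSmooth.IsPositive φ) (h' : OrientedSmooth.IsPositive φ') (h0 : φ 0 = φ' 0) :
    ∃ b, IsReparam b ∧ φ =ᶠ[𝓝 0] φ' ∘ b := by
  obtain ⟨α, hα, e⟩ := h
  obtain ⟨α', hα', e'⟩ := h'
  have h1 : lensRel p q (α 0) (α' 0) := by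
    rw [← lensMk_eq_iff]
    exact e.eq_of_nhds.symm.trans (h0.trans e'.eq_of_nhds)
  obtain ⟨ζ, hζ, h2⟩ := lensRel_iff.mp h1
  have hα2 : IsPositiveInS3 fun x => diagS3 ζ (ζ ^ q) (α x) :=
    hα.map (T := diagMap ζ (ζ ^ q)) (by rw [det_diagMap]; exact one_pos) fun x => rfl
  obtain ⟨b, hb, hb'⟩ := hα2.exists_reparam hα' h2.symm
  refine ⟨b, hb, ?_⟩
  filter_upwards [e, hb.tendsto.eventually e', hb'] with x h3 h4 h5
  rw [h3, Function.comp_apply, h4]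
  simp only [Function.comp_apply] at h5
  rw [← h5]
  exact lensMk_eq_iff.mpr (lensRel_iff.mpr ⟨ζ, hζ, rfl⟩)

/-! ### Comparing surgeries through a common lens space -/

namespace FramedNhd

variable {K : Set S3} (ν : FramedNhd K)

theorem isPositive_congr {φ φ' : ℝ × ℂ → ν.Surgery} (h : OrientedSmooth.IsPositive φ)
    (e : φ' =ᶠ[𝓝 0] φ) : OrientedSmooth.IsPositive φ' := by
  rcases h with ⟨α, h1, h2⟩ | ⟨β, h1, h2⟩
  · exact Or.inl ⟨α, h1, e.trans h2⟩
  · exact Or.inr ⟨β, h1, e.trans h2⟩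

theorem isPositive_comp {φ : ℝ × ℂ → ν.Surgery} (h : OrientedSmooth.IsPositive φ)
    {b : ℝ × ℂ → ℝ × ℂ} (hb : IsReparam b) : OrientedSmooth.IsPositive (φ ∘ b) := by
  rcases h with ⟨α, h1, h2⟩ | ⟨β, h1, h2⟩
  · exact Or.inl ⟨α ∘ b, h1.comp hb, hb.tendsto.eventually h2⟩
  · exact Or.inr ⟨β ∘ b, h1.comp hb, hb.tendsto.eventually h2⟩

/-- The parametrizations supplied by the two diffeomorphisms need not agree in the lens space; the
reparametrization between them is absorbed on the side of the surgery. -/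
theorem orientedDiffeomorphic_of_lensSpace {p q : ℤ} {Y : Type*} [TopologicalSpace Y]
    [OrientedSmooth Y] (h₁ : OrientedDiffeomorphic Y (LensSpace p q))
    (h₂ : OrientedDiffeomorphic ν.Surgery (LensSpace p q)) :
    OrientedDiffeomorphic Y ν.Surgery := by
  obtain ⟨f, hf⟩ := h₁
  obtain ⟨g, hg⟩ := h₂
  refine ⟨f.trans g.symm, fun y => ?_⟩
  obtain ⟨φ, h0, h1, h2⟩ := hf y
  obtain ⟨ψ, k0, k1, k2⟩ := hg (g.symm (f y))
  obtain ⟨b, hb, e⟩ := LensSpace.exists_reparam h2 k2 (by simp [h0, k0])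
  refine ⟨φ, h0, h1, ν.isPositive_congr (ν.isPositive_comp k1 hb) ?_⟩
  filter_upwards [e] with x hx
  simp only [Function.comp_apply] at hx
  simp [hx]

end FramedNhd

theorem surgeriesDiffeomorphic_of_lensSpace {p q : ℤ} {K J : Set S3}
    (hK : IsSurgery p K (LensSpace p q)) (hJ : IsSurgery p J (LensSpace p q)) :
    SurgeriesDiffeomorphic p K J := by
  obtain ⟨ν, hν, h1⟩ := hK
  obtain ⟨μ, hμ, h2⟩ := hJ
  exact ⟨μ, hμ, ν, hν, μ.orientedDiffeomorphic_of_lensSpace h1 h2⟩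

/-! ### A tubular neighbourhood of a torus knot -/

/-- The action of the circle on the sphere with weights `a`, `b`. -/
noncomputable def rotS3 (a b : ℕ) (t : Circle) (x : S3) : S3 := diagS3 (t ^ a) (t ^ b) x

theorem rotS3_mul (a b : ℕ) (t u : Circle) (x : S3) :
    rotS3 a b t (rotS3 a b u x) = rotS3 a b (t * u) x := by
  simp only [rotS3, diagS3_mul, mul_pow]

theorem rotS3_one (a b : ℕ) (x : S3) : rotS3 a b 1 x = x := by
  simp only [rotS3, one_pow, diagS3_one]

/-- The polynomial whose zero set in the sphere is the torus knot. -/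
noncomputable def knotPoly (a b : ℕ) (x : ℂ × ℂ) : ℂ :=
  ((√2 : ℝ) * x.1) ^ b - ((√2 : ℝ) * x.2) ^ a

theorem knotPoly_rotS3 (a b : ℕ) (t : Circle) (x : S3) :
    knotPoly a b (rotS3 a b t x).1 = ((t ^ (a * b) : Circle) : ℂ) * knotPoly a b x.1 := by
  simp only [knotPoly, rotS3, diagS3, diagMap_apply, Circle.coe_pow]
  ring

theorem Circle.eq_of_pow_eq {a b : ℕ} (h : Nat.Coprime a b) {t u : Circle} (ha : t ^ a = u ^ a)
    (hb : t ^ b = u ^ b) : t = u := by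
  have h1 : (t * u⁻¹) ^ a = 1 := by rw [mul_pow, ha, ← mul_pow, mul_inv_cancel, one_pow]
  have h2 : (t * u⁻¹) ^ b = 1 := by rw [mul_pow, hb, ← mul_pow, mul_inv_cancel, one_pow]
  have h3 : orderOf (t * u⁻¹) ∣ Nat.gcd a b :=
    Nat.dvd_gcd (orderOf_dvd_of_pow_eq_one h1) (orderOf_dvd_of_pow_eq_one h2)
  rw [h, Nat.dvd_one, orderOf_eq_one_iff] at h3
  exact mul_inv_eq_one.mp h3

/-- Take t = z^α w^β, where aα + bβ = 1. -/
theorem Circle.exists_pow_eq {a b : ℕ} (h : Nat.Coprime a b) {z w : Circle}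
    (e : z ^ b = w ^ a) : ∃ t : Circle, z = t ^ a ∧ w = t ^ b := by
  have hb : (1 : ℤ) = a * a.gcdA b + b * a.gcdB b := by
    rw [← Nat.gcd_eq_gcd_ab, h]; rfl
  have e' : z ^ (b : ℤ) = w ^ (a : ℤ) := by simpa using e
  refine ⟨z ^ a.gcdA b * w ^ a.gcdB b, ?_, ?_⟩
  · rw [← zpow_natCast, mul_zpow, ← zpow_mul, ← zpow_mul, mul_comm (a.gcdB b), zpow_mul w, ← e',
      ← zpow_mul, ← zpow_add]
    conv_lhs => rw [← zpow_one z, hb]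
    congr 1; ring
  · rw [← zpow_natCast, mul_zpow, ← zpow_mul, ← zpow_mul, mul_comm (a.gcdA b), zpow_mul z, e',
      ← zpow_mul, ← zpow_add]
    conv_lhs => rw [← zpow_one w, hb]
    congr 1; ring

theorem mem_torusKnot_iff {a b : ℕ} {x : S3} :
    x ∈ torusKnot a b ↔ ∃ t : Circle, (√2 : ℝ) * x.1.1 = ((t ^ a : Circle) : ℂ) ∧
      (√2 : ℝ) * x.1.2 = ((t ^ b : Circle) : ℂ) := by
  have h2 : ((√2 : ℝ) : ℂ) ≠ 0 := by simp
  refine exists_congr fun t => ?_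
  rw [eq_div_iff h2, eq_div_iff h2, mul_comm, mul_comm x.1.2, zpow_natCast, zpow_natCast]

/-- For the rescaled coordinates |z|² + |w|² = 2 and |z|^b = |w|^a. If one modulus were below 1, the
other would exceed 1, so both are 1, and coprimality produces the parameter. -/
theorem knotPoly_eq_zero_iff {a b : ℕ} (ha : a ≠ 0) (hb : b ≠ 0) (h : Nat.Coprime a b) {x : S3} :
    knotPoly a b x.1 = 0 ↔ x ∈ torusKnot a b := by
  rw [mem_torusKnot_iff, knotPoly, sub_eq_zero]
  constructor
  · intro e
    set z := ((√2 : ℝ) : ℂ) * x.1.1 with hz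
    set w := ((√2 : ℝ) : ℂ) * x.1.2 with hw
    have hx : ‖z‖ ^ 2 + ‖w‖ ^ 2 = 2 := by
      have := x.2
      rw [hz, hw, norm_mul, norm_mul, mul_pow, mul_pow, ← mul_add, this]
      simp
    have hn : ‖z‖ ^ b = ‖w‖ ^ a := by rw [← norm_pow, e, norm_pow]
    have hz1 : ‖z‖ = 1 := by
      rcases lt_trichotomy ‖z‖ 1 with h1 | h1 | h1
      · have h2 : 1 < ‖w‖ := by nlinarith [norm_nonneg z, norm_nonneg w]
        have h3 := pow_lt_one₀ (norm_nonneg z) h1 hb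
        have h4 := one_lt_pow₀ h2 ha
        linarith
      · exact h1
      · have h2 : ‖w‖ < 1 := by nlinarith [norm_nonneg z, norm_nonneg w]
        have h3 := pow_lt_one₀ (norm_nonneg w) h2 ha
        have h4 := one_lt_pow₀ h1 hb
        linarith
    have hw1 : ‖w‖ = 1 := by
      rw [hz1] at hx
      nlinarith [norm_nonneg w]
    obtain ⟨t, h1, h2⟩ := Circle.exists_pow_eq h
      (z := ⟨z, mem_sphere_zero_iff_norm.mpr hz1⟩) (w := ⟨w, mem_sphere_zero_iff_norm.mpr hw1⟩)
      (Subtype.ext (show z ^ b = w ^ a from e))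
    exact ⟨t, congrArg Subtype.val h1, congrArg Subtype.val h2⟩
  · rintro ⟨t, h1, h2⟩
    rw [h1, h2, Circle.coe_pow, Circle.coe_pow, ← pow_mul, ← pow_mul, mul_comm]

/-- The angle whose cosine and sine are the absolute values of the coordinates. -/
noncomputable def knotAngle (r : ℝ) : ℝ := Real.pi / 4 - Real.arctan r / 2

theorem knotAngle_pos (r : ℝ) : 0 < knotAngle r := by
  have := Real.arctan_lt_pi_div_two r
  unfold knotAngle; linarith

theorem knotAngle_lt (r : ℝ) : knotAngle r < Real.pi / 2 := by
  have := Real.neg_pi_div_two_lt_arctan r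
  unfold knotAngle; linarith

theorem cos_knotAngle_pos (r : ℝ) : 0 < Real.cos (knotAngle r) :=
  Real.cos_pos_of_mem_Ioo ⟨by linarith [knotAngle_pos r, Real.pi_pos], knotAngle_lt r⟩

theorem sin_knotAngle_pos (r : ℝ) : 0 < Real.sin (knotAngle r) :=
  Real.sin_pos_of_pos_of_lt_pi (knotAngle_pos r) (by linarith [knotAngle_lt r, Real.pi_pos])

theorem two_mul_cos_knotAngle_sq (r : ℝ) :
    (√2 * Real.cos (knotAngle r)) ^ 2 = 1 + Real.sin (Real.arctan r) := by
  rw [mul_pow, Real.sq_sqrt (by norm_num), Real.cos_sq, knotAngle,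
    show 2 * (Real.pi / 4 - Real.arctan r / 2) = Real.pi / 2 - Real.arctan r by ring,
    Real.cos_pi_div_two_sub]
  ring

theorem two_mul_sin_knotAngle_sq (r : ℝ) :
    (√2 * Real.sin (knotAngle r)) ^ 2 = 1 - Real.sin (Real.arctan r) := by
  rw [mul_pow, Real.sq_sqrt (by norm_num), Real.sin_sq, Real.cos_sq, knotAngle,
    show 2 * (Real.pi / 4 - Real.arctan r / 2) = Real.pi / 2 - Real.arctan r by ring,
    Real.cos_pi_div_two_sub]
  ring

/-- The sum of the absolute values of the two terms of `knotPoly`. -/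
noncomputable def knotSum (a b : ℕ) (r : ℝ) : ℝ :=
  (√2 * Real.cos (knotAngle r)) ^ b + (√2 * Real.sin (knotAngle r)) ^ a

theorem knotSum_pos (a b : ℕ) (r : ℝ) : 0 < knotSum a b r := by
  have := cos_knotAngle_pos r
  have := sin_knotAngle_pos r
  unfold knotSum; positivity

/-- The quotient of `(1 + s) ^ b - (1 - s) ^ a` by `s`, where `s` is the sine of `arctan r`. -/
noncomputable def knotQuot (a b : ℕ) (r : ℝ) : ℝ :=
  ∑ i ∈ Finset.range b, (1 + Real.sin (Real.arctan r)) ^ i +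
    ∑ i ∈ Finset.range a, (1 - Real.sin (Real.arctan r)) ^ i

theorem knotQuot_pos {a b : ℕ} (hb : b ≠ 0) (r : ℝ) : 0 < knotQuot a b r := by
  have h1 : 0 < 1 + Real.sin (Real.arctan r) := by
    rw [← two_mul_cos_knotAngle_sq]; have := cos_knotAngle_pos r; positivity
  have h2 : 0 < 1 - Real.sin (Real.arctan r) := by
    rw [← two_mul_sin_knotAngle_sq]; have := sin_knotAngle_pos r; positivity
  refine add_pos_of_pos_of_nonneg ?_ (Finset.sum_nonneg fun i _ => by positivity)
  exact Finset.sum_pos (fun i _ => by positivity) (Finset.nonempty_range_iff.mpr hb)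

/-- With C, D the two terms of `knotSum`, C² = (1+s)^b and D² = (1-s)^a. The difference C² - D² =
(C-D)(C+D) vanishes at s = 0, and dividing by s gives two geometric sums. -/
theorem sin_arctan_mul_knotQuot (a b : ℕ) (r : ℝ) :
    Real.sin (Real.arctan r) * knotQuot a b r =
      ((√2 * Real.cos (knotAngle r)) ^ b - (√2 * Real.sin (knotAngle r)) ^ a) *
        knotSum a b r := by
  have h1 := mul_geom_sum (1 + Real.sin (Real.arctan r)) b
  have h2 := mul_geom_sum (1 - Real.sin (Real.arctan r)) a
  have h3 : ((√2 * Real.cos (knotAngle r)) ^ b - (√2 * Real.sin (knotAngle r)) ^ a) *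
        knotSum a b r = (1 + Real.sin (Real.arctan r)) ^ b - (1 - Real.sin (Real.arctan r)) ^ a := by
    rw [← two_mul_cos_knotAngle_sq, ← two_mul_sin_knotAngle_sq, knotSum]; ring
  rw [h3, knotQuot]
  linear_combination h1 - h2

/-- The factor that relates the second coordinate on the slice to an angle. -/
noncomputable def knotScale (a b : ℕ) (r : ℝ) : ℝ :=
  knotQuot a b r * Real.cos (Real.arctan r) / knotSum a b r ^ 2

theorem knotScale_pos {a b : ℕ} (hb : b ≠ 0) (r : ℝ) : 0 < knotScale a b r := by
  have := knotQuot_pos (a := a) hb r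
  have := knotSum_pos a b r
  have := Real.cos_arctan_pos r
  unfold knotScale; positivity

/-- The angle coordinate on the slice. -/
noncomputable def knotTilt (a b : ℕ) (v : ℂ) : ℝ := Real.arctan (knotScale a b v.re * v.im)

/-- A neighbourhood of the torus knot in angular coordinates. -/
noncomputable def angularNhd (a b : ℕ) (x : ℝ × ℂ) : ℂ × ℂ :=
  (Real.cos x.2.re * Complex.exp ((a * x.1 + x.2.im / b : ℝ) * Complex.I),
    Real.sin x.2.re * Complex.exp ((b * x.1 - x.2.im / a : ℝ) * Complex.I))

/-- The change to angular coordinates. -/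
noncomputable def toAngular (a b : ℕ) (x : ℝ × ℂ) : ℝ × ℂ :=
  (x.1, ⟨knotAngle x.2.re, knotTilt a b x.2⟩)

/-- A neighbourhood of the torus knot in `ℂ²`, parametrized by `ℝ × ℂ`. -/
noncomputable def knotNhdLift (a b : ℕ) (x : ℝ × ℂ) : ℂ × ℂ := angularNhd a b (toAngular a b x)

theorem sqNorm_angularNhd (a b : ℕ) (x : ℝ × ℂ) : sqNorm (angularNhd a b x) = 1 := by
  simp only [sqNorm, angularNhd, norm_mul, Complex.norm_exp_ofReal_mul_I, mul_one,
    Complex.norm_real, Real.norm_eq_abs, sq_abs]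
  exact Real.cos_sq_add_sin_sq _

/-- The slice of the tubular neighbourhood through one point of the knot. -/
noncomputable def knotSlice (a b : ℕ) (v : ℂ) : S3 :=
  ⟨knotNhdLift a b (0, v), sqNorm_angularNhd a b _⟩

/-- A tubular neighbourhood of the torus knot, with the framing defined by the torus. -/
noncomputable def knotNhd (a b : ℕ) (x : Circle × ℂ) : S3 := rotS3 a b x.1 (knotSlice a b x.2)

theorem knotNhd_exp (a b : ℕ) (θ : ℝ) (v : ℂ) :
    (knotNhd a b (Circle.exp θ, v)).1 = knotNhdLift a b (θ, v) := by
  ext1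
  · simp only [knotNhd, rotS3, diagS3, diagMap_apply, knotSlice, knotNhdLift, angularNhd,
      toAngular, Circle.coe_pow, Circle.coe_exp, ← Complex.exp_nat_mul]
    rw [mul_left_comm, ← Complex.exp_add]
    congr 2; push_cast; ring
  · simp only [knotNhd, rotS3, diagS3, diagMap_apply, knotSlice, knotNhdLift, angularNhd,
      toAngular, Circle.coe_pow, Circle.coe_exp, ← Complex.exp_nat_mul]
    rw [mul_left_comm, ← Complex.exp_add]
    congr 2; push_cast; ring

/-- The value of f on the slice is (C-D) cos y + i (C+D) sin y. `knotScale` is chosen so that the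
ratio of the imaginary to the real part is that of v. Hence f has the phase of v, which is what
makes the two pieces of the map to the lens space fit. -/
theorem exists_knotPoly_knotSlice {a b : ℕ} (ha : a ≠ 0) (hb : b ≠ 0) (v : ℂ) :
    ∃ c : ℝ, 0 < c ∧ knotPoly a b (knotSlice a b v).1 = c * v := by
  set r := v.re with hr
  set y := knotTilt a b v with hy
  have hG := knotSum_pos a b r
  have hcy : 0 < Real.cos y := Real.cos_arctan_pos _
  have hcr := Real.cos_arctan_pos r
  have hQ := knotQuot_pos (a := a) hb r
  refine ⟨knotQuot a b r * Real.cos (Real.arctan r) * Real.cos y / knotSum a b r,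
    by positivity, ?_⟩
  set C := (√2 * Real.cos (knotAngle r)) ^ b with hC
  set D := (√2 * Real.sin (knotAngle r)) ^ a with hD
  have h1 : knotPoly a b (knotSlice a b v).1 =
      C * Complex.exp (y * Complex.I) - D * Complex.exp ((-y : ℝ) * Complex.I) := by
    simp only [knotPoly, knotSlice, knotNhdLift, angularNhd, toAngular, mul_zero, zero_add,
      zero_sub, ← mul_assoc]
    rw [mul_pow _ (Complex.exp _), mul_pow _ (Complex.exp _), ← Complex.exp_nat_mul,
      ← Complex.exp_nat_mul, hC, hD]
    have ha' : (a : ℂ) ≠ 0 := Nat.cast_ne_zero.mpr ha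
    have hb' : (b : ℂ) ≠ 0 := Nat.cast_ne_zero.mpr hb
    push_cast
    congr 3
    · field_simp
      rfl
    · field_simp
      rfl
  have hs := sin_arctan_mul_knotQuot a b r
  have hsc : Real.sin (Real.arctan r) = Real.cos (Real.arctan r) * r := by
    conv_rhs => rw [← Real.tan_arctan r]
    rw [Real.tan_arctan, ← Real.tan_mul_cos hcr.ne', Real.tan_arctan, mul_comm]
  have hsy : Real.sin y = knotScale a b r * v.im * Real.cos y := by
    rw [← Real.tan_mul_cos hcy.ne', hy, knotTilt, Real.tan_arctan]
  have hGe : knotSum a b r = C + D := rfl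
  rw [← hC, ← hD] at hs
  rw [h1, Complex.exp_mul_I, Complex.exp_mul_I, ← Complex.ofReal_cos, ← Complex.ofReal_sin,
    ← Complex.ofReal_cos, ← Complex.ofReal_sin, Real.cos_neg, Real.sin_neg]
  apply Complex.ext
  · simp only [Complex.sub_re, Complex.re_ofReal_mul, Complex.add_re, Complex.ofReal_re,
      Complex.mul_I_re, Complex.ofReal_im, neg_zero, add_zero]
    field_simp
    rw [← hr]
    rw [hsc] at hs
    linear_combination -hs
  · simp only [Complex.sub_im, Complex.im_ofReal_mul, Complex.add_im, Complex.ofReal_im,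
      Complex.mul_I_im, Complex.ofReal_re, zero_add]
    rw [hsy, knotScale, hGe]
    rw [hGe] at hG
    field_simp
    ring

/-- The moduli of the coordinates determine Re v, the phases determine the tilt, and coprimality
then determines t. -/
theorem knotNhd_injective {a b : ℕ} (ha : a ≠ 0) (hb : b ≠ 0) (h : Nat.Coprime a b) :
    Function.Injective (knotNhd a b) := by
  rintro ⟨t, v⟩ ⟨t', v'⟩ e
  have e1 := congrArg (fun x : S3 => x.1.1) e
  have e2 := congrArg (fun x : S3 => x.1.2) e
  simp only [knotNhd, rotS3, diagS3, diagMap_apply, knotSlice, knotNhdLift, angularNhd,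
      toAngular, mul_zero, zero_add, zero_sub] at e1 e2
  have hre : v.re = v'.re := by
    have h1 := congrArg norm e1
    simp only [norm_mul, Complex.norm_exp_ofReal_mul_I, mul_one, Circle.norm_coe, one_mul,
      Complex.norm_real, Real.norm_eq_abs, abs_of_pos (cos_knotAngle_pos _)] at h1
    have h2 := Real.injOn_cos ⟨(knotAngle_pos _).le, by linarith [knotAngle_lt v.re, Real.pi_pos]⟩
      ⟨(knotAngle_pos _).le, by linarith [knotAngle_lt v'.re, Real.pi_pos]⟩ h1
    exact Real.arctan_injective (by unfold knotAngle at h2; linarith)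
  rw [hre] at e1 e2
  have hc : ((Real.cos (knotAngle v'.re) : ℝ) : ℂ) ≠ 0 :=
    Complex.ofReal_ne_zero.mpr (cos_knotAngle_pos _).ne'
  have hs : ((Real.sin (knotAngle v'.re) : ℝ) : ℂ) ≠ 0 :=
    Complex.ofReal_ne_zero.mpr (sin_knotAngle_pos _).ne'
  simp only [mul_left_comm _ ((Real.cos (knotAngle v'.re) : ℝ) : ℂ),
    mul_right_inj' hc] at e1
  simp only [mul_left_comm _ ((Real.sin (knotAngle v'.re) : ℝ) : ℂ),
    mul_right_inj' hs] at e2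
  have c1 : t ^ a * Circle.exp (knotTilt a b v / b) = t' ^ a * Circle.exp (knotTilt a b v' / b) := by
    apply Subtype.ext
    simpa only [Circle.coe_mul, Circle.coe_exp] using e1
  have c2 : t ^ b * Circle.exp (-(knotTilt a b v / a)) =
      t' ^ b * Circle.exp (-(knotTilt a b v' / a)) := by
    apply Subtype.ext
    simpa only [Circle.coe_mul, Circle.coe_exp] using e2
  have ha' : (a : ℝ) ≠ 0 := Nat.cast_ne_zero.mpr ha
  have hb' : (b : ℝ) ≠ 0 := Nat.cast_ne_zero.mpr hb
  have d1 := congrArg (fun x => x ^ b) c1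
  have d2 := congrArg (fun x => x ^ a) c2
  simp only [mul_pow, ← pow_mul, ← Circle.exp_nsmul, nsmul_eq_mul] at d1 d2
  rw [mul_div_cancel₀ _ hb', mul_div_cancel₀ _ hb'] at d1
  rw [mul_neg, mul_neg, mul_div_cancel₀ _ ha', mul_div_cancel₀ _ ha', Circle.exp_neg,
    Circle.exp_neg, mul_comm b a] at d2
  -- Dividing the b-th power of the first phase by the a-th power of the second eliminates t. The
  -- remaining angle, twice an arctangent, lies in (-π, π) and is determined.
  have d3 : Circle.exp (2 * knotTilt a b v) = Circle.exp (2 * knotTilt a b v') := by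
    have := congrArg₂ (· / ·) d1 d2
    simp only [mul_div_mul_left_eq_div, div_inv_eq_mul] at this
    rw [two_mul, two_mul, Circle.exp_add, Circle.exp_add, this]
  have l1 := Real.arctan_lt_pi_div_two (knotScale a b v.re * v.im)
  have l2 := Real.neg_pi_div_two_lt_arctan (knotScale a b v.re * v.im)
  have l3 := Real.arctan_lt_pi_div_two (knotScale a b v'.re * v'.im)
  have l4 := Real.neg_pi_div_two_lt_arctan (knotScale a b v'.re * v'.im)
  have hy : knotTilt a b v = knotTilt a b v' := by
    have h3 := congrArg (fun z : Circle => Complex.arg z) d3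
    simp only [knotTilt] at h3
    rw [Circle.arg_exp (by linarith) (by linarith), Circle.arg_exp (by linarith) (by linarith)]
      at h3
    unfold knotTilt
    linarith
  rw [hy] at c1 c2
  have ht : t = t' := Circle.eq_of_pow_eq h (mul_right_cancel c1) (mul_right_cancel c2)
  refine Prod.ext ht (Complex.ext hre ?_)
  have h3 := Real.arctan_injective hy
  rw [hre] at h3
  exact mul_left_cancel₀ (knotScale_pos hb _).ne' h3

/-! ### The tubular neighbourhood is smooth and preserves the orientation -/

theorem contDiff_angularNhd (a b : ℕ) : ContDiff ℝ ∞ (angularNhd a b) := by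
  have hre : ContDiff ℝ ∞ fun x : ℝ × ℂ => x.2.re := Complex.reCLM.contDiff.comp contDiff_snd
  have him : ContDiff ℝ ∞ fun x : ℝ × ℂ => x.2.im := Complex.imCLM.contDiff.comp contDiff_snd
  have hof {f : ℝ × ℂ → ℝ} (hf : ContDiff ℝ ∞ f) : ContDiff ℝ ∞ fun x => (f x : ℂ) :=
    Complex.ofRealCLM.contDiff.comp hf
  refine ContDiff.prodMk ((hof (Real.contDiff_cos.comp hre)).mul ?_)
    ((hof (Real.contDiff_sin.comp hre)).mul ?_)
  · exact ContDiff.cexp ((hof ((contDiff_const.mul contDiff_fst).add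
      (him.div_const _))).mul contDiff_const)
  · exact ContDiff.cexp ((hof ((contDiff_const.mul contDiff_fst).sub
      (him.div_const _))).mul contDiff_const)

theorem contDiff_knotAngle : ContDiff ℝ ∞ knotAngle :=
  contDiff_const.sub (Real.contDiff_arctan.div_const _)

theorem contDiff_knotScale (a b : ℕ) : ContDiff ℝ ∞ (knotScale a b) := by
  have hs : ContDiff ℝ ∞ fun r : ℝ => Real.sin (Real.arctan r) :=
    Real.contDiff_sin.comp Real.contDiff_arctan
  have hc : ContDiff ℝ ∞ fun r : ℝ => Real.cos (Real.arctan r) :=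
    Real.contDiff_cos.comp Real.contDiff_arctan
  have hc' : ContDiff ℝ ∞ fun r : ℝ => Real.cos (knotAngle r) :=
    Real.contDiff_cos.comp contDiff_knotAngle
  have hs' : ContDiff ℝ ∞ fun r : ℝ => Real.sin (knotAngle r) :=
    Real.contDiff_sin.comp contDiff_knotAngle
  refine ContDiff.div (ContDiff.mul ?_ hc) ?_ fun r => (pow_pos (knotSum_pos a b r) 2).ne'
  · exact (ContDiff.sum fun i _ => (contDiff_const.add hs).pow i).add
      (ContDiff.sum fun i _ => (contDiff_const.sub hs).pow i)
  · exact (((contDiff_const.mul hc').pow b).add ((contDiff_const.mul hs').pow a)).pow 2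

theorem contDiff_toAngular (a b : ℕ) : ContDiff ℝ ∞ (toAngular a b) := by
  have hre : ContDiff ℝ ∞ fun x : ℝ × ℂ => x.2.re := Complex.reCLM.contDiff.comp contDiff_snd
  have him : ContDiff ℝ ∞ fun x : ℝ × ℂ => x.2.im := Complex.imCLM.contDiff.comp contDiff_snd
  have hof {f : ℝ × ℂ → ℝ} (hf : ContDiff ℝ ∞ f) : ContDiff ℝ ∞ fun x => (f x : ℂ) :=
    Complex.ofRealCLM.contDiff.comp hf
  refine ContDiff.prodMk contDiff_fst ?_
  have h : ContDiff ℝ ∞ fun x : ℝ × ℂ =>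
      (knotAngle x.2.re : ℂ) + (knotTilt a b x.2 : ℂ) * Complex.I :=
    (hof (contDiff_knotAngle.comp hre)).add ((hof (Real.contDiff_arctan.comp
      (((contDiff_knotScale a b).comp hre).mul him))).mul contDiff_const)
  convert h using 2 with x
  exact Complex.mk_eq_add_mul_I _ _

theorem contDiff_knotNhdLift (a b : ℕ) : ContDiff ℝ ∞ (knotNhdLift a b) :=
  (contDiff_angularNhd a b).comp (contDiff_toAngular a b)

theorem fderiv_eq_of_hasLineDerivAt {E F : Type*} [NormedAddCommGroup E] [NormedSpace ℝ E]
    [NormedAddCommGroup F] [NormedSpace ℝ F] {f : E → F} {x v : E} {d : F}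
    (hf : DifferentiableAt ℝ f x) (h : HasDerivAt (fun t : ℝ => f (x + t • v)) d 0) :
    fderiv ℝ f x v = d :=
  HasLineDerivAt.unique (hf.hasFDerivAt.hasLineDerivAt v) h

theorem hasDerivAt_cexp_line (u k : ℝ) :
    HasDerivAt (fun t : ℝ => Complex.exp ((u + k * t : ℝ) * Complex.I))
      (k * Complex.I * Complex.exp (u * Complex.I)) 0 := by
  have h1 : HasDerivAt (fun t : ℝ => ((u + k * t : ℝ) : ℂ) * Complex.I) ((k : ℝ) * Complex.I) 0 := by
    have h2 : HasDerivAt (fun t : ℝ => u + k * t) k 0 := by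
      simpa using ((hasDerivAt_id (0 : ℝ)).const_mul k).const_add u
    exact h2.ofReal_comp.mul_const Complex.I
  simpa [mul_comm] using h1.cexp

/-- The negative sign is compensated by `toAngular`, whose angle `knotAngle` decreases. -/
theorem frameDet_angularNhd {a b : ℕ} (ha : a ≠ 0) (hb : b ≠ 0) (x : ℝ × ℂ) :
    frameDet (angularNhd a b x) (fderiv ℝ (angularNhd a b) x) =
      -(2 * Real.cos x.2.re * Real.sin x.2.re) := by
  have hd := (contDiff_angularNhd a b).differentiable (by simp) x
  set A := a * x.1 + x.2.im / b with hA
  set B := b * x.1 - x.2.im / a with hB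
  have h1 : fderiv ℝ (angularNhd a b) x (1, 0) =
      (Real.cos x.2.re * ((a : ℝ) * Complex.I * Complex.exp (A * Complex.I)),
        Real.sin x.2.re * ((b : ℝ) * Complex.I * Complex.exp (B * Complex.I))) := by
    refine fderiv_eq_of_hasLineDerivAt hd ?_
    have := ((hasDerivAt_cexp_line A a).const_mul (Real.cos x.2.re : ℂ)).prodMk
      ((hasDerivAt_cexp_line B b).const_mul (Real.sin x.2.re : ℂ))
    refine this.congr_of_eventuallyEq (Filter.Eventually.of_forall fun t => ?_)
    simp only [angularNhd, hA, hB, Prod.fst_add, Prod.snd_add, Prod.smul_fst, Prod.smul_snd,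
      smul_zero, add_zero, smul_eq_mul, mul_one]
    congr 5 <;> ring
  have h2 : fderiv ℝ (angularNhd a b) x (0, 1) =
      (((-Real.sin x.2.re : ℝ) : ℂ) * Complex.exp (A * Complex.I),
        Real.cos x.2.re * Complex.exp (B * Complex.I)) := by
    refine fderiv_eq_of_hasLineDerivAt hd ?_
    have hl : HasDerivAt (fun t : ℝ => x.2.re + t) 1 0 := (hasDerivAt_id (0 : ℝ)).const_add _
    have hc : HasDerivAt (fun t : ℝ => Real.cos (x.2.re + t)) (-Real.sin x.2.re) 0 := by
      simpa using hl.cos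
    have hs : HasDerivAt (fun t : ℝ => Real.sin (x.2.re + t)) (Real.cos x.2.re) 0 := by
      simpa using hl.sin
    have := (hc.ofReal_comp.mul_const (Complex.exp (A * Complex.I))).prodMk
      (hs.ofReal_comp.mul_const (Complex.exp (B * Complex.I)))
    refine this.congr_of_eventuallyEq (Filter.Eventually.of_forall fun t => ?_)
    simp [angularNhd, hA, hB]
  have h3 : fderiv ℝ (angularNhd a b) x (0, Complex.I) =
      (Real.cos x.2.re * ((1 / b : ℝ) * Complex.I * Complex.exp (A * Complex.I)),
        Real.sin x.2.re * ((-1 / a : ℝ) * Complex.I * Complex.exp (B * Complex.I))) := by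
    refine fderiv_eq_of_hasLineDerivAt hd ?_
    have := ((hasDerivAt_cexp_line A (1 / b)).const_mul (Real.cos x.2.re : ℂ)).prodMk
      ((hasDerivAt_cexp_line B (-1 / a)).const_mul (Real.sin x.2.re : ℂ))
    refine this.congr_of_eventuallyEq (Filter.Eventually.of_forall fun t => ?_)
    have e1 : (x.2 + t • Complex.I).re = x.2.re := by simp
    have e2 : (x.2 + t • Complex.I).im = x.2.im + t := by simp
    simp only [angularNhd, hA, hB, Prod.fst_add, Prod.snd_add, Prod.smul_fst, Prod.smul_snd,
      smul_zero, add_zero, e1, e2]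
    congr 5 <;> ring
  rw [frameDet, h1, h2, h3, volC2_vec, det_fin_four]
  have ha' : (a : ℝ) ≠ 0 := Nat.cast_ne_zero.mpr ha
  have hb' : (b : ℝ) ≠ 0 := Nat.cast_ne_zero.mpr hb
  have t1 := Real.cos_sq_add_sin_sq A
  have t2 := Real.cos_sq_add_sin_sq B
  have t3 := Real.cos_sq_add_sin_sq x.2.re
  -- Reinserting the factors cos² + sin² = 1 turns the goal into a polynomial identity.
  have key : ∀ c s c1 s1 c2 s2 ia ib : ℝ, c ^ 2 + s ^ 2 = 1 → c1 ^ 2 + s1 ^ 2 = 1 →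
      c2 ^ 2 + s2 ^ 2 = 1 → (a : ℝ) * ia = 1 → (b : ℝ) * ib = 1 →
      (c ^ 2 + s ^ 2) * (c1 ^ 2 + s1 ^ 2) * (c2 ^ 2 + s2 ^ 2) * (c * s) * (a * ia + b * ib) =
        2 * c * s := by
    intro c s c1 s1 c2 s2 ia ib e1 e2 e3 e4 e5
    rw [e1, e2, e3, e4, e5]; ring
  rw [← key _ _ _ _ _ _ (1 / a) (1 / b) t3 t1 t2 (by field_simp) (by field_simp)]
  simp only [realCoords, angularNhd, ← hA, ← hB, Matrix.of_apply, Matrix.cons_val,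
    Complex.mul_re, Complex.mul_im, Complex.ofReal_re, Complex.ofReal_im, Complex.I_re,
    Complex.I_im, Complex.exp_ofReal_mul_I_re, Complex.exp_ofReal_mul_I_im]
  ring

theorem det_eq_det_fin_three (T : ℝ × ℂ →ₗ[ℝ] ℝ × ℂ) : LinearMap.det T =
    Matrix.det !![(T (1, 0)).1, (T (1, 0)).2.re, (T (1, 0)).2.im;
      (T (0, 1)).1, (T (0, 1)).2.re, (T (0, 1)).2.im;
      (T (0, Complex.I)).1, (T (0, Complex.I)).2.re, (T (0, Complex.I)).2.im] := by
  have h := Module.Basis.det_comp basisRC T basisRC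
  rw [Module.Basis.det_self, mul_one, Module.Basis.det_apply, ← Matrix.det_transpose] at h
  rw [← h]
  congr 1
  ext i j
  rw [Matrix.transpose_apply, Module.Basis.toMatrix_apply, coe_basisRC]
  fin_cases i <;> fin_cases j <;> simp [basisRC, realCoordsEquiv₃]

/-- The Jacobian matrix is triangular, so the derivative of the tilt in the real direction is not
needed. Its diagonal is 1, the negative derivative of `knotAngle`, and a positive number. -/
theorem det_fderiv_toAngular_neg {a b : ℕ} (hb : b ≠ 0) (x : ℝ × ℂ) :
    LinearMap.det (fderiv ℝ (toAngular a b) x : ℝ × ℂ →ₗ[ℝ] ℝ × ℂ) < 0 := by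
  have hd := (contDiff_toAngular a b).differentiable (by simp) x
  have h1 : fderiv ℝ (toAngular a b) x (1, 0) = (1, 0) := by
    refine fderiv_eq_of_hasLineDerivAt hd ?_
    have h : HasDerivAt (fun t : ℝ => (x.1 + t, (toAngular a b x).2)) ((1, 0) : ℝ × ℂ) 0 :=
      ((hasDerivAt_id (0 : ℝ)).const_add _).prodMk (hasDerivAt_const _ _)
    refine h.congr_of_eventuallyEq (Filter.Eventually.of_forall fun t => ?_)
    simp [toAngular]
  have h2 : (fderiv ℝ (toAngular a b) x (0, 1)).1 = 0 := by
    have h := fderiv_eq_of_hasLineDerivAt (v := (0, 1)) (d := (0 : ℝ))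
      ((ContinuousLinearMap.fst ℝ ℝ ℂ).differentiableAt.comp x hd) (by
        have := hasDerivAt_const (0 : ℝ) x.1
        refine this.congr_of_eventuallyEq (Filter.Eventually.of_forall fun t => ?_)
        simp [toAngular])
    rw [((ContinuousLinearMap.fst ℝ ℝ ℂ).hasFDerivAt.comp x hd.hasFDerivAt).fderiv] at h
    exact h
  have h3 : (fderiv ℝ (toAngular a b) x (0, 1)).2.re = -(1 / (1 + x.2.re ^ 2) / 2) := by
    have h := fderiv_eq_of_hasLineDerivAt (v := (0, 1)) (d := -(1 / (1 + x.2.re ^ 2) / 2))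
      ((Complex.reCLM.comp (ContinuousLinearMap.snd ℝ ℝ ℂ)).differentiableAt.comp x hd) (by
        have h4 : HasDerivAt (fun t : ℝ => x.2.re + t) 1 0 := (hasDerivAt_id (0 : ℝ)).const_add _
        have h5 := (h4.arctan.div_const 2).const_sub (Real.pi / 4)
        simp only [add_zero, mul_one] at h5
        refine h5.congr_of_eventuallyEq (Filter.Eventually.of_forall fun t => ?_)
        simp [toAngular, knotAngle])
    rw [((Complex.reCLM.comp (ContinuousLinearMap.snd ℝ ℝ ℂ)).hasFDerivAt.comp x
      hd.hasFDerivAt).fderiv] at h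
    exact h
  set k := knotScale a b x.2.re with hk
  have hk0 : 0 < k := knotScale_pos hb _
  have h4 : fderiv ℝ (toAngular a b) x (0, Complex.I) =
      (0, ((1 / (1 + (k * x.2.im) ^ 2) * k : ℝ) : ℂ) * Complex.I) := by
    refine fderiv_eq_of_hasLineDerivAt hd ?_
    have h5 : HasDerivAt (fun t : ℝ => k * (x.2.im + t)) k 0 := by
      simpa using ((hasDerivAt_id (0 : ℝ)).const_add x.2.im).const_mul k
    have h6 := h5.arctan
    rw [add_zero] at h6
    have h7 := (hasDerivAt_const (0 : ℝ) x.1).prodMk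
      ((h6.ofReal_comp.mul_const Complex.I).const_add (knotAngle x.2.re : ℂ))
    refine h7.congr_of_eventuallyEq (Filter.Eventually.of_forall fun t => ?_)
    have e1 : (x.2 + t • Complex.I).re = x.2.re := by simp
    have e2 : (x.2 + t • Complex.I).im = x.2.im + t := by simp
    simp only [toAngular, knotTilt, Prod.fst_add, Prod.snd_add, Prod.smul_fst, Prod.smul_snd,
      smul_zero, add_zero, e1, e2, ← hk]
    rw [Complex.mk_eq_add_mul_I]
  rw [det_eq_det_fin_three, Matrix.det_fin_three]
  simp only [ContinuousLinearMap.coe_coe, h1, h2, h3, h4]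
  simp only [Matrix.of_apply, Matrix.cons_val', Matrix.cons_val_zero, Matrix.cons_val_one,
    Matrix.cons_val, Complex.mul_re, Complex.mul_im, Complex.ofReal_re, Complex.ofReal_im,
    Complex.I_re, Complex.I_im, Complex.zero_re, Complex.zero_im]
  have : 0 < 1 / (1 + x.2.re ^ 2) / 2 * (1 / (1 + (k * x.2.im) ^ 2) * k) := by positivity
  linarith

theorem frameDet_knotNhdLift_pos {a b : ℕ} (ha : a ≠ 0) (hb : b ≠ 0) (x : ℝ × ℂ) :
    0 < frameDet (knotNhdLift a b x) (fderiv ℝ (knotNhdLift a b) x) := by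
  have h := frameDet_chain (F := angularNhd a b) (b := toAngular a b) (u := x)
    (T := ContinuousLinearMap.id ℝ (ℂ × ℂ))
    ((contDiff_angularNhd a b).differentiable (by simp) _)
    ((contDiff_toAngular a b).differentiable (by simp) _)
  have h' : frameDet (knotNhdLift a b x) (fderiv ℝ (knotNhdLift a b) x) = _ := h
  rw [h', frameDet_angularNhd ha hb, ContinuousLinearMap.coe_id, LinearMap.det_id, one_mul]
  refine mul_pos_of_neg_of_neg (det_fderiv_toAngular_neg hb x) (neg_neg_of_pos ?_)
  have h1 : 0 < Real.cos (toAngular a b x).2.re := cos_knotAngle_pos _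
  have h2 : 0 < Real.sin (toAngular a b x).2.re := sin_knotAngle_pos _
  positivity

/-! ### Twists of `ℝ × ℂ` -/

/-- The map `(θ, v) ↦ (θ + θ₀, exp (i (m θ + m₀)) J (v + v₀))`. -/
noncomputable def twistMap (m θ₀ m₀ : ℝ) (v₀ : ℂ) (J : ℂ →L[ℝ] ℂ) (x : ℝ × ℂ) : ℝ × ℂ :=
  (x.1 + θ₀, Complex.exp ((m * x.1 + m₀ : ℝ) * Complex.I) * J (x.2 + v₀))

theorem contDiff_twistMap (m θ₀ m₀ : ℝ) (v₀ : ℂ) (J : ℂ →L[ℝ] ℂ) :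
    ContDiff ℝ ∞ (twistMap m θ₀ m₀ v₀ J) := by
  refine ContDiff.prodMk (contDiff_fst.add contDiff_const) (ContDiff.mul ?_ ?_)
  · exact ContDiff.cexp ((Complex.ofRealCLM.contDiff.comp
      ((contDiff_const.mul contDiff_fst).add contDiff_const)).mul contDiff_const)
  · exact J.contDiff.comp (contDiff_snd.add contDiff_const)

/-- The twist contributes only a shear and a rotation of the fibre, so the determinant of `J`
remains. -/
theorem det_fderiv_twistMap (m θ₀ m₀ : ℝ) (v₀ : ℂ) (J : ℂ →L[ℝ] ℂ) (x : ℝ × ℂ) :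
    LinearMap.det (fderiv ℝ (twistMap m θ₀ m₀ v₀ J) x : ℝ × ℂ →ₗ[ℝ] ℝ × ℂ) =
      (J 1).re * (J Complex.I).im - (J 1).im * (J Complex.I).re := by
  have hd := (contDiff_twistMap m θ₀ m₀ v₀ J).differentiable (by simp) x
  set A := m * x.1 + m₀ with hA
  have h1 : (fderiv ℝ (twistMap m θ₀ m₀ v₀ J) x (1, 0)).1 = 1 := by
    have h := fderiv_eq_of_hasLineDerivAt (v := (1, 0)) (d := (1 : ℝ))
      ((ContinuousLinearMap.fst ℝ ℝ ℂ).differentiableAt.comp x hd) (by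
        have := ((hasDerivAt_id (0 : ℝ)).const_add x.1).add_const θ₀
        refine this.congr_of_eventuallyEq (Filter.Eventually.of_forall fun t => ?_)
        simp [twistMap])
    rw [((ContinuousLinearMap.fst ℝ ℝ ℂ).hasFDerivAt.comp x hd.hasFDerivAt).fderiv] at h
    exact h
  have h2 (v : ℂ) : fderiv ℝ (twistMap m θ₀ m₀ v₀ J) x (0, v) =
      (0, Complex.exp (A * Complex.I) * J v) := by
    refine fderiv_eq_of_hasLineDerivAt hd ?_
    have h3 : HasDerivAt (fun t : ℝ => J (x.2 + v₀) + t • J v) (J v) 0 := by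
      simpa using ((hasDerivAt_id (0 : ℝ)).smul_const (J v)).const_add (J (x.2 + v₀))
    have h4 := (hasDerivAt_const (0 : ℝ) (x.1 + θ₀)).prodMk
      (h3.const_mul (Complex.exp (A * Complex.I)))
    refine h4.congr_of_eventuallyEq (Filter.Eventually.of_forall fun t => ?_)
    simp only [twistMap, Prod.fst_add, Prod.snd_add, Prod.smul_fst, Prod.smul_snd,
      smul_zero, add_zero, ← hA]
    rw [add_right_comm, map_add J (x.2 + v₀), map_smul]
  rw [det_eq_det_fin_three, Matrix.det_fin_three]
  simp only [ContinuousLinearMap.coe_coe, h1, h2]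
  simp only [Matrix.of_apply, Matrix.cons_val', Matrix.cons_val_zero, Matrix.cons_val_one,
    Matrix.cons_val, Complex.mul_re, Complex.mul_im, Complex.exp_ofReal_mul_I_re,
    Complex.exp_ofReal_mul_I_im]
  linear_combination ((J 1).re * (J Complex.I).im - (J 1).im * (J Complex.I).re) *
    Real.cos_sq_add_sin_sq A

/-! ### Framed neighbourhoods of torus knots -/

theorem knotSlice_zero (a b : ℕ) : (knotSlice a b 0).1 = (((√2 : ℝ) : ℂ)⁻¹, ((√2 : ℝ) : ℂ)⁻¹) := by
  have h : (√2 / 2 : ℂ) = ((√2 : ℝ) : ℂ)⁻¹ := by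
    rw [div_eq_iff (by norm_num), inv_mul_eq_div, eq_div_iff (by simp), ← Complex.ofReal_mul,
      Real.mul_self_sqrt (by norm_num)]
    norm_num
  ext1 <;> simp [knotSlice, knotNhdLift, angularNhd, toAngular, knotTilt, knotAngle, h]

theorem knotNhd_zero_mem (a b : ℕ) (t : Circle) : knotNhd a b (t, 0) ∈ torusKnot a b := by
  refine ⟨t, ?_, ?_⟩ <;>
    simp [knotNhd, rotS3, diagS3, diagMap_apply, knotSlice_zero, div_eq_mul_inv]

theorem exists_eq_knotNhd {a b : ℕ} {x : S3} (hx : x ∈ torusKnot a b) :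
    ∃ t : Circle, x = knotNhd a b (t, 0) := by
  obtain ⟨t, h1, h2⟩ := hx
  refine ⟨t, Subtype.ext (Prod.ext ?_ ?_)⟩
  · rw [h1]; simp [knotNhd, rotS3, diagS3, diagMap_apply, knotSlice_zero, div_eq_mul_inv]
  · rw [h2]; simp [knotNhd, rotS3, diagS3, diagMap_apply, knotSlice_zero, div_eq_mul_inv]

theorem knotNhd_twist_eq (a b : ℕ) (e : ℤ) (x : ℝ × ℂ) :
    (knotNhd a b (Circle.exp x.1, ((Circle.exp x.1 ^ e : Circle) : ℂ) * x.2)).1 =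
      knotNhdLift a b (twistMap e 0 0 0 (ContinuousLinearMap.id ℝ ℂ) x) := by
  rw [knotNhd_exp, twistMap]
  simp [← Circle.exp_intCast_mul, Circle.coe_exp]

/-- The tubular neighbourhood of the torus knot with framing `a * b + e`. -/
noncomputable def torusFramedNhd {a b : ℕ} (ha : a ≠ 0) (hb : b ≠ 0) (h : Nat.Coprime a b)
    (e : ℤ) : FramedNhd (torusKnot a b) where
  toFun x := knotNhd a b (x.1, ((x.1 ^ e : Circle) : ℂ) * x.2)
  injective := by
    rintro ⟨t, v⟩ ⟨t', v'⟩ he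
    have h1 := knotNhd_injective ha hb h he
    simp only [Prod.mk.injEq] at h1
    obtain ⟨rfl, h2⟩ := h1
    rw [mul_right_inj' (Circle.coe_ne_zero _)] at h2
    rw [h2]
  smooth := by
    simp only [knotNhd_twist_eq]
    exact (contDiff_knotNhdLift a b).comp (contDiff_twistMap _ _ _ _ _)
  positive x := by
    simp only [knotNhd_twist_eq]
    rw [isPositiveFrame_iff]
    have h1 := frameDet_chain (F := knotNhdLift a b) (u := x)
      (b := twistMap e 0 0 0 (ContinuousLinearMap.id ℝ ℂ)) (T := ContinuousLinearMap.id ℝ (ℂ × ℂ))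
      ((contDiff_knotNhdLift a b).differentiable (by simp) _)
      ((contDiff_twistMap _ _ _ _ _).differentiable (by simp) _)
    simp only [ContinuousLinearMap.id_apply] at h1
    rw [h1, det_fderiv_twistMap]
    simpa using frameDet_knotNhdLift_pos ha hb _
  core := by
    ext x
    constructor
    · rintro ⟨t, rfl⟩
      simpa using knotNhd_zero_mem a b t
    · intro hx
      obtain ⟨t, rfl⟩ := exists_eq_knotNhd hx
      exact ⟨t, by simp⟩

/-! ### The phase of the polynomial -/

/-- The phase of `knotPoly` (and `1` on the knot). -/
noncomputable def knotPhase (a b : ℕ) (x : S3) : Circle := Circle.exp (Complex.arg (knotPoly a b x.1))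

theorem knotPhase_eq {a b : ℕ} {x : S3} {r : ℝ} {u : Circle} (hr : 0 < r)
    (h : knotPoly a b x.1 = r * u) : knotPhase a b x = u := by
  rw [knotPhase, h, Complex.arg_real_mul _ hr, Circle.exp_arg]

theorem knotPoly_eq_norm_mul_phase (a b : ℕ) (x : S3) :
    knotPoly a b x.1 = (‖knotPoly a b x.1‖ : ℝ) * (knotPhase a b x : ℂ) := by
  rw [knotPhase, Circle.coe_exp, Complex.norm_mul_exp_arg_mul_I]

theorem knotPhase_rotS3 {a b : ℕ} {x : S3} (hx : knotPoly a b x.1 ≠ 0) (t : Circle) :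
    knotPhase a b (rotS3 a b t x) = t ^ (a * b) * knotPhase a b x := by
  refine knotPhase_eq (norm_pos_iff.mpr hx) ?_
  rw [knotPoly_rotS3, Circle.coe_mul, mul_left_comm, ← knotPoly_eq_norm_mul_phase]

theorem knotPoly_rotS3_ne_zero {a b : ℕ} {x : S3} (hx : knotPoly a b x.1 ≠ 0) (t : Circle) :
    knotPoly a b (rotS3 a b t x).1 ≠ 0 := by
  rw [knotPoly_rotS3]
  exact mul_ne_zero (Circle.coe_ne_zero _) hx

theorem knotPhase_knotNhd {a b : ℕ} (ha : a ≠ 0) (hb : b ≠ 0) (t u : Circle) {r : ℝ}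
    (hr : 0 < r) : knotPhase a b (knotNhd a b (t, r * u)) = t ^ (a * b) * u := by
  obtain ⟨c, hc, h⟩ := exists_knotPoly_knotSlice ha hb (r * u)
  refine knotPhase_eq (mul_pos hc hr) ?_
  rw [knotNhd, knotPoly_rotS3, h]
  push_cast
  ring

theorem Circle.exists_zpow_eq {p : ℤ} (hp : p ≠ 0) (u : Circle) : ∃ r : Circle, r ^ p = u := by
  refine ⟨Circle.exp (Complex.arg u / p), ?_⟩
  rw [← Circle.exp_intCast_mul, mul_div_cancel₀ _ (Int.cast_ne_zero.mpr hp), Circle.exp_arg]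

theorem continuous_knotPoly (a b : ℕ) : Continuous (knotPoly a b) := by
  unfold knotPoly; fun_prop

/-! ### Rotating by a power of the phase -/

/-- The real inner product of `ℂ²`. -/
noncomputable def innerC2 (x y : ℂ × ℂ) : ℝ :=
  (starRingEnd ℂ x.1 * y.1).re + (starRingEnd ℂ x.2 * y.2).re

theorem innerC2_self (x : ℂ × ℂ) : innerC2 x x = sqNorm x := by
  simp [innerC2, sqNorm, Complex.sq_norm, Complex.normSq_apply]

theorem innerC2_fderiv {γ : ℝ × ℂ → S3} {u : ℝ × ℂ}
    (hγ : DifferentiableAt ℝ (fun x => (γ x).1) u) (v : ℝ × ℂ) :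
    innerC2 (γ u).1 (fderiv ℝ (fun x => (γ x).1) u v) = 0 := by
  have hl : HasDerivAt (fun t : ℝ => (γ (u + t • v)).1)
      (fderiv ℝ (fun x => (γ x).1) u v) 0 := hγ.hasFDerivAt.hasLineDerivAt v
  set d := fderiv ℝ (fun x => (γ x).1) u v
  have h1 := hl.hasFDerivAt.fst.hasDerivAt
  have h2 := hl.hasFDerivAt.snd.hasDerivAt
  have h3 := h1.norm_sq.add h2.norm_sq
  have h4 : (fun t : ℝ => ‖(γ (u + t • v)).1.1‖ ^ 2 + ‖(γ (u + t • v)).1.2‖ ^ 2) = fun _ => 1 :=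
    funext fun t => (γ (u + t • v)).2
  have h5 := h3.unique (by
    have := hasDerivAt_const (0 : ℝ) (1 : ℝ)
    rw [← h4] at this
    exact this)
  simp only [zero_smul, add_zero] at h5
  have h6 : 2 * innerC2 (γ u).1 d = 0 := by
    rw [← h5]
    simp [innerC2, Complex.inner]
    ring
  linarith

/-- The velocity of the circle action with weights `a`, `b`. -/
noncomputable def rotField (a b : ℕ) (y : ℂ × ℂ) : ℂ × ℂ :=
  (a * Complex.I * y.1, b * Complex.I * y.2)

theorem innerC2_rotField (a b : ℕ) (y : ℂ × ℂ) : innerC2 y (rotField a b y) = 0 := by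
  simp [innerC2, rotField]
  ring

/-- The infinitesimal form of the equivariance `knotPoly_rotS3`. -/
theorem hasFDerivAt_knotPoly_line (a b : ℕ) {γ : ℝ × ℂ → ℂ × ℂ} {u v : ℝ × ℂ}
    (hγ : DifferentiableAt ℝ γ u) (hv : fderiv ℝ γ u v = rotField a b (γ u)) :
    fderiv ℝ (fun x => knotPoly a b (γ x)) u v = a * b * Complex.I * knotPoly a b (γ u) := by
  have hl : HasDerivAt (fun t : ℝ => γ (u + t • v)) (rotField a b (γ u)) 0 := by
    rw [← hv]; exact hγ.hasFDerivAt.hasLineDerivAt v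
  have h1 := hl.hasFDerivAt.fst.hasDerivAt
  have h2 := hl.hasFDerivAt.snd.hasDerivAt
  have hd : DifferentiableAt ℝ (fun x => knotPoly a b (γ x)) u :=
    (((hγ.fst.const_mul _).pow b).sub ((hγ.snd.const_mul _).pow a))
  refine fderiv_eq_of_hasLineDerivAt hd ?_
  have h3 := ((h1.const_mul ((√2 : ℝ) : ℂ)).pow b).sub ((h2.const_mul ((√2 : ℝ) : ℂ)).pow a)
  refine h3.congr_deriv ?_
  simp only [zero_smul, add_zero, knotPoly, rotField]
  simp
  rcases a with _ | a <;> rcases b with _ | b <;> simp [pow_succ] <;> ring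

/-- The point `x`, rotated by a power of the phase. -/
noncomputable def phaseRot (a b : ℕ) (e : ℤ) (x : S3) : S3 := rotS3 a b (knotPhase a b x ^ e) x

/-- Up to a fixed rotation, the derivative is the identity plus e·dϑ times the rotation field. The
phase changes at rate ab along that field, so the determinant of this transvection is 1 + e·ab. -/
theorem frameDet_phaseRot {a b : ℕ} {e : ℤ} {γ : ℝ × ℂ → S3}
    (hγ : ContDiffAt ℝ ∞ (fun x => (γ x).1) 0)
    (hdet : frameDet (γ 0).1 (fderiv ℝ (fun x => (γ x).1) 0) ≠ 0)
    (h0 : knotPoly a b (γ 0).1 ≠ 0) :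
    ContDiffAt ℝ ∞ (fun x => (phaseRot a b e (γ x)).1) 0 ∧
    frameDet (phaseRot a b e (γ 0)).1 (fderiv ℝ (fun x => (phaseRot a b e (γ x)).1) 0) =
      (1 + e * (a * b)) * frameDet (γ 0).1 (fderiv ℝ (fun x => (γ x).1) 0) := by
  set L := fderiv ℝ (fun x => (γ x).1) 0 with hL
  set f₀ := knotPoly a b (γ 0).1 with hf₀
  have hd := hγ.differentiableAt (by simp)
  -- A smooth local lift of the phase relative to its value at the origin; dividing by f₀ keeps the
  -- logarithm away from its branch cut.
  set ϑ : ℝ × ℂ → ℝ := fun x => (Complex.log (knotPoly a b (γ x).1 / f₀)).im with hϑ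
  have hfc : ContDiffAt ℝ ∞ (fun x => knotPoly a b (γ x).1) 0 :=
    ((contDiffAt_const.mul hγ.fst).pow b).sub ((contDiffAt_const.mul hγ.snd).pow a)
  have hfd := hfc.differentiableAt (by simp)
  have hslit : knotPoly a b (γ 0).1 / f₀ ∈ Complex.slitPlane := by
    rw [← hf₀, div_self h0]; exact Complex.one_mem_slitPlane
  have hϑc : ContDiffAt ℝ ∞ ϑ 0 :=
    Complex.imCLM.contDiff.contDiffAt.comp (0 : ℝ × ℂ)
      (ContDiffAt.comp (g := Complex.log) (0 : ℝ × ℂ)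
        ((Complex.contDiffAt_log hslit).restrict_scalars ℝ) (hfc.div_const f₀))
  have hϑ0 : ϑ 0 = 0 := by simp [hϑ, ← hf₀, div_self h0]
  have hϑd : HasFDerivAt ϑ (Complex.imCLM.comp (f₀⁻¹ • fderiv ℝ (fun x => knotPoly a b (γ x).1) 0))
      0 := by
    have h1 : HasFDerivAt (fun x => knotPoly a b (γ x).1 / f₀)
        (f₀⁻¹ • fderiv ℝ (fun x => knotPoly a b (γ x).1) 0) 0 := by
      simpa only [div_eq_mul_inv] using hfd.hasFDerivAt.mul_const f₀⁻¹
    have h2 := ((Complex.hasDerivAt_log hslit).hasFDerivAt.restrictScalars ℝ).comp (0 : ℝ × ℂ) h1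
    rw [← hf₀, div_self h0, inv_one] at h2
    have h3 : HasFDerivAt (fun x => Complex.log (knotPoly a b (γ x).1 / f₀))
        (f₀⁻¹ • fderiv ℝ (fun x => knotPoly a b (γ x).1) 0) 0 :=
      h2.congr_fderiv (ContinuousLinearMap.ext fun x => by simp)
    exact Complex.imCLM.hasFDerivAt.comp (0 : ℝ × ℂ) h3
  set dϑ := Complex.imCLM.comp (f₀⁻¹ • fderiv ℝ (fun x => knotPoly a b (γ x).1) 0) with hdϑ
  obtain ⟨⟨c, x₀⟩, hx₀⟩ := (frameMap_bijective hdet).2 (rotField a b (γ 0).1)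
  rw [frameMap_apply] at hx₀
  -- The rotation field is tangent to the sphere, so it has no radial component and is the image of
  -- a parameter direction x₀.
  have hc : c = 0 := by
    have h1 := innerC2_rotField a b (γ 0).1
    have h2 := innerC2_fderiv hd x₀
    have h3 : innerC2 (γ 0).1 (c • (γ 0).1 + L x₀) = c * sqNorm (γ 0).1 +
        innerC2 (γ 0).1 (L x₀) := by
      rw [← innerC2_self]
      simp [innerC2]
      ring
    have h4 : sqNorm (γ 0).1 = 1 := (γ 0).2
    rw [← hx₀, h3, h2, h4] at h1
    linarith
  rw [hc, zero_smul, zero_add] at hx₀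
  have hdx₀ : dϑ x₀ = a * b := by
    rw [hdϑ]
    simp only [ContinuousLinearMap.comp_apply, smul_apply]
    rw [hasFDerivAt_knotPoly_line a b hd hx₀, ← hf₀, smul_eq_mul, mul_comm, mul_assoc,
      mul_inv_cancel₀ h0]
    simp
  set Γ : ℝ × ℂ → ℂ × ℂ := fun x =>
    (Complex.exp ((e * a * ϑ x : ℝ) * Complex.I) * (γ x).1.1,
      Complex.exp ((e * b * ϑ x : ℝ) * Complex.I) * (γ x).1.2) with hΓ
  have hofc {g : ℝ × ℂ → ℝ} (hg : ContDiffAt ℝ ∞ g 0) : ContDiffAt ℝ ∞ (fun x => (g x : ℂ)) 0 :=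
    Complex.ofRealCLM.contDiff.contDiffAt.comp (0 : ℝ × ℂ) hg
  have hΓc : ContDiffAt ℝ ∞ Γ 0 :=
    ((((hofc (contDiffAt_const.mul hϑc)).mul contDiffAt_const).cexp).mul hγ.fst).prodMk
      ((((hofc (contDiffAt_const.mul hϑc)).mul contDiffAt_const).cexp).mul hγ.snd)
  have hΓd : HasFDerivAt Γ (L.comp (ContinuousLinearMap.id ℝ (ℝ × ℂ) +
      ((e : ℝ) • dϑ).smulRight x₀)) 0 := by
    have hex (k : ℝ) : HasFDerivAt (fun x => Complex.exp ((k * ϑ x : ℝ) * Complex.I))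
        ((k • dϑ).smulRight Complex.I) 0 := by
      have h1 := (((Complex.ofRealCLM.hasFDerivAt.comp (0 : ℝ × ℂ)
        (hϑd.const_mul k)).mul_const Complex.I)).cexp
      refine h1.congr_fderiv ?_
      refine ContinuousLinearMap.ext fun x => ?_
      simp [hϑ0, mul_comm]
    have h1 := ((hex (e * a)).mul hd.hasFDerivAt.fst).prodMk
      ((hex (e * b)).mul hd.hasFDerivAt.snd)
    refine h1.congr_fderiv (ContinuousLinearMap.ext fun x => ?_)
    simp only [ContinuousLinearMap.comp_apply, add_apply,
      ContinuousLinearMap.id_apply, ContinuousLinearMap.smulRight_apply, map_add, map_smul, hx₀]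
    ext1
    · simp [hϑ0, rotField, ← hL]
      ring
    · simp [hϑ0, rotField, ← hL]
      ring
  set T := diagMap ((knotPhase a b (γ 0) ^ e) ^ a) ((knotPhase a b (γ 0) ^ e) ^ b) with hT
  have hnear : ∀ᶠ x in 𝓝 (0 : ℝ × ℂ), knotPoly a b (γ x).1 ≠ 0 :=
    hfc.continuousAt.eventually_ne h0
  have heq : (fun x => (phaseRot a b e (γ x)).1) =ᶠ[𝓝 0] fun x => T (Γ x) := by
    filter_upwards [hnear] with x hx
    have hph : knotPhase a b (γ x) = knotPhase a b (γ 0) * Circle.exp (ϑ x) := by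
      refine knotPhase_eq (norm_pos_iff.mpr hx) ?_
      have h1 : knotPoly a b (γ x).1 = f₀ * (knotPoly a b (γ x).1 / f₀) := by field_simp
      have h2 := Complex.norm_mul_exp_arg_mul_I (knotPoly a b (γ x).1 / f₀)
      have h3 : f₀ = (‖f₀‖ : ℝ) * (knotPhase a b (γ 0) : ℂ) := knotPoly_eq_norm_mul_phase a b (γ 0)
      have h4 : ((‖f₀‖ : ℝ) : ℂ) ≠ 0 := by simpa using h0
      have h5 : (Circle.exp (ϑ x) : ℂ) =
          Complex.exp (Complex.arg (knotPoly a b (γ x).1 / f₀) * Complex.I) := by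
        rw [Circle.coe_exp, ← Complex.log_im]
      rw [Circle.coe_mul, h5]
      calc knotPoly a b (γ x).1 = f₀ * ((‖knotPoly a b (γ x).1 / f₀‖ : ℝ) *
            Complex.exp (Complex.arg (knotPoly a b (γ x).1 / f₀) * Complex.I)) := by
              rw [h2]; exact h1
        _ = ((‖f₀‖ : ℝ) * (knotPhase a b (γ 0) : ℂ)) *
            (((‖knotPoly a b (γ x).1‖ : ℝ) : ℂ) / ((‖f₀‖ : ℝ) : ℂ) *
            Complex.exp (Complex.arg (knotPoly a b (γ x).1 / f₀) * Complex.I)) := by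
              rw [← h3, norm_div, Complex.ofReal_div]
        _ = _ := by field_simp
    have hpow (k : ℕ) : ((Circle.exp (ϑ x) ^ e) ^ k) = Circle.exp (e * k * ϑ x) := by
      rw [← Circle.exp_intCast_mul, ← Circle.exp_natCast_mul]
      congr 1; ring
    have hpow' (k : ℕ) : (((knotPhase a b (γ x) ^ e) ^ k : Circle) : ℂ) =
        (((knotPhase a b (γ 0) ^ e) ^ k : Circle) : ℂ) *
          Complex.exp ((e * k * ϑ x : ℝ) * Complex.I) := by
      rw [hph, mul_zpow, mul_pow, hpow, Circle.coe_mul, Circle.coe_exp]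
    simp only [phaseRot, rotS3, diagS3, diagMap_apply, hT, hΓ, hpow', mul_assoc]
  refine ⟨(T.contDiff.contDiffAt.comp (0 : ℝ × ℂ) hΓc).congr_of_eventuallyEq heq, ?_⟩
  have hΓ0 : Γ 0 = (γ 0).1 := by simp [hΓ, hϑ0]
  have h1 : HasFDerivAt (fun x => T (Γ x)) (T.comp _) 0 := T.hasFDerivAt.comp (0 : ℝ × ℂ) hΓd
  rw [heq.fderiv_eq, h1.fderiv, heq.eq_of_nhds, frameDet_map, frameDet_comp, hΓ0, det_diagMap,
    one_mul]
  congr 1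
  have h2 : ((ContinuousLinearMap.id ℝ (ℝ × ℂ) + ((e : ℝ) • dϑ).smulRight x₀ :
      ℝ × ℂ →L[ℝ] ℝ × ℂ) : ℝ × ℂ →ₗ[ℝ] ℝ × ℂ) =
      LinearMap.transvection (((e : ℝ) • dϑ : ℝ × ℂ →L[ℝ] ℝ) : ℝ × ℂ →ₗ[ℝ] ℝ) x₀ := by
    refine LinearMap.ext fun x => ?_
    simp [LinearMap.transvection.apply]
  rw [h2, LinearMap.transvection.det]
  simp [hdx₀]

/-! ### Surgeries on torus knots that produce lens spaces -/

/-- An identification of `L(p, q)` with the quotient of the sphere by the `p`-th roots of unity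
in the circle whose orbits are of type `(a, b)`. It preserves or reverses the orientation according
to the sign `e`, and `p = a * b + e`. -/
structure LensModel (a b : ℕ) (e p q : ℤ) where
  left_ne_zero : a ≠ 0
  right_ne_zero : b ≠ 0
  coprime : Nat.Coprime a b
  sign_mul_self : e * e = 1
  eq_add : p = a * b + e
  pos : 0 < p
  J : ℂ →L[ℝ] ℂ
  map_polar : ∀ (r : ℝ) (t : Circle), J (r * t) = r * ((t ^ e : Circle) : ℂ)
  det_J : (J 1).re * (J Complex.I).im - (J 1).im * (J Complex.I).re = e
  κ : S3 ≃ S3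
  lin : ℂ × ℂ →L[ℝ] ℂ × ℂ
  linSymm : ℂ × ℂ →L[ℝ] ℂ × ℂ
  coe_κ : ∀ x, (κ x).1 = lin x.1
  coe_κ_symm : ∀ x, (κ.symm x).1 = linSymm x.1
  det_lin : 0 < e * LinearMap.det (lin : ℂ × ℂ →ₗ[ℝ] ℂ × ℂ)
  det_linSymm : 0 < e * LinearMap.det (linSymm : ℂ × ℂ →ₗ[ℝ] ℂ × ℂ)
  rel_iff : ∀ x y, lensRel p q x y ↔ ∃ ζ : Circle, ζ ^ p = 1 ∧ κ y = rotS3 a b ζ (κ x)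

theorem phaseRot_eq (a b : ℕ) (e : ℤ) (x : S3) :
    phaseRot a b e x = rotS3 a b (knotPhase a b x ^ e) x := rfl

theorem knotNhd_mul (a b : ℕ) (t u : Circle) (v : ℂ) :
    knotNhd a b (t * u, v) = rotS3 a b t (knotNhd a b (u, v)) := by
  simp only [knotNhd, rotS3_mul]

/-- A root of a point of the circle. -/
noncomputable def circleRoot (p : ℤ) (u : Circle) : Circle := Circle.exp (Complex.arg u / p)

theorem circleRoot_zpow {p : ℤ} (hp : p ≠ 0) (u : Circle) : circleRoot p u ^ p = u := by
  rw [circleRoot, ← Circle.exp_intCast_mul, mul_div_cancel₀ _ (Int.cast_ne_zero.mpr hp),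
    Circle.exp_arg]

/-! ### The bijection between the surgery and the lens space -/

namespace LensModel

variable {a b : ℕ} {e p q : ℤ}

theorem p_ne_zero (M : LensModel a b e p q) : p ≠ 0 := M.pos.ne'

theorem one_add_mul (M : LensModel a b e p q) : 1 + e * (a * b : ℤ) = e * p := by
  linear_combination -M.sign_mul_self - e * M.eq_add

/-- The framed neighbourhood along which the surgery is done. -/
noncomputable def nhd (M : LensModel a b e p q) : FramedNhd (torusKnot a b) :=
  torusFramedNhd M.left_ne_zero M.right_ne_zero M.coprime e

theorem mk_eq_of_rot (M : LensModel a b e p q) {x y ζ} (hζ : ζ ^ p = 1) (h : y = rotS3 a b ζ x) :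
    (Quot.mk _ (M.κ.symm x) : LensSpace p q) = Quot.mk _ (M.κ.symm y) := by
  refine lensMk_eq_iff.mpr ((M.rel_iff _ _).mpr ⟨ζ, hζ, ?_⟩)
  rw [M.κ.apply_symm_apply, M.κ.apply_symm_apply, h]

theorem exists_rot_of_mk_eq (M : LensModel a b e p q) {x y : S3}
    (h : (Quot.mk _ (M.κ.symm x) : LensSpace p q) = Quot.mk _ (M.κ.symm y)) :
    ∃ ζ : Circle, ζ ^ p = 1 ∧ y = rotS3 a b ζ x := by
  obtain ⟨ζ, hζ, h⟩ := (M.rel_iff _ _).mp (lensMk_eq_iff.mp h)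
  rw [M.κ.apply_symm_apply, M.κ.apply_symm_apply] at h
  exact ⟨ζ, hζ, h⟩

theorem zpow_div_eq_one {r s : Circle} (h : r ^ p = s ^ p) : (r / s) ^ p = 1 := by
  rw [div_zpow, h, div_self']

/-- The map to the lens space on the complement of the knot. -/
noncomputable def outer (M : LensModel a b e p q) (m : {x : S3 // x ∉ torusKnot a b}) : LensSpace p q :=
  Quot.mk _ (M.κ.symm (rotS3 a b (circleRoot p (knotPhase a b m.1))⁻¹ m.1))

/-- The map to the lens space on the solid torus. -/
noncomputable def inner (M : LensModel a b e p q) (y : ℂ × Circle) : LensSpace p q :=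
  Quot.mk _ (M.κ.symm (knotNhd a b (circleRoot p y.2, M.J y.1 * ((y.2⁻¹ : Circle) : ℂ))))

/-- Any p-th root of the phase gives the same point of the lens space; the particular root
`circleRoot` is not continuous, so this freedom is essential. -/
theorem outer_eq (M : LensModel a b e p q) (m : {x : S3 // x ∉ torusKnot a b}) {r : Circle} (hr : r ^ p = knotPhase a b m.1) :
    M.outer m = Quot.mk _ (M.κ.symm (rotS3 a b r⁻¹ m.1)) := by
  refine M.mk_eq_of_rot (ζ := circleRoot p (knotPhase a b m.1) / r) ?_ ?_
  · exact zpow_div_eq_one (by rw [circleRoot_zpow M.p_ne_zero, hr])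
  · rw [rotS3_mul]; congr 1; rw [div_mul_eq_mul_div, mul_inv_cancel, one_div]

theorem inner_eq (M : LensModel a b e p q) (y : ℂ) (σ : Circle) :
    M.inner (y, σ ^ p) =
      Quot.mk _ (M.κ.symm (knotNhd a b (σ, M.J y * ((σ ^ (-p) : Circle) : ℂ)))) := by
  refine M.mk_eq_of_rot (ζ := σ / circleRoot p (σ ^ p)) ?_ ?_
  · exact zpow_div_eq_one (by rw [circleRoot_zpow M.p_ne_zero])
  · rw [← knotNhd_mul, zpow_neg]; congr 2; exact (div_mul_cancel _ _).symm

theorem knotPoly_ne_zero (M : LensModel a b e p q) {x : S3} (hx : x ∉ torusKnot a b) :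
    knotPoly a b x.1 ≠ 0 := fun h =>
  hx ((knotPoly_eq_zero_iff M.left_ne_zero M.right_ne_zero M.coprime).mp h)

theorem rotS3_notMem (M : LensModel a b e p q) {x : S3} (hx : x ∉ torusKnot a b) (t : Circle) :
    rotS3 a b t x ∉ torusKnot a b := fun h =>
  knotPoly_rotS3_ne_zero (M.knotPoly_ne_zero hx) t
    ((knotPoly_eq_zero_iff M.left_ne_zero M.right_ne_zero M.coprime).mpr h)

/-- The map to the lens space. -/
noncomputable def toLens (M : LensModel a b e p q) : M.nhd.Surgery → LensSpace p q :=
  Quot.lift (Sum.elim M.outer M.inner) (by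
    rintro _ _ ⟨t, u, r, hr⟩
    simp only [Sum.elim_inl, Sum.elim_inr]
    have hν : M.nhd.toFun (t, r * u) = knotNhd a b (t, r * ((t ^ e * u : Circle) : ℂ)) := by
      simp only [nhd, torusFramedNhd, Circle.coe_mul]
      rw [mul_left_comm]
    -- The phase of f at ν(t, r u) is t^{ab} · t^e u = t^p u. With its root ρ, the point ρ⁻¹ t of
    -- the circle has p-th power u⁻¹, the solid torus coordinate of the glued point.
    obtain ⟨ρ, hρ⟩ := Circle.exists_zpow_eq M.p_ne_zero (t ^ p * u)
    have hu : (ρ⁻¹ * t) ^ p = u⁻¹ := by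
      rw [mul_zpow, inv_zpow, hρ, mul_inv_rev, inv_mul_cancel_right]
    rw [M.outer_eq (r := ρ), ← hu, M.inner_eq]
    · congr 2
      simp only [hν, zpow_neg, hu, inv_inv, M.map_polar]
      rw [← knotNhd_mul]
      congr 2
      push_cast; ring
    · simp only [hν]
      rw [hρ, knotPhase_knotNhd M.left_ne_zero M.right_ne_zero _ _ hr, M.eq_add, zpow_add,
        mul_assoc]
      norm_cast)

/-- The phase at r⁻¹·m is r^{p-ab} = r^e, and its e-th power is r because e² = 1. So `phaseRot`
undoes `outer`. -/
theorem phaseRot_inv_rot (M : LensModel a b e p q) {m : S3} (hm : m ∉ torusKnot a b) {r : Circle}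
    (hr : r ^ p = knotPhase a b m) : phaseRot a b e (rotS3 a b r⁻¹ m) = m := by
  have h1 : (r⁻¹ ^ (a * b) * knotPhase a b m) ^ e = r := by
    rw [← hr, ← zpow_natCast, inv_zpow', ← zpow_add, ← zpow_mul]
    have : (-((a * b : ℕ) : ℤ) + p) * e = 1 := by
      push_cast
      linear_combination M.sign_mul_self + e * M.eq_add
    rw [this, zpow_one]
  rw [phaseRot_eq, knotPhase_rotS3 (M.knotPoly_ne_zero hm), h1, rotS3_mul, mul_inv_cancel,
    rotS3_one]

/-- The factor that ζ contributes is ζ^{1 + e·ab} = ζ^{ep} = 1. -/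
theorem phaseRot_rot (M : LensModel a b e p q) {x : S3} (hx : x ∉ torusKnot a b) {ζ : Circle} (hζ : ζ ^ p = 1) :
    phaseRot a b e (rotS3 a b ζ x) = phaseRot a b e x := by
  have h1 : (ζ ^ (a * b)) ^ e * ζ = 1 := by
    rw [← zpow_natCast, ← zpow_mul, ← zpow_add_one]
    have : ((a * b : ℕ) : ℤ) * e + 1 = p * e := by
      push_cast
      linear_combination M.one_add_mul
    rw [this, zpow_mul, hζ, one_zpow]
  rw [phaseRot_eq, phaseRot_eq, knotPhase_rotS3 (M.knotPoly_ne_zero hx), rotS3_mul, mul_zpow,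
    mul_right_comm, h1, one_mul]

theorem phaseRot_notMem (M : LensModel a b e p q) {x : S3} (hx : x ∉ torusKnot a b) :
    phaseRot a b e x ∉ torusKnot a b := M.rotS3_notMem hx _

theorem outer_phaseRot (M : LensModel a b e p q) {x : S3} (hx : M.κ x ∉ torusKnot a b) :
    M.outer ⟨phaseRot a b e (M.κ x), M.phaseRot_notMem hx⟩ = Quot.mk _ x := by
  rw [M.outer_eq (r := knotPhase a b (M.κ x) ^ e)]
  · simp only [phaseRot_eq, rotS3_mul, inv_mul_cancel, rotS3_one, Equiv.symm_apply_apply]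
    rfl
  · simp only [phaseRot_eq]
    rw [knotPhase_rotS3 (M.knotPoly_ne_zero hx), ← zpow_natCast, ← zpow_mul, ← zpow_mul,
      ← zpow_add_one, ← M.one_add_mul]
    congr 1
    push_cast; ring

/-- Off its core the solid torus is glued to the complement, so only core points are new. -/
theorem exists_inr_or_inl (M : LensModel a b e p q) (y : M.nhd.Surgery) :
    (∃ m, y = Quot.mk _ (Sum.inl m)) ∨ ∃ σ : Circle, y = Quot.mk _ (Sum.inr (0, σ ^ p)) := by
  obtain ⟨m | ⟨y, τ⟩, rfl⟩ := Quot.exists_rep y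
  · exact Or.inl ⟨m, rfl⟩
  · by_cases hy : y = 0
    · obtain ⟨σ, rfl⟩ := Circle.exists_zpow_eq M.p_ne_zero τ
      exact Or.inr ⟨σ, by rw [hy]⟩
    · have h := FramedNhd.SurgeryRel.glue (ν := M.nhd) (Circle.exp (Complex.arg y)) τ⁻¹ ‖y‖
        (norm_pos_iff.mpr hy)
      rw [inv_inv, Circle.coe_exp, Complex.norm_mul_exp_arg_mul_I] at h
      exact Or.inl ⟨_, (Quot.sound h).symm⟩

theorem toLens_inl (M : LensModel a b e p q) (m) : M.toLens (Quot.mk _ (Sum.inl m)) = M.outer m := rfl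

theorem toLens_inr (M : LensModel a b e p q) (y) : M.toLens (Quot.mk _ (Sum.inr y)) = M.inner y := rfl

theorem inner_zero (M : LensModel a b e p q) (σ : Circle) :
    M.inner (0, σ ^ p) = Quot.mk _ (M.κ.symm (knotNhd a b (σ, 0))) := by
  rw [M.inner_eq, map_zero, zero_mul]

theorem outer_ne_inner_zero (M : LensModel a b e p q) (m) (σ : Circle) : M.outer m ≠ M.inner (0, σ ^ p) := by
  intro h
  rw [M.inner_zero, outer] at h
  obtain ⟨ζ, -, h⟩ := M.exists_rot_of_mk_eq h
  rw [rotS3_mul] at h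
  exact M.rotS3_notMem m.2 _ (h ▸ knotNhd_zero_mem a b σ)

theorem toLens_injective (M : LensModel a b e p q) : Function.Injective M.toLens := by
  intro y y' h
  rcases M.exists_inr_or_inl y with ⟨m, rfl⟩ | ⟨σ, rfl⟩ <;>
    rcases M.exists_inr_or_inl y' with ⟨m', rfl⟩ | ⟨σ', rfl⟩ <;>
    simp only [toLens_inl, toLens_inr] at h
  · obtain ⟨ζ, hζ, h⟩ := M.exists_rot_of_mk_eq h
    have h2 := congrArg (phaseRot a b e) h
    rw [M.phaseRot_rot (M.rotS3_notMem m.2 _) hζ,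
      M.phaseRot_inv_rot m'.2 (circleRoot_zpow M.p_ne_zero _),
      M.phaseRot_inv_rot m.2 (circleRoot_zpow M.p_ne_zero _)] at h2
    rw [Subtype.ext h2]
  · exact absurd h (M.outer_ne_inner_zero m σ')
  · exact absurd h.symm (M.outer_ne_inner_zero m' σ)
  · rw [M.inner_zero, M.inner_zero] at h
    obtain ⟨ζ, hζ, h⟩ := M.exists_rot_of_mk_eq h
    rw [← knotNhd_mul] at h
    have h2 := congrArg Prod.fst (knotNhd_injective M.left_ne_zero M.right_ne_zero M.coprime h)
    simp only at h2
    rw [h2, mul_zpow, hζ, one_mul]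

theorem toLens_surjective (M : LensModel a b e p q) : Function.Surjective M.toLens := by
  intro y
  obtain ⟨x, rfl⟩ := Quot.exists_rep y
  by_cases hx : M.κ x ∈ torusKnot a b
  · obtain ⟨σ, hσ⟩ := exists_eq_knotNhd hx
    refine ⟨Quot.mk _ (Sum.inr (0, σ ^ p)), ?_⟩
    rw [M.toLens_inr, M.inner_zero, ← hσ, M.κ.symm_apply_apply]
  · exact ⟨Quot.mk _ (Sum.inl _), M.outer_phaseRot hx⟩

end LensModel

/-! ### The identification of the surgery with the lens space is an oriented diffeomorphism -/

/-- A parametrization of the solid torus near `(y, exp (p * θ))`. -/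
noncomputable def torusParam (p : ℤ) (y : ℂ) (θ : ℝ) (x : ℝ × ℂ) : ℂ × Circle :=
  (y + x.2, Circle.exp (θ + x.1) ^ p)

theorem isPositiveInSolidTorus_torusParam {p : ℤ} (hp : 0 < p) (y : ℂ) (θ : ℝ) :
    IsPositiveInSolidTorus (torusParam p y θ) := by
  have heq : (fun x => ((torusParam p y θ x).1, ((torusParam p y θ x).2 : ℂ))) =
      fun x : ℝ × ℂ => (y + x.2, Complex.exp ((p * θ + p * x.1 : ℝ) * Complex.I)) := by
    funext x
    simp only [torusParam, ← Circle.exp_intCast_mul, Circle.coe_exp, mul_add]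
  have hc : ContDiff ℝ ∞
      fun x : ℝ × ℂ => (y + x.2, Complex.exp ((p * θ + p * x.1 : ℝ) * Complex.I)) := by
    refine ContDiff.prodMk (contDiff_const.add contDiff_snd) (ContDiff.cexp
      (ContDiff.mul ?_ contDiff_const))
    exact Complex.ofRealCLM.contDiff.comp (contDiff_const.add (contDiff_const.mul contDiff_fst))
  have hd := hc.differentiable (by simp) 0
  have hv (v : ℝ × ℂ) : fderiv ℝ
      (fun x : ℝ × ℂ => (y + x.2, Complex.exp ((p * θ + p * x.1 : ℝ) * Complex.I))) 0 v =
      (v.2, (p * v.1 : ℝ) * Complex.I * Complex.exp ((p * θ : ℝ) * Complex.I)) := by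
    refine fderiv_eq_of_hasLineDerivAt hd ?_
    have h : HasDerivAt (fun t : ℝ => (y + t • v.2,
        Complex.exp ((p * θ + (p * v.1) * t : ℝ) * Complex.I)))
        (v.2, (p * v.1 : ℝ) * Complex.I * Complex.exp ((p * θ : ℝ) * Complex.I)) 0 := by
      refine HasDerivAt.prodMk ?_ (hasDerivAt_cexp_line _ _)
      simpa using ((hasDerivAt_id (0 : ℝ)).smul_const v.2).const_add y
    refine h.congr_of_eventuallyEq (Filter.Eventually.of_forall fun t => ?_)
    have h1 : (p * v.1) * t = p * (t * v.1) := by ring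
    simp only [h1, zero_add]
    rfl
  refine ⟨by rw [heq]; exact hc.contDiffAt, ?_⟩
  have h0 : ((torusParam p y θ 0).2 : ℂ) = Complex.exp ((p * θ : ℝ) * Complex.I) := by
    simp [torusParam, ← Circle.exp_intCast_mul, Circle.coe_exp]
  rw [heq, h0, IsPositiveFrame, det_fin_four, hv, hv, hv]
  have hu : (Complex.exp ((p * θ : ℝ) * Complex.I)).re ^ 2 +
      (Complex.exp ((p * θ : ℝ) * Complex.I)).im ^ 2 = 1 := by
    rw [Complex.exp_ofReal_mul_I_re, Complex.exp_ofReal_mul_I_im, Real.cos_sq_add_sin_sq]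
  generalize Complex.exp ((p * θ : ℝ) * Complex.I) = u at hu
  have hp' : (0 : ℝ) < p := Int.cast_pos.mpr hp
  simp [realCoords]
  nlinarith

theorem nhds_le_map_torusParam {p : ℤ} (hp : p ≠ 0) (y : ℂ) (θ : ℝ) :
    𝓝 (y, Circle.exp θ ^ p) ≤ Filter.map (torusParam p y θ) (𝓝 0) := by
  have h1 : Filter.map (fun c : ℂ => y + c) (𝓝 0) = 𝓝 y := by simp
  have hp' : (p : ℝ) ≠ 0 := Int.cast_ne_zero.mpr hp
  have h2 : Filter.map (fun s : ℝ => Circle.exp (θ + s) ^ p) (𝓝 0) = 𝓝 (Circle.exp θ ^ p) := by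
    have h3 : (fun s : ℝ => Circle.exp (θ + s) ^ p) =
        Circle.exp ∘ ((Homeomorph.addLeft θ).trans (Homeomorph.mulLeft₀ (p : ℝ) hp')) := by
      funext s
      rw [← Circle.exp_intCast_mul]
      rfl
    rw [h3, ← Filter.map_map, Homeomorph.map_nhds_eq, isLocalHomeomorph_circleExp.map_nhds_eq]
    simp [← Circle.exp_intCast_mul]
  rw [nhds_prod_eq, ← h1, ← h2, Filter.prod_map_map_eq, Prod.zero_eq_mk, nhds_prod_eq,
    Filter.prod_comm (f := 𝓝 (0 : ℂ)), Filter.map_map]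
  exact le_rfl

namespace LensModel

variable {a b : ℕ} {e p q : ℤ}

/-- Two signs e cancel: one from `J`, one from the linear map inverse to κ. -/
theorem isPositiveInS3_inner (M : LensModel a b e p q) (y : ℂ) (θ : ℝ) :
    IsPositiveInS3 fun x => M.κ.symm (knotNhd a b (Circle.exp (θ + x.1),
      M.J (y + x.2) * ((Circle.exp (θ + x.1) ^ (-p) : Circle) : ℂ))) := by
  refine isPositiveInS3_of_eventuallyEq (F := knotNhdLift a b) M.linSymm
    (b := twistMap (-p) θ (-p * θ) y M.J) (Filter.Eventually.of_forall fun x => ?_)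
    (contDiff_knotNhdLift a b).contDiffAt (contDiff_twistMap _ _ _ _ _).contDiffAt ?_
  · simp only [M.coe_κ_symm, knotNhd_exp, twistMap, ← Circle.exp_intCast_mul, Circle.coe_exp]
    congr 2
    ext1
    · simp only; ring
    · simp only
      rw [mul_comm, add_comm x.2]
      congr 3
      push_cast; ring
  · rw [det_fderiv_twistMap, M.det_J, ← mul_assoc, mul_comm _ (e : ℝ)]
    exact mul_pos M.det_linSymm (frameDet_knotNhdLift_pos M.left_ne_zero M.right_ne_zero _)

/-- The sign e of κ cancels against the one in the Jacobian factor 1 + e·ab = e·p of `phaseRot`. -/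
theorem isPositiveInS3_phaseRot (M : LensModel a b e p q) {x₀ : S3} (hx : M.κ x₀ ∉ torusKnot a b) :
    IsPositiveInS3 fun x => phaseRot a b e (M.κ (sphereParam x₀ x)) := by
  have h1 := isPositiveInS3_sphereParam x₀
  have heq : (fun x => (M.κ (sphereParam x₀ x)).1) = fun x => M.lin (sphereParam x₀ x).1 := by
    funext x; exact M.coe_κ _
  have hγ : ContDiffAt ℝ ∞ (fun x => (M.κ (sphereParam x₀ x)).1) 0 := by
    rw [heq]
    exact M.lin.contDiff.contDiffAt.comp (0 : ℝ × ℂ) h1.1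
  have hd : 0 < e * frameDet (M.κ (sphereParam x₀ 0)).1
      (fderiv ℝ (fun x => (M.κ (sphereParam x₀ x)).1) 0) := by
    have h2 := frameDet_chain (F := fun x => (sphereParam x₀ x).1) (T := M.lin) (b := id) (u := 0)
      (h1.1.differentiableAt (by simp)) differentiableAt_id
    simp only [id] at h2
    rw [heq, M.coe_κ, h2, ← mul_assoc]
    refine mul_pos M.det_lin ?_
    have h3 := h1.frameDet_pos
    have h4 : fderiv ℝ (id : ℝ × ℂ → ℝ × ℂ) 0 = ContinuousLinearMap.id ℝ _ := fderiv_id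
    rw [h4]
    simpa using h3
  obtain ⟨h3, h4⟩ := frameDet_phaseRot (e := e) hγ (right_ne_zero_of_mul hd.ne')
    (by rw [sphereParam_zero]; exact M.knotPoly_ne_zero hx)
  refine ⟨h3, ?_⟩
  rw [isPositiveFrame_iff, h4]
  have h5 : (1 + e * (a * b) : ℝ) = e * p := by exact_mod_cast M.one_add_mul
  rw [h5, mul_right_comm]
  exact mul_pos hd (Int.cast_pos.mpr M.pos)

/-- Instead of differentiating `outer`, which contains a discontinuous root, a parametrization of
the sphere is pushed to the complement by `phaseRot`, which `outer` undoes. Continuity of `outer` is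
read off from this as well. -/
theorem exists_positive_inl (M : LensModel a b e p q) (m : {x : S3 // x ∉ torusKnot a b}) :
    ∃ (α : ℝ × ℂ → {x : S3 // x ∉ torusKnot a b}) (β : ℝ × ℂ → S3), α 0 = m ∧
      IsPositiveInS3 (fun x => (α x).1) ∧ IsPositiveInS3 β ∧
      (fun x => M.outer (α x)) =ᶠ[𝓝 0] fun x => Quot.mk _ (β x) := by
  classical
  set r := circleRoot p (knotPhase a b m.1) with hr
  have hrp : r ^ p = knotPhase a b m.1 := circleRoot_zpow M.p_ne_zero _
  set x₀ : S3 := M.κ.symm (rotS3 a b r⁻¹ m.1) with hx₀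
  have hκ : M.κ x₀ = rotS3 a b r⁻¹ m.1 := M.κ.apply_symm_apply _
  have hm : M.κ x₀ ∉ torusKnot a b := hκ ▸ M.rotS3_notMem m.2 _
  have hnear : ∀ᶠ x in 𝓝 (0 : ℝ × ℂ), M.κ (sphereParam x₀ x) ∉ torusKnot a b := by
    have hc : ContinuousAt (fun x => knotPoly a b (M.lin (sphereParam x₀ x).1)) 0 :=
      ((continuous_knotPoly a b).comp M.lin.continuous).continuousAt.comp
        (isPositiveInS3_sphereParam x₀).1.continuousAt
    have h0 : knotPoly a b (M.lin (sphereParam x₀ 0).1) ≠ 0 := by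
      rw [sphereParam_zero, ← M.coe_κ]; exact M.knotPoly_ne_zero hm
    filter_upwards [hc.eventually_ne h0] with x hx hmem
    rw [← M.coe_κ] at hx
    exact hx ((knotPoly_eq_zero_iff M.left_ne_zero M.right_ne_zero M.coprime).mpr hmem)
  -- Only the germ at 0 matters; the value `m` taken where the parametrization meets the knot is
  -- arbitrary.
  have heq : (fun x => ((if h : M.κ (sphereParam x₀ x) ∉ torusKnot a b then
      ⟨phaseRot a b e (M.κ (sphereParam x₀ x)), M.phaseRot_notMem h⟩ else m :
        {x : S3 // x ∉ torusKnot a b})).1) =ᶠ[𝓝 0]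
      fun x => phaseRot a b e (M.κ (sphereParam x₀ x)) := by
    filter_upwards [hnear] with x hx
    rw [dif_pos hx]
  refine ⟨_, sphereParam x₀, ?_, (M.isPositiveInS3_phaseRot hm).congr heq,
    isPositiveInS3_sphereParam x₀, ?_⟩
  · apply Subtype.ext
    rw [heq.eq_of_nhds, sphereParam_zero, hκ, M.phaseRot_inv_rot m.2 hrp]
  · filter_upwards [hnear] with x hx
    rw [dif_pos hx, M.outer_phaseRot hx]

theorem continuous_outer (M : LensModel a b e p q) : Continuous M.outer := by
  refine continuous_iff_continuousAt.mpr fun m => ?_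
  obtain ⟨α, β, h0, hα, hβ, h⟩ := M.exists_positive_inl m
  have h1 : Filter.map α (𝓝 0) = 𝓝 m := by
    have h2 := hα.map_nhds
    rw [h0] at h2
    have h3 : Filter.map (fun x => (α x).1) (𝓝 0) = Filter.map Subtype.val (Filter.map α (𝓝 0)) :=
      Filter.map_map.symm
    refine (Filter.comap_map Subtype.val_injective).symm.trans ?_
    rw [← h3, h2]
    exact (nhds_subtype_eq_comap).symm
  rw [ContinuousAt, ← h1, Filter.tendsto_map'_iff, ← h0]
  refine Filter.Tendsto.congr' h.symm ?_
  have h3 : M.outer (α 0) = Quot.mk _ (β 0) := h.eq_of_nhds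
  rw [h3]
  have h4 : Continuous (Quot.mk (lensRel p q)) := continuous_quot_mk
  exact h4.continuousAt.tendsto.comp hβ.map_nhds.le

theorem inner_torusParam (M : LensModel a b e p q) (y : ℂ) (θ : ℝ) (x : ℝ × ℂ) :
    M.inner (torusParam p y θ x) = Quot.mk _ (M.κ.symm (knotNhd a b (Circle.exp (θ + x.1),
      M.J (y + x.2) * ((Circle.exp (θ + x.1) ^ (-p) : Circle) : ℂ)))) := M.inner_eq _ _

theorem continuous_inner (M : LensModel a b e p q) : Continuous M.inner := by
  refine continuous_iff_continuousAt.mpr fun ⟨y, τ⟩ => ?_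
  obtain ⟨σ, rfl⟩ := Circle.exists_zpow_eq M.p_ne_zero τ
  obtain ⟨θ, rfl⟩ := Circle.exp_surjective σ
  have h := M.isPositiveInS3_inner y θ
  refine Filter.Tendsto.mono_left ?_ (nhds_le_map_torusParam M.p_ne_zero y θ)
  rw [Filter.tendsto_map'_iff]
  have h3 := M.inner_torusParam y θ 0
  have h4 : Continuous (Quot.mk (lensRel p q)) := continuous_quot_mk
  have h5 : M.inner (y, Circle.exp θ ^ p) = M.inner (torusParam p y θ 0) := by
    simp [torusParam]
  rw [h5, h3]
  refine Filter.Tendsto.congr (fun x => (M.inner_torusParam y θ x).symm) ?_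
  exact h4.continuousAt.tendsto.comp h.map_nhds.le

theorem continuous_toLens (M : LensModel a b e p q) : Continuous M.toLens :=
  continuous_quot_lift _ (M.continuous_outer.sumElim M.continuous_inner)

theorem exists_positive (M : LensModel a b e p q) (y : M.nhd.Surgery) :
    ∃ φ : ℝ × ℂ → M.nhd.Surgery, φ 0 = y ∧ ContinuousAt φ 0 ∧
      OrientedSmooth.IsPositive φ ∧ OrientedSmooth.IsPositive (M.toLens ∘ φ) := by
  have hq : Continuous (Quot.mk M.nhd.SurgeryRel) := continuous_quot_mk
  obtain ⟨m | ⟨y, τ⟩, rfl⟩ := Quot.exists_rep y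
  · obtain ⟨α, β, h0, hα, hβ, h⟩ := M.exists_positive_inl m
    refine ⟨fun x => Quot.mk _ (Sum.inl (α x)), by simp only [h0]; rfl, ?_,
      Or.inl ⟨α, hα, Filter.EventuallyEq.rfl⟩, ⟨β, hβ, h⟩⟩
    have h1 : ContinuousAt α 0 :=
      Topology.IsInducing.subtypeVal.continuousAt_iff.mpr hα.map_nhds.le
    exact (hq.comp continuous_inl).continuousAt.comp h1
  · obtain ⟨σ, rfl⟩ := Circle.exists_zpow_eq M.p_ne_zero τ
    obtain ⟨θ, rfl⟩ := Circle.exp_surjective σ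
    refine ⟨fun x => Quot.mk _ (Sum.inr (torusParam p y θ x)), by simp [torusParam]; rfl, ?_,
      Or.inr ⟨_, isPositiveInSolidTorus_torusParam M.pos y θ, Filter.EventuallyEq.rfl⟩,
      ⟨_, M.isPositiveInS3_inner y θ, Filter.Eventually.of_forall (M.inner_torusParam y θ)⟩⟩
    have h1 : Continuous (torusParam p y θ) := by
      unfold torusParam
      fun_prop
    exact ((hq.comp continuous_inr).comp h1).continuousAt

theorem isOpenMap_lensMk (p q : ℤ) :
    IsOpenMap (Quot.mk (lensRel p q) : S3 → Quot (lensRel p q)) := by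
  intro U hU
  have h : Quot.mk (lensRel p q) ⁻¹' (Quot.mk (lensRel p q) '' U) =
      ⋃ ζ : {ζ : Circle // ζ ^ p = 1}, diagS3 ζ (ζ ^ q) ⁻¹' U := by
    ext x
    simp only [Set.mem_preimage, Set.mem_image, Set.mem_iUnion]
    constructor
    · rintro ⟨y, hy, h⟩
      obtain ⟨ζ, hζ, rfl⟩ := lensRel_iff.mp (lensMk_eq_iff.mp h.symm)
      exact ⟨⟨ζ, hζ⟩, hy⟩
    · rintro ⟨ζ, h⟩
      exact ⟨_, h, lensMk_eq_iff.mpr ((lensRel_equivalence p q).symm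
        (lensRel_iff.mpr ⟨ζ, ζ.2, rfl⟩))⟩
  refine isQuotientMap_quot_mk.isOpen_preimage.mp ?_
  rw [h]
  refine isOpen_iUnion fun ζ => hU.preimage ?_
  exact Continuous.subtype_mk ((diagMap _ _).continuous.comp continuous_subtype_val) _

theorem map_nhds_of_isPositive {φ : ℝ × ℂ → LensSpace p q} (h : OrientedSmooth.IsPositive φ) :
    𝓝 (φ 0) ≤ Filter.map φ (𝓝 0) := by
  obtain ⟨α, hα, e⟩ := h
  rw [Filter.map_congr e, e.eq_of_nhds]
  refine ((isOpenMap_lensMk p q).nhds_le _).trans ?_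
  rw [← hα.map_nhds, Filter.map_map]
  rfl

theorem orientedDiffeomorphic (M : LensModel a b e p q) :
    OrientedDiffeomorphic M.nhd.Surgery (LensSpace p q) := by
  have hopen : IsOpenMap M.toLens := by
    refine IsOpenMap.of_nhds_le fun y => ?_
    obtain ⟨φ, rfl, hc, -, h2⟩ := M.exists_positive y
    refine (map_nhds_of_isPositive h2).trans ?_
    rw [← Filter.map_map]
    exact Filter.map_mono hc
  refine ⟨(Equiv.ofBijective M.toLens ⟨M.toLens_injective,
    M.toLens_surjective⟩).toHomeomorphOfContinuousOpen M.continuous_toLens hopen, fun y => ?_⟩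
  obtain ⟨φ, h0, -, h1, h2⟩ := M.exists_positive y
  exact ⟨φ, h0, h1, h2⟩

end LensModel

/-! ### The two lens space surgeries -/

theorem Circle.zpow_eq_of_dvd {ζ : Circle} {p m n : ℤ} (hζ : ζ ^ p = 1) (h : p ∣ m - n) :
    ζ ^ m = ζ ^ n := by
  obtain ⟨k, hk⟩ := h
  rw [sub_eq_iff_eq_add.mp hk, zpow_add, zpow_mul, hζ, one_zpow, one_mul]

/-- The surgery with coefficient `a * b + 1` on the torus knot. -/
noncomputable def lensModelAddOne {a b : ℕ} (ha : a ≠ 0) (hb : b ≠ 0) (h : Nat.Coprime a b)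
    {p q : ℤ} (hp : p = a * b + 1) (hq : p ∣ q + b ^ 2) : LensModel a b 1 p q where
  left_ne_zero := ha
  right_ne_zero := hb
  coprime := h
  sign_mul_self := one_mul 1
  eq_add := hp
  pos := by rw [hp]; positivity
  J := ContinuousLinearMap.id ℝ ℂ
  map_polar r t := by simp
  det_J := by simp
  κ := Equiv.refl S3
  lin := ContinuousLinearMap.id ℝ (ℂ × ℂ)
  linSymm := ContinuousLinearMap.id ℝ (ℂ × ℂ)
  coe_κ x := rfl
  coe_κ_symm x := rfl
  det_lin := by rw [ContinuousLinearMap.coe_id, LinearMap.det_id]; norm_num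
  det_linSymm := by rw [ContinuousLinearMap.coe_id, LinearMap.det_id]; norm_num
  rel_iff x y := by
    rw [lensRel_iff]
    simp only [Equiv.refl_apply, rotS3]
    constructor
    · rintro ⟨ζ, hζ, rfl⟩
      -- For ξ = ζ^{-b} one has ξ^a = ζ^{1-p} = ζ and ξ^b = ζ^{-b²} = ζ^q.
      refine ⟨ζ ^ (-b : ℤ), by rw [zpow_comm, hζ, one_zpow], ?_⟩
      congr 1 <;> rw [← zpow_natCast, ← zpow_mul]
      · rw [← zpow_one ζ, ← zpow_mul]
        exact Circle.zpow_eq_of_dvd hζ ⟨1, by rw [hp]; ring⟩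
      · refine Circle.zpow_eq_of_dvd hζ ?_
        convert hq using 1
        ring
    · rintro ⟨ξ, hξ, rfl⟩
      refine ⟨ξ ^ a, by rw [← zpow_natCast, zpow_comm, hξ, one_zpow], ?_⟩
      congr 1
      rw [← zpow_natCast, ← zpow_natCast, ← zpow_mul]
      refine Circle.zpow_eq_of_dvd hξ ?_
      have h1 : (b - a * q : ℤ) = p * b - a * (q + b ^ 2) := by rw [hp]; ring
      rw [h1]
      exact dvd_sub (dvd_mul_right _ _) (hq.mul_left _)

/-- The reflection `(z, w) ↦ (w, conj z)`. -/
noncomputable def flipConj : ℂ × ℂ →L[ℝ] ℂ × ℂ :=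
  (ContinuousLinearMap.snd ℝ ℂ ℂ).prod
    ((Complex.conjCLE : ℂ →L[ℝ] ℂ).comp (ContinuousLinearMap.fst ℝ ℂ ℂ))

/-- The reflection `(z, w) ↦ (conj w, z)`, inverse to `flipConj`. -/
noncomputable def flipConjSymm : ℂ × ℂ →L[ℝ] ℂ × ℂ :=
  ((Complex.conjCLE : ℂ →L[ℝ] ℂ).comp (ContinuousLinearMap.snd ℝ ℂ ℂ)).prod
    (ContinuousLinearMap.fst ℝ ℂ ℂ)

theorem flipConj_apply (x : ℂ × ℂ) : flipConj x = (x.2, starRingEnd ℂ x.1) := rfl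

theorem flipConjSymm_apply (x : ℂ × ℂ) : flipConjSymm x = (starRingEnd ℂ x.2, x.1) := rfl

theorem det_flipConj : LinearMap.det (flipConj : ℂ × ℂ →ₗ[ℝ] ℂ × ℂ) = -1 := by
  rw [det_eq_volC2, volC2_vec, det_fin_four]
  simp [realCoords, flipConj_apply]

theorem det_flipConjSymm : LinearMap.det (flipConjSymm : ℂ × ℂ →ₗ[ℝ] ℂ × ℂ) = -1 := by
  rw [det_eq_volC2, volC2_vec, det_fin_four]
  simp [realCoords, flipConjSymm_apply]

/-- The reflection `flipConj` of the sphere. -/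
noncomputable def flipS3 : S3 ≃ S3 where
  toFun x := ⟨flipConj x.1, by
    rw [flipConj_apply, RCLike.norm_conj, add_comm]; exact x.2⟩
  invFun x := ⟨flipConjSymm x.1, by
    rw [flipConjSymm_apply, RCLike.norm_conj, add_comm]; exact x.2⟩
  left_inv x := by simp [flipConj_apply, flipConjSymm_apply]
  right_inv x := by simp [flipConj_apply, flipConjSymm_apply]

theorem flipS3_diagS3 (u v : Circle) (x : S3) :
    flipS3 (diagS3 u v x) = diagS3 v u⁻¹ (flipS3 x) := by
  apply Subtype.ext
  simp [flipS3, diagS3, flipConj_apply, diagMap_apply, Circle.coe_inv_eq_conj, -Circle.coe_inv]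

/-- The surgery with coefficient `a * b - 1` on the torus knot. -/
noncomputable def lensModelSubOne {a b : ℕ} (ha : 2 ≤ a) (hb : 2 ≤ b) (h : Nat.Coprime a b)
    {p q : ℤ} (hp : p = a * b - 1) (hq : p ∣ q + a ^ 2) : LensModel a b (-1) p q where
  left_ne_zero := by omega
  right_ne_zero := by omega
  coprime := h
  sign_mul_self := by norm_num
  eq_add := hp
  pos := by rw [hp]; nlinarith
  J := (Complex.conjCLE : ℂ →L[ℝ] ℂ)
  map_polar r t := by simp [Circle.coe_inv_eq_conj, -Circle.coe_inv]
  det_J := by simp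
  κ := flipS3
  lin := flipConj
  linSymm := flipConjSymm
  coe_κ x := rfl
  coe_κ_symm x := rfl
  det_lin := by rw [det_flipConj]; norm_num
  det_linSymm := by rw [det_flipConjSymm]; norm_num
  rel_iff x y := by
    rw [lensRel_iff]
    simp only [rotS3]
    constructor
    · rintro ⟨ζ, hζ, rfl⟩
      -- The reflection turns the weights (1, q) into (q, -1). For ξ = ζ^{-a} one has ξ^a = ζ^{-a²}
      -- = ζ^q and ξ^b = ζ^{-(p+1)} = ζ⁻¹.
      refine ⟨ζ ^ (-a : ℤ), by rw [zpow_comm, hζ, one_zpow], ?_⟩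
      rw [flipS3_diagS3]
      congr 1 <;> rw [← zpow_natCast, ← zpow_mul]
      · refine Circle.zpow_eq_of_dvd hζ ?_
        convert hq using 1
        ring
      · rw [← zpow_neg_one]
        exact Circle.zpow_eq_of_dvd hζ ⟨1, by rw [hp]; ring⟩
    · rintro ⟨ξ, hξ, hy⟩
      refine ⟨ξ ^ (-b : ℤ), by rw [zpow_comm, hξ, one_zpow], flipS3.injective ?_⟩
      rw [hy, flipS3_diagS3]
      congr 1
      · rw [← zpow_natCast, ← zpow_mul]
        refine Circle.zpow_eq_of_dvd hξ ?_
        have h1 : (a - -b * q : ℤ) = b * (q + a ^ 2) - p * a := by rw [hp]; ring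
        rw [h1]
        exact dvd_sub (hq.mul_left _) (dvd_mul_right _ _)
      · simp

/-! ### Abelian characters of the fundamental group, evaluated on paths -/

section PathChar

open Path

variable {X : Type*} [TopologicalSpace X] {x₀ : X} {A : Type*} [CommGroup A]

open Classical in
/-- The value of a character of the fundamental group on a path, with the ends joined to the base
point by auxiliary paths. -/
noncomputable def pathChar (χ : FundamentalGroup X x₀ →* A) {x y : X} (γ : Path x y) : A :=
  if h : Joined x₀ x then χ (FundamentalGroup.fromPath
    ((Homotopic.Quotient.mk h.somePath).trans ((Homotopic.Quotient.mk γ).trans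
      (Homotopic.Quotient.mk (Joined.trans h ⟨γ⟩).somePath).symm))) else 1

variable (χ : FundamentalGroup X x₀ →* A)

theorem map_fromPath_trans (g h : Homotopic.Quotient x₀ x₀) :
    χ (FundamentalGroup.fromPath (g.trans h)) =
      χ (FundamentalGroup.fromPath g) * χ (FundamentalGroup.fromPath h) := by
  -- The group law reverses concatenation; commutativity of `A` makes this harmless.
  have h1 : FundamentalGroup.fromPath (g.trans h) =
      FundamentalGroup.fromPath h * FundamentalGroup.fromPath g := rfl
  rw [h1, map_mul, mul_comm]

theorem pathChar_eq_of_homotopic {x y : X} {γ γ' : Path x y} (h : γ.Homotopic γ') :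
    pathChar χ γ = pathChar χ γ' := by
  simp only [pathChar, Homotopic.Quotient.eq.mpr h]

theorem pathChar_congr {x y x' y' : X} {γ : Path x y} {γ' : Path x' y'} (h : ∀ t, γ t = γ' t) :
    pathChar χ γ = pathChar χ γ' := by
  have hx : x = x' := by simpa using h 0
  have hy : y = y' := by simpa using h 1
  subst hx hy
  congr 1
  ext t
  exact h t

/-- The auxiliary path to a point depends only on the point, so the two copies at y cancel. -/
theorem pathChar_trans {x y z : X} (γ : Path x y) (δ : Path y z) :
    pathChar χ (γ.trans δ) = pathChar χ γ * pathChar χ δ := by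
  by_cases h : Joined x₀ x
  · have h' : Joined x₀ y := Joined.trans h ⟨γ⟩
    rw [pathChar, pathChar, pathChar, dif_pos h, dif_pos h, dif_pos h', ← map_fromPath_trans]
    simp only [Homotopic.Quotient.trans_assoc, Homotopic.Quotient.mk_trans]
    rw [← Homotopic.Quotient.trans_assoc (Homotopic.Quotient.symm _), Homotopic.Quotient.symm_trans, Homotopic.Quotient.refl_trans]
  · have h' : ¬ Joined x₀ y := fun h' => h (Joined.trans h' (Joined.symm ⟨γ⟩))
    rw [pathChar, pathChar, pathChar, dif_neg h, dif_neg h, dif_neg h', one_mul]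

theorem pathChar_refl (x : X) : pathChar χ (Path.refl x) = 1 := by
  have h := pathChar_trans χ (Path.refl x) (Path.refl x)
  rwa [Path.refl_trans_refl, right_eq_mul] at h

theorem pathChar_loop (γ : Path x₀ x₀) :
    pathChar χ γ = χ (FundamentalGroup.fromPath (Homotopic.Quotient.mk γ)) := by
  have h : Joined x₀ x₀ := Joined.refl x₀
  rw [pathChar, dif_pos h, map_fromPath_trans, map_fromPath_trans, mul_left_comm,
    ← map_fromPath_trans, Homotopic.Quotient.trans_symm]
  have h1 : χ (FundamentalGroup.fromPath (Homotopic.Quotient.refl x₀)) = 1 := map_one χ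
  rw [h1, mul_one]

end PathChar

/-! ### Characters on images of segments -/

section SegChar

variable {Y : Type*} [TopologicalSpace Y] {P : Y → Prop} {x₀ : {y // P y}} {A : Type*} [CommGroup A]
  {E : Type*} [AddCommGroup E] [Module ℝ E] [TopologicalSpace E] [IsTopologicalAddGroup E]
  [ContinuousSMul ℝ E]

open Classical in
/-- The value of a character on the image of a segment. -/
noncomputable def segChar (χ : FundamentalGroup {y // P y} x₀ →* A) (F : C(E, Y)) (x y : E) : A :=
  if h : ∀ t, P (F (Path.segment x y t)) then
    pathChar χ (x := ⟨F x, by simpa using h 0⟩) (y := ⟨F y, by simpa using h 1⟩)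
      { toFun := fun t => ⟨F (Path.segment x y t), h t⟩
        continuous_toFun := Continuous.subtype_mk (by fun_prop) _
        source' := by simp
        target' := by simp }
  else 1

variable (χ : FundamentalGroup {y // P y} x₀ →* A) (F : C(E, Y))

theorem segment_apply_mem {C : Set E} (hC : Convex ℝ C) {x y : E} (hx : x ∈ C) (hy : y ∈ C)
    (t : unitInterval) : Path.segment x y t ∈ C := by
  refine hC.segment_subset hx hy ?_
  rw [← Path.range_segment]
  exact ⟨t, rfl⟩

/-- A convex set is simply connected, so paths in it are homotopic to the segment, and only the ends
matter. -/
theorem pathChar_eq_segChar {C : Set E} (hC : Convex ℝ C) (hP : ∀ z ∈ C, P (F z)) {x y : E}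
    (γ : Path x y) (hγ : ∀ t, γ t ∈ C) {u v : {y // P y}} (δ : Path u v)
    (hδ : ∀ t, (δ t).1 = F (γ t)) : pathChar χ δ = segChar χ F x y := by
  have hx : x ∈ C := by simpa using hγ 0
  have hy : y ∈ C := by simpa using hγ 1
  have hs := segment_apply_mem hC hx hy
  have : ContractibleSpace C := hC.contractibleSpace ⟨x, hx⟩
  let γC : Path (⟨x, hx⟩ : C) ⟨y, hy⟩ :=
    { toFun := fun t => ⟨γ t, hγ t⟩
      continuous_toFun := Continuous.subtype_mk (by fun_prop) _
      source' := by simp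
      target' := by simp }
  let sC : Path (⟨x, hx⟩ : C) ⟨y, hy⟩ :=
    { toFun := fun t => ⟨Path.segment x y t, hs t⟩
      continuous_toFun := Continuous.subtype_mk (by fun_prop) _
      source' := by simp
      target' := by simp }
  let G : C(C, {y // P y}) := ⟨fun z => ⟨F z, hP z z.2⟩, Continuous.subtype_mk (by fun_prop) _⟩
  have h := (SimplyConnectedSpace.paths_homotopic γC sC).map G
  rw [segChar, dif_pos fun t => hP _ (hs t)]
  refine (pathChar_congr χ (γ' := γC.map G.continuous) fun t => Subtype.ext (hδ t)).trans ?_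
  refine (pathChar_eq_of_homotopic χ h).trans (pathChar_congr χ fun t => rfl)

theorem segChar_trans {C : Set E} (hC : Convex ℝ C) (hP : ∀ z ∈ C, P (F z)) {x y z : E}
    (hx : x ∈ C) (hy : y ∈ C) (hz : z ∈ C) :
    segChar χ F x y * segChar χ F y z = segChar χ F x z := by
  have h1 := segment_apply_mem hC hx hy
  have h2 := segment_apply_mem hC hy hz
  have h3 (t : unitInterval) : ((Path.segment x y).trans (Path.segment y z)) t ∈ C := by
    rw [Path.trans_apply]
    split_ifs
    exacts [h1 _, h2 _]
  let lift {x y : E} (γ : Path x y) (hγ : ∀ t, γ t ∈ C) (hx : x ∈ C) (hy : y ∈ C) :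
      Path (⟨F x, hP x hx⟩ : {y // P y}) ⟨F y, hP y hy⟩ :=
    { toFun := fun t => ⟨F (γ t), hP _ (hγ t)⟩
      continuous_toFun := Continuous.subtype_mk (by fun_prop) _
      source' := by simp
      target' := by simp }
  rw [← pathChar_eq_segChar χ F hC hP _ h1 (lift _ h1 hx hy) fun t => rfl,
    ← pathChar_eq_segChar χ F hC hP _ h2 (lift _ h2 hy hz) fun t => rfl,
    ← pathChar_eq_segChar χ F hC hP _ h3 (lift _ h3 hx hz) fun t => rfl, ← pathChar_trans]
  refine pathChar_congr χ fun t => Subtype.ext ?_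
  simp only [Path.trans_apply, lift, Path.coe_mk_mk]
  split_ifs <;> rfl

theorem segChar_congr {E' : Type*} [AddCommGroup E'] [Module ℝ E'] [TopologicalSpace E']
    [IsTopologicalAddGroup E'] [ContinuousSMul ℝ E'] {F' : C(E', Y)} {x y : E} {x' y' : E'}
    (h : ∀ t, F (Path.segment x y t) = F' (Path.segment x' y' t)) :
    segChar χ F x y = segChar χ F' x' y' := by
  by_cases hP : ∀ t, P (F (Path.segment x y t))
  · have hP' : ∀ t, P (F' (Path.segment x' y' t)) := fun t => h t ▸ hP t
    rw [segChar, segChar, dif_pos hP, dif_pos hP']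
    exact pathChar_congr χ fun t => Subtype.ext (h t)
  · have hP' : ¬ ∀ t, P (F' (Path.segment x' y' t)) := fun hP' => hP fun t => h t ▸ hP' t
    rw [segChar, segChar, dif_neg hP, dif_neg hP']

theorem segChar_eq_one {x y : E} (h : ∀ t, F (Path.segment x y t) = F x) :
    segChar χ F x y = 1 := by
  by_cases hP : P (F x)
  · rw [segChar, dif_pos fun t => (h t).symm ▸ hP]
    refine (pathChar_congr χ (γ' := Path.refl ⟨F x, hP⟩) fun t => Subtype.ext (h t)).trans
      (pathChar_refl χ _)
  · rw [segChar, dif_neg]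
    exact fun h' => hP (h 0 ▸ h' 0)

theorem segChar_self (x : E) : segChar χ F x x = 1 :=
  segChar_eq_one χ F fun t => by simp

theorem segChar_comp {C : Set E} (hC : Convex ℝ C) (hP : ∀ z ∈ C, P (F z)) {E' : Type*}
    [AddCommGroup E'] [Module ℝ E'] [TopologicalSpace E'] [IsTopologicalAddGroup E']
    [ContinuousSMul ℝ E'] (m : C(E', E)) {s t : E'} (h : ∀ r ∈ segment ℝ s t, m r ∈ C) :
    segChar χ (F.comp m) s t = segChar χ F (m s) (m t) := by
  have hmem (r) : m (Path.segment s t r) ∈ C := h _ (by rw [← Path.range_segment]; exact ⟨r, rfl⟩)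
  have hP' : ∀ r, P ((F.comp m) (Path.segment s t r)) := fun r => hP _ (hmem r)
  rw [segChar, dif_pos hP']
  exact pathChar_eq_segChar χ F hC hP ((Path.segment s t).map m.continuous) hmem _ fun r => rfl

end SegChar

/-! ### Periods of the character under translations that preserve the map -/

section Period

variable {Y : Type*} [TopologicalSpace Y] {P : Y → Prop} {x₀ : {y // P y}} {A : Type*} [CommGroup A]
  {E : Type*} [AddCommGroup E] [Module ℝ E] [TopologicalSpace E] [IsTopologicalAddGroup E]
  [ContinuousSMul ℝ E] (χ : FundamentalGroup {y // P y} x₀ →* A) (F : C(E, Y))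

theorem segChar_symm {C : Set E} (hC : Convex ℝ C) (hP : ∀ z ∈ C, P (F z)) {x y : E}
    (hx : x ∈ C) (hy : y ∈ C) : segChar χ F y x = (segChar χ F x y)⁻¹ := by
  rw [eq_inv_iff_mul_eq_one, segChar_trans χ F hC hP hy hx hy, segChar_self]

theorem segChar_add_right {l : E} (hl : ∀ z, F (z + l) = F z) (x y : E) :
    segChar χ F (x + l) (y + l) = segChar χ F x y := by
  refine segChar_congr χ F fun t => ?_
  rw [← hl (Path.segment x y t)]
  congr 1
  simp only [Path.segment_apply, AffineMap.lineMap_apply_module]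
  module

/-- In the parallelogram x, y, y + l, x + l the sides from x to y and from x + l to y + l have equal
values and cancel, because `A` is commutative. -/
theorem segChar_period {C : Set E} (hC : Convex ℝ C) (hP : ∀ z ∈ C, P (F z)) {l : E}
    (hl : ∀ z, F (z + l) = F z) {x y : E} (hx : x ∈ C) (hy : y ∈ C) (hxl : x + l ∈ C)
    (hyl : y + l ∈ C) : segChar χ F x (x + l) = segChar χ F y (y + l) := by
  rw [← segChar_trans χ F hC hP hx hy hxl, ← segChar_trans χ F hC hP hy hyl hxl,
    segChar_add_right χ F hl, mul_comm, mul_assoc, segChar_trans χ F hC hP hy hx hy, segChar_self,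
    mul_one]

theorem segChar_zsmul {C : Set E} (hC : Convex ℝ C) (hP : ∀ z ∈ C, P (F z)) {l : E}
    (hl : ∀ z, F (z + l) = F z) {x : E} (hx : ∀ k : ℤ, x + k • l ∈ C) (k : ℤ) :
    segChar χ F x (x + k • l) = segChar χ F x (x + l) ^ k := by
  have h0 : x ∈ C := by simpa using hx 0
  have h1 : x + l ∈ C := by simpa using hx 1
  have hstep (k : ℤ) : segChar χ F x (x + (k + 1) • l) =
      segChar χ F x (x + k • l) * segChar χ F x (x + l) := by
    have h2 : x + (k + 1) • l = x + k • l + l := by rw [add_smul, one_smul, add_assoc]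
    rw [← segChar_trans χ F hC hP h0 (hx k) (hx (k + 1)), h2,
      segChar_period χ F hC hP hl (hx k) h0 (h2 ▸ hx (k + 1)) h1]
  induction k using Int.induction_on with
  | zero => simp [segChar_self]
  | succ k ih => rw [hstep, ih, zpow_add_one]
  | pred k ih =>
    have h := hstep (-k - 1)
    rw [sub_add_cancel, ih] at h
    rw [zpow_sub_one, h, mul_inv_cancel_right]

end Period

/-! ### Angular coordinates on the complement of a torus knot -/

/-- The angular parametrization of the sphere. -/
noncomputable def angularS3 (a b : ℕ) : C(ℝ × ℂ, S3) where
  toFun x := ⟨angularNhd a b x, sqNorm_angularNhd a b x⟩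
  continuous_toFun := Continuous.subtype_mk (contDiff_angularNhd a b).continuous _

theorem knotPoly_angularNhd {a b : ℕ} (ha : a ≠ 0) (hb : b ≠ 0) (x : ℝ × ℂ) :
    knotPoly a b (angularNhd a b x) = Complex.exp ((a * b * x.1 - x.2.im : ℝ) * Complex.I) *
      (((√2 * Real.cos x.2.re) ^ b : ℝ) * Complex.exp ((2 * x.2.im : ℝ) * Complex.I) -
        ((√2 * Real.sin x.2.re) ^ a : ℝ)) := by
  have ha' : (a : ℝ) ≠ 0 := Nat.cast_ne_zero.mpr ha
  have hb' : (b : ℝ) ≠ 0 := Nat.cast_ne_zero.mpr hb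
  have h1 : Complex.exp ((a * x.1 + x.2.im / b : ℝ) * Complex.I) ^ b =
      Complex.exp ((a * b * x.1 - x.2.im : ℝ) * Complex.I) *
        Complex.exp ((2 * x.2.im : ℝ) * Complex.I) := by
    rw [← Complex.exp_nat_mul, ← Complex.exp_add]
    congr 1
    have : b * (a * x.1 + x.2.im / b) = (a * b * x.1 - x.2.im) + 2 * x.2.im := by field_simp; ring
    rw [← mul_assoc, ← add_mul]
    exact_mod_cast congrArg (fun r : ℝ => (r : ℂ) * Complex.I) this
  have h2 : Complex.exp ((b * x.1 - x.2.im / a : ℝ) * Complex.I) ^ a =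
      Complex.exp ((a * b * x.1 - x.2.im : ℝ) * Complex.I) := by
    rw [← Complex.exp_nat_mul]
    congr 1
    have : a * (b * x.1 - x.2.im / a) = (a * b * x.1 - x.2.im) := by field_simp
    rw [← mul_assoc]
    exact_mod_cast congrArg (fun r : ℝ => (r : ℂ) * Complex.I) this
  simp only [knotPoly, angularNhd, mul_pow, h1, h2, Complex.ofReal_pow, Complex.ofReal_mul]
  ring

theorem pow_lt_pow_of_lt_pi_div_four {a b : ℕ} (ha : a ≠ 0) (hb : b ≠ 0) {ψ : ℝ} (h0 : 0 ≤ ψ)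
    (h : ψ < Real.pi / 4) : (√2 * Real.sin ψ) ^ a < (√2 * Real.cos ψ) ^ b := by
  have hpi := Real.pi_pos
  have h2 : √2 * (√2 / 2) = 1 := by
    rw [mul_div_assoc', Real.mul_self_sqrt (by norm_num)]; norm_num
  have hs : √2 * Real.sin ψ < 1 := by
    rw [← h2, ← Real.sin_pi_div_four]
    exact mul_lt_mul_of_pos_left (Real.sin_lt_sin_of_lt_of_le_pi_div_two (by linarith)
      (by linarith) h) (by positivity)
  have hc : 1 < √2 * Real.cos ψ := by
    rw [← h2, ← Real.cos_pi_div_four]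
    exact mul_lt_mul_of_pos_left (Real.cos_lt_cos_of_nonneg_of_le_pi_div_two h0
      (by linarith) h) (by positivity)
  have hs0 : 0 ≤ √2 * Real.sin ψ :=
    mul_nonneg (by positivity) (Real.sin_nonneg_of_nonneg_of_le_pi h0 (by linarith))
  exact (pow_lt_one₀ hs0 hs ha).trans (one_lt_pow₀ hc hb)

/-- Equality of the moduli of the two terms forces the angle π/4, and equality of their phases
forces exp(2iy) = 1. -/
theorem angularNhd_eq_zero {a b : ℕ} (ha : a ≠ 0) (hb : b ≠ 0) {x : ℝ × ℂ} (h0 : 0 ≤ x.2.re)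
    (h1 : x.2.re ≤ Real.pi / 2) (h : knotPoly a b (angularNhd a b x) = 0) :
    x.2.re = Real.pi / 4 ∧ Real.sin x.2.im = 0 := by
  have hpi := Real.pi_pos
  rw [knotPoly_angularNhd ha hb, mul_eq_zero, or_iff_right (Complex.exp_ne_zero _), sub_eq_zero] at h
  have hc : 0 ≤ Real.cos x.2.re := Real.cos_nonneg_of_neg_pi_div_two_le_of_le (by linarith) h1
  have hs : 0 ≤ Real.sin x.2.re := Real.sin_nonneg_of_nonneg_of_le_pi h0 (by linarith)
  have hn := congrArg norm h
  rw [norm_mul, Complex.norm_exp_ofReal_mul_I, mul_one, Complex.norm_real, Complex.norm_real,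
    Real.norm_of_nonneg (by positivity), Real.norm_of_nonneg (by positivity)] at hn
  have h4 : x.2.re = Real.pi / 4 := by
    rcases lt_trichotomy x.2.re (Real.pi / 4) with h' | h' | h'
    · exact absurd hn (pow_lt_pow_of_lt_pi_div_four ha hb h0 h').ne'
    · exact h'
    · have h5 := pow_lt_pow_of_lt_pi_div_four hb ha (ψ := Real.pi / 2 - x.2.re) (by linarith)
        (by linarith)
      rw [Real.sin_pi_div_two_sub, Real.cos_pi_div_two_sub] at h5
      exact absurd hn h5.ne
  refine ⟨h4, ?_⟩
  have hcpos : 0 < Real.cos x.2.re := by rw [h4, Real.cos_pi_div_four]; positivity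
  rw [← hn] at h
  have h6 : Complex.exp ((2 * x.2.im : ℝ) * Complex.I) = 1 := by
    refine mul_left_cancel₀ (a := (((√2 * Real.cos x.2.re) ^ b : ℝ) : ℂ)) ?_ (by rw [h, mul_one])
    exact Complex.ofReal_ne_zero.mpr (by positivity)
  have h7 := congrArg Complex.re h6
  rw [Complex.exp_ofReal_mul_I_re, Complex.one_re, Real.cos_two_mul] at h7
  nlinarith [Real.sin_sq_add_cos_sq x.2.im]

/-- The points with given ranges of the two transverse angular coordinates. -/
def angularBox (I J : Set ℝ) : Set (ℝ × ℂ) := {x | x.2.re ∈ I ∧ x.2.im ∈ J}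

theorem convex_angularBox {I J : Set ℝ} (hI : Convex ℝ I) (hJ : Convex ℝ J) :
    Convex ℝ (angularBox I J) :=
  (hI.linear_preimage (Complex.reLm ∘ₗ LinearMap.snd ℝ ℝ ℂ)).inter
    (hJ.linear_preimage (Complex.imLm ∘ₗ LinearMap.snd ℝ ℝ ℂ))

/-- A box in the angular coordinates that avoids the knot. -/
structure IsGoodBox (I J : Set ℝ) : Prop where
  left_convex : Convex ℝ I
  right_convex : Convex ℝ J
  nonneg : ∀ ψ ∈ I, 0 ≤ ψ
  le : ∀ ψ ∈ I, ψ ≤ Real.pi / 2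
  avoid : (∀ ψ ∈ I, ψ ≠ Real.pi / 4) ∨ ∀ y ∈ J, Real.sin y ≠ 0

theorem IsGoodBox.notMem {I J : Set ℝ} (h : IsGoodBox I J) {a b : ℕ} (ha : a ≠ 0) (hb : b ≠ 0)
    (hab : Nat.Coprime a b) : ∀ x ∈ angularBox I J, angularS3 a b x ∉ torusKnot a b := by
  intro x hx hmem
  rw [← knotPoly_eq_zero_iff ha hb hab] at hmem
  obtain ⟨h1, h2⟩ := angularNhd_eq_zero ha hb (h.nonneg _ hx.1) (h.le _ hx.1) hmem
  rcases h.avoid with h3 | h3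
  exacts [h3 _ hx.1 h1, h3 _ hx.2 h2]

theorem isGoodBox_lower : IsGoodBox (Set.Ico 0 (Real.pi / 4)) Set.univ :=
  ⟨convex_Ico _ _, convex_univ, fun _ h => h.1, fun _ h => by linarith [h.2, Real.pi_pos],
    Or.inl fun _ h => h.2.ne⟩

theorem isGoodBox_upper : IsGoodBox (Set.Ioc (Real.pi / 4) (Real.pi / 2)) Set.univ :=
  ⟨convex_Ioc _ _, convex_univ, fun _ h => by linarith [h.1, Real.pi_pos], fun _ h => h.2,
    Or.inl fun _ h => h.1.ne'⟩

theorem isGoodBox_pos : IsGoodBox (Set.Icc 0 (Real.pi / 2)) (Set.Ioo 0 Real.pi) :=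
  ⟨convex_Icc _ _, convex_Ioo _ _, fun _ h => h.1, fun _ h => h.2,
    Or.inr fun _ h => (Real.sin_pos_of_mem_Ioo h).ne'⟩

theorem isGoodBox_neg : IsGoodBox (Set.Icc 0 (Real.pi / 2)) (Set.Ioo (-Real.pi) 0) :=
  ⟨convex_Icc _ _, convex_Ioo _ _, fun _ h => h.1, fun _ h => h.2,
    Or.inr fun _ h => (Real.sin_neg_of_neg_of_neg_pi_lt h.2 h.1).ne⟩

/-- The phase of a coordinate matters modulo 2π, and not at all where that coordinate vanishes. -/
theorem angularS3_eq {a b : ℕ} {x x' : ℝ × ℂ} (h0 : x.2.re = x'.2.re)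
    (h1 : Real.cos x.2.re = 0 ∨ ∃ m : ℤ,
      a * x'.1 + x'.2.im / b = a * x.1 + x.2.im / b + m * (2 * Real.pi))
    (h2 : Real.sin x.2.re = 0 ∨ ∃ n : ℤ,
      b * x'.1 - x'.2.im / a = b * x.1 - x.2.im / a + n * (2 * Real.pi)) :
    angularS3 a b x = angularS3 a b x' := by
  have hexp (r s : ℝ) (m : ℤ) (h : s = r + m * (2 * Real.pi)) :
      Complex.exp (r * Complex.I) = Complex.exp (s * Complex.I) := by
    rw [Complex.exp_eq_exp_iff_exists_int]
    exact ⟨-m, by rw [h]; push_cast; ring⟩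
  apply Subtype.ext
  simp only [angularS3, ContinuousMap.coe_mk, angularNhd, ← h0]
  ext1
  · rcases h1 with h1 | ⟨m, h1⟩
    · simp [h1]
    · simp only [hexp _ _ m h1]
  · rcases h2 with h2 | ⟨m, h2⟩
    · simp [h2]
    · simp only [hexp _ _ m h2]

theorem knotNhd_notMem {a b : ℕ} (ha : a ≠ 0) (hb : b ≠ 0) (hab : Nat.Coprime a b) (t : Circle)
    {v : ℂ} (hv : v ≠ 0) : knotNhd a b (t, v) ∉ torusKnot a b := by
  rw [← knotPoly_eq_zero_iff ha hb hab, knotNhd, knotPoly_rotS3]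
  obtain ⟨c, hc, h⟩ := exists_knotPoly_knotSlice ha hb v
  rw [h]
  exact mul_ne_zero (Circle.coe_ne_zero _) (mul_ne_zero (Complex.ofReal_ne_zero.mpr hc.ne') hv)

theorem angularS3_toAngular (a b : ℕ) (θ : ℝ) (v : ℂ) :
    angularS3 a b (toAngular a b (θ, v)) = knotNhd a b (Circle.exp θ, v) :=
  Subtype.ext (knotNhd_exp a b θ v).symm

/-- The boundary of the neighbourhood of radius one, in angular coordinates. -/
noncomputable def boundaryTorus (a b : ℕ) : C(ℝ × ℝ, ℝ × ℂ) where
  toFun x := toAngular a b (x.1, (Circle.exp x.2 : ℂ))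
  continuous_toFun := (contDiff_toAngular a b).continuous.comp
    (continuous_fst.prodMk (by fun_prop))

theorem angularS3_boundaryTorus (a b : ℕ) (x : ℝ × ℝ) :
    (angularS3 a b).comp (boundaryTorus a b) x =
      knotNhd a b (Circle.exp x.1, (Circle.exp x.2 : ℂ)) := angularS3_toAngular a b _ _

/-! ### Meridian and longitude in the homology of the knot complement -/

section

variable {a b : ℕ}
  {x₀ : {x : S3 // x ∉ torusKnot a b}} {A : Type*} [CommGroup A]
  (χ : FundamentalGroup {x : S3 // x ∉ torusKnot a b} x₀ →* A)

theorem boundaryTorus_re (x : ℝ × ℝ) :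
    (boundaryTorus a b x).2.re = knotAngle (Real.cos x.2) := by
  simp [boundaryTorus, toAngular, Circle.coe_exp, Complex.exp_ofReal_mul_I_re]

theorem boundaryTorus_im (x : ℝ × ℝ) : (boundaryTorus a b x).2.im =
    Real.arctan (knotScale a b (Real.cos x.2) * Real.sin x.2) := by
  simp [boundaryTorus, toAngular, knotTilt, Circle.coe_exp, Complex.exp_ofReal_mul_I_re,
    Complex.exp_ofReal_mul_I_im]

theorem boundaryTorus_lower {x : ℝ × ℝ} (h : 0 < Real.cos x.2) :
    boundaryTorus a b x ∈ angularBox (Set.Ico 0 (Real.pi / 4)) Set.univ := by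
  refine ⟨?_, trivial⟩
  rw [boundaryTorus_re]
  refine ⟨(knotAngle_pos _).le, ?_⟩
  have := Real.arctan_pos.mpr h
  unfold knotAngle; linarith

theorem boundaryTorus_upper {x : ℝ × ℝ} (h : Real.cos x.2 < 0) :
    boundaryTorus a b x ∈ angularBox (Set.Ioc (Real.pi / 4) (Real.pi / 2)) Set.univ := by
  refine ⟨?_, trivial⟩
  rw [boundaryTorus_re]
  refine ⟨?_, (knotAngle_lt _).le⟩
  have := Real.arctan_lt_zero.mpr h
  unfold knotAngle; linarith

theorem boundaryTorus_pos (hb : b ≠ 0) {x : ℝ × ℝ} (h : 0 < Real.sin x.2) :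
    boundaryTorus a b x ∈ angularBox (Set.Icc 0 (Real.pi / 2)) (Set.Ioo 0 Real.pi) := by
  refine ⟨?_, ?_⟩
  · rw [boundaryTorus_re]
    exact ⟨(knotAngle_pos _).le, (knotAngle_lt _).le⟩
  · rw [boundaryTorus_im]
    exact ⟨Real.arctan_pos.mpr (mul_pos (knotScale_pos hb _) h),
      (Real.arctan_lt_pi_div_two _).trans (by linarith [Real.pi_pos])⟩

theorem boundaryTorus_neg (hb : b ≠ 0) {x : ℝ × ℝ} (h : Real.sin x.2 < 0) :
    boundaryTorus a b x ∈ angularBox (Set.Icc 0 (Real.pi / 2)) (Set.Ioo (-Real.pi) 0) := by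
  refine ⟨?_, ?_⟩
  · rw [boundaryTorus_re]
    exact ⟨(knotAngle_pos _).le, (knotAngle_lt _).le⟩
  · rw [boundaryTorus_im]
    exact ⟨(by linarith [Real.pi_pos] : -Real.pi < -(Real.pi / 2)).trans
      (Real.neg_pi_div_two_lt_arctan _),
      Real.arctan_lt_zero.mpr (mul_neg_of_pos_of_neg (knotScale_pos hb _) h)⟩

theorem boundaryTorus_period (x : ℝ × ℝ) :
    boundaryTorus a b (x + (0, 2 * Real.pi)) = boundaryTorus a b x := by
  simp only [boundaryTorus, ContinuousMap.coe_mk, Prod.fst_add, Prod.snd_add, Circle.exp_add,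
    Circle.exp_two_pi, mul_one, add_zero]

theorem boundaryTorus_comp_period₁ (x : ℝ × ℝ) :
    (angularS3 a b).comp (boundaryTorus a b) (x + (2 * Real.pi, 0)) =
      (angularS3 a b).comp (boundaryTorus a b) x := by
  simp only [angularS3_boundaryTorus]
  simp [Circle.exp_add]

theorem boundaryTorus_notMem (ha : a ≠ 0) (hb : b ≠ 0) (hab : Nat.Coprime a b) (x : ℝ × ℝ) :
    (angularS3 a b).comp (boundaryTorus a b) x ∉ torusKnot a b := by
  rw [angularS3_boundaryTorus]
  exact knotNhd_notMem ha hb hab _ (Circle.coe_ne_zero _)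

/-- The ends of an arc of the boundary torus, joined within a box. -/
theorem segChar_boundaryTorus (ha : a ≠ 0) (hb : b ≠ 0) (hab : Nat.Coprime a b) {I J : Set ℝ}
    (h : IsGoodBox I J) {x y : ℝ × ℝ}
    (hxy : ∀ r ∈ segment ℝ x y, boundaryTorus a b r ∈ angularBox I J) :
    segChar χ ((angularS3 a b).comp (boundaryTorus a b)) x y =
      segChar χ (angularS3 a b) (boundaryTorus a b x) (boundaryTorus a b y) :=
  segChar_comp χ _ (convex_angularBox h.left_convex h.right_convex) (h.notMem ha hb hab) _ hxy

theorem mem_segment_snd {s t : ℝ} (hst : s ≤ t) {r : ℝ × ℝ}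
    (hr : r ∈ segment ℝ ((0 : ℝ), s) ((0 : ℝ), t)) : s ≤ r.2 ∧ r.2 ≤ t := by
  rw [← Prod.image_mk_segment_right, segment_eq_Icc hst] at hr
  obtain ⟨u, hu, rfl⟩ := hr
  exact hu

/-- On this core circle only the first phase is visible, and it is constant along the segment. -/
theorem segChar_angularS3_eq_one_of_zero {x y : ℝ × ℂ} (hx : x.2.re = 0) (hy : y.2.re = 0)
    (h : a * x.1 + x.2.im / b = a * y.1 + y.2.im / b) : segChar χ (angularS3 a b) x y = 1 := by
  refine segChar_eq_one χ _ fun t => ?_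
  rw [Path.segment_apply, AffineMap.lineMap_apply_module]
  refine (angularS3_eq (by simp [hx, hy]) (Or.inr ⟨0, ?_⟩) (Or.inl (by simp [hx]))).symm
  simp
  linear_combination -(t : ℝ) * h

theorem segChar_angularS3_eq_one_of_pi_div_two {x y : ℝ × ℂ} (hx : x.2.re = Real.pi / 2)
    (hy : y.2.re = Real.pi / 2) (h : b * x.1 - x.2.im / a = b * y.1 - y.2.im / a) :
    segChar χ (angularS3 a b) x y = 1 := by
  refine segChar_eq_one χ _ fun t => ?_
  rw [Path.segment_apply, AffineMap.lineMap_apply_module]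
  refine (angularS3_eq ?_ (Or.inl (by simp [hx])) (Or.inr ⟨0, ?_⟩)).symm
  · simp [hx, hy]; ring
  simp
  linear_combination -(t : ℝ) * h

theorem mul_telescope {A : Type*} [CommGroup A] (p₁ p₂ p₃ p₄ q₁ q₂ q₃ q₄ : A) :
    (q₄⁻¹ * (p₁ * q₁)) * ((q₁⁻¹ * (p₂ * q₂)) * ((q₂⁻¹ * (p₃ * q₃)) * (q₃⁻¹ * (p₄ * q₄)))) =
      p₁ * p₂ * (p₃ * p₄) := by
  have h (B : Type _) [AddCommGroup B] (p₁ p₂ p₃ p₄ q₁ q₂ q₃ q₄ : B) :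
      (-q₄ + (p₁ + q₁)) + ((-q₁ + (p₂ + q₂)) + ((-q₂ + (p₃ + q₃)) + (-q₃ + (p₄ + q₄)))) =
        p₁ + p₂ + (p₃ + p₄) := by abel
  exact h (Additive A) p₁ p₂ p₃ p₄ q₁ q₂ q₃ q₄

/-- The class of the meridian as a product over four corners in the four boxes. -/
theorem segChar_meridian (ha : a ≠ 0) (hb : b ≠ 0) (hab : Nat.Coprime a b) {c₁ c₂ c₃ c₄ : ℝ × ℂ}
    (h₁ : c₁.2.re = 0 ∧ c₁.2.im ∈ Set.Ioo 0 Real.pi)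
    (h₂ : c₂.2.re = Real.pi / 2 ∧ c₂.2.im ∈ Set.Ioo 0 Real.pi)
    (h₃ : c₃.2.re = Real.pi / 2 ∧ c₃.2.im ∈ Set.Ioo (-Real.pi) 0)
    (h₄ : c₄.2.re = 0 ∧ c₄.2.im ∈ Set.Ioo (-Real.pi) 0) :
    segChar χ ((angularS3 a b).comp (boundaryTorus a b)) (0, 0) (0, 2 * Real.pi) =
      segChar χ (angularS3 a b) c₄ c₁ * segChar χ (angularS3 a b) c₁ c₂ *
        (segChar χ (angularS3 a b) c₂ c₃ * segChar χ (angularS3 a b) c₃ c₄) := by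
  have hpi := Real.pi_pos
  set F := angularS3 a b
  set T := boundaryTorus a b
  have cS := convex_angularBox isGoodBox_lower.left_convex isGoodBox_lower.right_convex
  have cL := convex_angularBox isGoodBox_upper.left_convex isGoodBox_upper.right_convex
  have cP := convex_angularBox isGoodBox_pos.left_convex isGoodBox_pos.right_convex
  have cN := convex_angularBox isGoodBox_neg.left_convex isGoodBox_neg.right_convex
  have pS := isGoodBox_lower.notMem ha hb hab
  have pL := isGoodBox_upper.notMem ha hb hab
  have pP := isGoodBox_pos.notMem ha hb hab
  have pN := isGoodBox_neg.notMem ha hb hab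
  have hT := fun x (_ : x ∈ (Set.univ : Set (ℝ × ℝ))) => boundaryTorus_notMem ha hb hab x
  have hper : ∀ x : ℝ × ℝ, F.comp T (x + (0, 2 * Real.pi)) = F.comp T x := fun x => by
    simp only [ContinuousMap.comp_apply, T, boundaryTorus_period]
  have hcos₁ {r : ℝ × ℝ} (hr : r ∈ segment ℝ ((0 : ℝ), -(Real.pi / 4)) ((0 : ℝ), Real.pi / 4)) :
      0 < Real.cos r.2 := by
    obtain ⟨h1, h2⟩ := mem_segment_snd (by linarith) hr
    exact Real.cos_pos_of_mem_Ioo ⟨by linarith, by linarith⟩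
  have hsin₁ {r : ℝ × ℝ} (hr : r ∈ segment ℝ ((0 : ℝ), Real.pi / 4) ((0 : ℝ), 3 * Real.pi / 4)) :
      0 < Real.sin r.2 := by
    obtain ⟨h1, h2⟩ := mem_segment_snd (by linarith) hr
    exact Real.sin_pos_of_mem_Ioo ⟨by linarith, by linarith⟩
  have hcos₂ {r : ℝ × ℝ}
      (hr : r ∈ segment ℝ ((0 : ℝ), 3 * Real.pi / 4) ((0 : ℝ), 5 * Real.pi / 4)) :
      Real.cos r.2 < 0 := by
    obtain ⟨h1, h2⟩ := mem_segment_snd (by linarith) hr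
    exact Real.cos_neg_of_pi_div_two_lt_of_lt (by linarith) (by linarith)
  have hsin₂ {r : ℝ × ℝ}
      (hr : r ∈ segment ℝ ((0 : ℝ), 5 * Real.pi / 4) ((0 : ℝ), 7 * Real.pi / 4)) :
      Real.sin r.2 < 0 := by
    obtain ⟨h1, h2⟩ := mem_segment_snd (by linarith) hr
    rw [← Real.sin_sub_two_pi]
    exact Real.sin_neg_of_neg_of_neg_pi_lt (by linarith) (by linarith)
  have e₁ := segChar_boundaryTorus χ ha hb hab isGoodBox_lower
    (fun r hr => boundaryTorus_lower (hcos₁ hr))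
  have e₂ := segChar_boundaryTorus χ ha hb hab isGoodBox_pos
    (fun r hr => boundaryTorus_pos hb (hsin₁ hr))
  have e₃ := segChar_boundaryTorus χ ha hb hab isGoodBox_upper
    (fun r hr => boundaryTorus_upper (hcos₂ hr))
  have e₄ := segChar_boundaryTorus χ ha hb hab isGoodBox_neg
    (fun r hr => boundaryTorus_neg hb (hsin₂ hr))
  have hend : T (0, 7 * Real.pi / 4) = T (0, -(Real.pi / 4)) := by
    rw [← boundaryTorus_period (0, -(Real.pi / 4))]
    congr 1
    ext1
    · simp
    · simp; ring
  -- Starting at -π/4 makes each quarter arc of the meridian lie in a single box.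
  have hshift : segChar χ (F.comp T) (0, 0) (0, 2 * Real.pi) =
      segChar χ (F.comp T) (0, -(Real.pi / 4)) (0, 7 * Real.pi / 4) := by
    have h := segChar_period χ (F.comp T) convex_univ hT hper (x := (0, 0))
      (y := (0, -(Real.pi / 4))) trivial trivial trivial trivial
    rw [Prod.mk_add_mk, Prod.mk_add_mk, zero_add, zero_add] at h
    rw [h]
    congr 2
    ring
  rw [hend] at e₄
  rw [hshift, ← segChar_trans χ (F.comp T) convex_univ hT (y := (0, Real.pi / 4)) trivial trivial
    trivial, ← segChar_trans χ (F.comp T) convex_univ hT (x := (0, Real.pi / 4))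
    (y := (0, 3 * Real.pi / 4)) trivial trivial trivial,
    ← segChar_trans χ (F.comp T) convex_univ hT (x := (0, 3 * Real.pi / 4))
    (y := (0, 5 * Real.pi / 4)) trivial trivial trivial, e₁, e₂, e₃, e₄]
  have q₁S := boundaryTorus_lower (a := a) (b := b) (hcos₁ (right_mem_segment ℝ _ _))
  have q₁P := boundaryTorus_pos (a := a) hb (hsin₁ (left_mem_segment ℝ _ _))
  have q₂P := boundaryTorus_pos (a := a) hb (hsin₁ (right_mem_segment ℝ _ _))
  have q₂L := boundaryTorus_upper (a := a) (b := b) (hcos₂ (left_mem_segment ℝ _ _))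
  have q₃L := boundaryTorus_upper (a := a) (b := b) (hcos₂ (right_mem_segment ℝ _ _))
  have q₃N := boundaryTorus_neg (a := a) hb (hsin₂ (left_mem_segment ℝ _ _))
  have q₄N := boundaryTorus_neg (a := a) hb (hsin₂ (right_mem_segment ℝ _ _))
  have q₄S := boundaryTorus_lower (a := a) (b := b) (hcos₁ (left_mem_segment ℝ _ _))
  rw [hend] at q₄N
  generalize T (0, Real.pi / 4) = t₁ at *
  generalize T (0, 3 * Real.pi / 4) = t₂ at *
  generalize T (0, 5 * Real.pi / 4) = t₃ at *
  generalize T (0, -(Real.pi / 4)) = t₄ at *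
  have zI : (0 : ℝ) ∈ Set.Icc 0 (Real.pi / 2) := ⟨le_rfl, by positivity⟩
  have wI : Real.pi / 2 ∈ Set.Icc 0 (Real.pi / 2) := ⟨by positivity, le_rfl⟩
  have zS : (0 : ℝ) ∈ Set.Ico 0 (Real.pi / 4) := ⟨le_rfl, by positivity⟩
  have wL : Real.pi / 2 ∈ Set.Ioc (Real.pi / 4) (Real.pi / 2) := ⟨by linarith, le_rfl⟩
  have c₁S : c₁ ∈ angularBox (Set.Ico 0 (Real.pi / 4)) Set.univ := ⟨h₁.1.symm ▸ zS, trivial⟩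
  have c₄S : c₄ ∈ angularBox (Set.Ico 0 (Real.pi / 4)) Set.univ := ⟨h₄.1.symm ▸ zS, trivial⟩
  have c₂L : c₂ ∈ angularBox (Set.Ioc (Real.pi / 4) (Real.pi / 2)) Set.univ :=
    ⟨h₂.1.symm ▸ wL, trivial⟩
  have c₃L : c₃ ∈ angularBox (Set.Ioc (Real.pi / 4) (Real.pi / 2)) Set.univ :=
    ⟨h₃.1.symm ▸ wL, trivial⟩
  have c₁P : c₁ ∈ angularBox (Set.Icc 0 (Real.pi / 2)) (Set.Ioo 0 Real.pi) :=
    ⟨h₁.1.symm ▸ zI, h₁.2⟩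
  have c₂P : c₂ ∈ angularBox (Set.Icc 0 (Real.pi / 2)) (Set.Ioo 0 Real.pi) :=
    ⟨h₂.1.symm ▸ wI, h₂.2⟩
  have c₃N : c₃ ∈ angularBox (Set.Icc 0 (Real.pi / 2)) (Set.Ioo (-Real.pi) 0) :=
    ⟨h₃.1.symm ▸ wI, h₃.2⟩
  have c₄N : c₄ ∈ angularBox (Set.Icc 0 (Real.pi / 2)) (Set.Ioo (-Real.pi) 0) :=
    ⟨h₄.1.symm ▸ zI, h₄.2⟩
  -- Each quarter is rerouted through two corners; the detours between arc ends and corners cancel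
  -- around the loop.
  rw [← segChar_trans χ F cS pS q₄S c₄S q₁S, ← segChar_trans χ F cS pS c₄S c₁S q₁S,
    ← segChar_trans χ F cP pP q₁P c₁P q₂P, ← segChar_trans χ F cP pP c₁P c₂P q₂P,
    ← segChar_trans χ F cL pL q₂L c₂L q₃L, ← segChar_trans χ F cL pL c₂L c₃L q₃L,
    ← segChar_trans χ F cN pN q₃N c₃N q₄N, ← segChar_trans χ F cN pN c₃N c₄N q₄N,
    segChar_symm χ F cS pS c₁S q₁S, segChar_symm χ F cP pP c₂P q₂P,
    segChar_symm χ F cL pL c₃L q₃L, segChar_symm χ F cN pN c₄N q₄N]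
  simp only [mul_assoc]
  have h := mul_telescope (segChar χ F c₄ c₁) (segChar χ F c₁ c₂) (segChar χ F c₂ c₃)
    (segChar χ F c₃ c₄) (segChar χ F c₁ t₁) (segChar χ F c₂ t₂) (segChar χ F c₃ t₃)
    (segChar χ F c₄ t₄)
  simpa only [mul_assoc] using h

/-- Let o be the class of a circle orbit, and x, y those of the two core circles in the
complementary solid tori, each up to orientation. Then x^a = o^m and y^b = o^n with bm - an = 1,
while the meridian is x y⁻¹. Hence its ab-th power is o^{bm-an} = o. -/
theorem segChar_longitude (ha : a ≠ 0) (hb : b ≠ 0) (hab : Nat.Coprime a b) :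
    segChar χ ((angularS3 a b).comp (boundaryTorus a b)) (0, 0) (2 * Real.pi, 0) =
      segChar χ ((angularS3 a b).comp (boundaryTorus a b)) (0, 0) (0, 2 * Real.pi) ^ (a * b) := by
  have hpi := Real.pi_pos
  have ha' : (a : ℝ) ≠ 0 := Nat.cast_ne_zero.mpr ha
  have hb' : (b : ℝ) ≠ 0 := Nat.cast_ne_zero.mpr hb
  set F := angularS3 a b with hF
  set T := boundaryTorus a b
  have cS := convex_angularBox isGoodBox_lower.left_convex isGoodBox_lower.right_convex
  have cL := convex_angularBox isGoodBox_upper.left_convex isGoodBox_upper.right_convex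
  have cN := convex_angularBox isGoodBox_neg.left_convex isGoodBox_neg.right_convex
  have pS := isGoodBox_lower.notMem ha hb hab
  have pL := isGoodBox_upper.notMem ha hb hab
  have pN := isGoodBox_neg.notMem ha hb hab
  obtain ⟨m, n, hmn⟩ : ∃ m n : ℤ, b * m - a * n = 1 := by
    obtain ⟨u, v, h⟩ := Nat.isCoprime_iff_coprime.mpr hab
    exact ⟨v, -u, by linarith⟩
  have hmn' : (b * m - a * n : ℝ) = 1 := by exact_mod_cast hmn
  -- The translation that changes the two phases by 2πm and 2πn and raises y by π, from the negative
  -- box to the positive one.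
  set l : ℝ × ℂ := ((b * m + a * n) * Real.pi / (a * b), ⟨0, Real.pi⟩) with hl
  set w : ℝ × ℂ := (2 * Real.pi, 0) with hw
  have lper : ∀ z, F (z + l) = F z := fun z => by
    refine (angularS3_eq (by simp [hl]) (Or.inr ⟨m, ?_⟩) (Or.inr ⟨n, ?_⟩)).symm
    · simp only [hl, Prod.fst_add, Prod.snd_add, Complex.add_im]
      field_simp
      linear_combination -Real.pi * hmn'
    · simp only [hl, Prod.fst_add, Prod.snd_add, Complex.add_im]
      field_simp
      linear_combination Real.pi * hmn'
  have wper : ∀ z, F (z + w) = F z := fun z => by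
    refine (angularS3_eq (by simp [hw]) (Or.inr ⟨a, ?_⟩) (Or.inr ⟨b, ?_⟩)).symm
    · simp [hw]; ring
    · simp [hw]; ring
  set D := segChar χ F with hD
  set c : ℝ × ℂ := (0, ⟨0, -(Real.pi / 2)⟩) with hc
  set d : ℝ × ℂ := (0, ⟨Real.pi / 2, -(Real.pi / 2)⟩) with hd
  have cmem (z : ℝ × ℂ) (hz : z.2.re = 0) : z ∈ angularBox (Set.Ico 0 (Real.pi / 4)) Set.univ :=
    ⟨by rw [hz]; exact ⟨le_rfl, by positivity⟩, trivial⟩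
  have dmem (z : ℝ × ℂ) (hz : z.2.re = Real.pi / 2) :
      z ∈ angularBox (Set.Ioc (Real.pi / 4) (Real.pi / 2)) Set.univ :=
    ⟨by rw [hz]; exact ⟨by linarith, le_rfl⟩, trivial⟩
  have ckl (k : ℤ) : (c + k • l).2.re = 0 := by simp [hc, hl]
  have ckw (k : ℤ) : (c + k • w).2.re = 0 := by simp [hc, hw]
  have dkl (k : ℤ) : (d + k • l).2.re = Real.pi / 2 := by simp [hd, hl]
  have dkw (k : ℤ) : (d + k • w).2.re = Real.pi / 2 := by simp [hd, hw]
  -- At angle 0 the translations a·l and m·w both change the first phase by 2πam, so their ends have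
  -- the same image.
  have hca : D c (c + l) ^ (a : ℤ) = D c (c + w) ^ m := by
    rw [hD, ← segChar_zsmul χ F cS pS lper (fun k => cmem _ (ckl k)),
      ← segChar_zsmul χ F cS pS wper (fun k => cmem _ (ckw k)),
      ← segChar_trans χ F cS pS (cmem c rfl) (cmem _ (ckw m)) (cmem _ (ckl a)),
      segChar_angularS3_eq_one_of_zero χ (ckw m) (ckl a), mul_one]
    simp [hc, hl, hw]
    field_simp
    linear_combination 2 * a * hmn'
  have hdb : D d (d + l) ^ (b : ℤ) = D d (d + w) ^ n := by
    rw [hD, ← segChar_zsmul χ F cL pL lper (fun k => dmem _ (dkl k)),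
      ← segChar_zsmul χ F cL pL wper (fun k => dmem _ (dkw k)),
      ← segChar_trans χ F cL pL (dmem d rfl) (dmem _ (dkw n)) (dmem _ (dkl b)),
      segChar_angularS3_eq_one_of_pi_div_two χ (dkw n) (dkl b), mul_one]
    simp [hd, hl, hw]
    field_simp
    linear_combination -2 * b * hmn'
  have hzI : (0 : ℝ) ∈ Set.Icc 0 (Real.pi / 2) := ⟨le_rfl, by positivity⟩
  have hwI : Real.pi / 2 ∈ Set.Icc 0 (Real.pi / 2) := ⟨by positivity, le_rfl⟩
  have hyN : -(Real.pi / 2) ∈ Set.Ioo (-Real.pi) 0 := ⟨by linarith, by linarith⟩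
  have hcd : D c (c + w) = D d (d + w) :=
    segChar_period χ F cN pN wper (x := c) (y := d) ⟨hzI, hyN⟩ ⟨hwI, hyN⟩
      ⟨by simpa [hc, hw] using hzI, by simpa [hc, hw] using hyN⟩
      ⟨by simpa [hd, hw] using hwI, by simpa [hd, hw] using hyN⟩
  have hlong : segChar χ (F.comp T) (0, 0) (2 * Real.pi, 0) = D c (c + w) := by
    have h1 (r : ℝ × ℝ) (hr : r ∈ segment ℝ ((0 : ℝ), (0 : ℝ)) (2 * Real.pi, 0)) :
        T r ∈ angularBox (Set.Ico 0 (Real.pi / 4)) Set.univ := by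
      refine boundaryTorus_lower ?_
      rw [← Prod.image_mk_segment_left] at hr
      obtain ⟨u, -, rfl⟩ := hr
      simp
    have h2 : T (2 * Real.pi, 0) = T (0, 0) + w := by
      simp [T, boundaryTorus, toAngular, hw]
    have h3 := h1 _ (left_mem_segment ℝ _ _)
    have h4 := h1 _ (right_mem_segment ℝ _ _)
    rw [segChar_boundaryTorus χ ha hb hab isGoodBox_lower h1]
    rw [h2] at h4 ⊢
    exact segChar_period χ F cS pS wper h3 (cmem c rfl) h4 (by simpa using cmem _ (ckw 1))
  -- With these corners the two sides across the knot are translates of each other by l and cancel.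
  have hmer := segChar_meridian χ ha hb hab (c₁ := c + l) (c₂ := d + l) (c₃ := d) (c₄ := c)
    ⟨by simpa using ckl 1, by simp [hc, hl]; linarith, by simp [hc, hl]; linarith⟩
    ⟨by simpa using dkl 1, by simp [hd, hl]; linarith, by simp [hd, hl]; linarith⟩
    ⟨rfl, hyN⟩ ⟨rfl, hyN⟩
  rw [hlong, hmer]
  have h5 : segChar χ F (c + l) (d + l) = segChar χ F c d := segChar_add_right χ F lper c d
  have h6 : segChar χ F d c = (segChar χ F c d)⁻¹ :=
    segChar_symm χ F cN pN (x := c) (y := d) ⟨hzI, hyN⟩ ⟨hwI, hyN⟩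
  have h7 : segChar χ F (d + l) d = (segChar χ F d (d + l))⁻¹ :=
    segChar_symm χ F cL pL (dmem d rfl) (dmem _ (by simpa using dkl 1))
  rw [← hF, h5, h6, h7]
  rw [← hcd] at hdb
  change D c (c + w) = (D c (c + l) * D c d * ((D d (d + l))⁻¹ * (D c d)⁻¹)) ^ (a * b)
  generalize D c (c + w) = o at *
  generalize D c (c + l) = x at *
  generalize D d (d + l) = y at *
  have h8 : x * D c d * (y⁻¹ * (D c d)⁻¹) = x * y⁻¹ := by
    rw [mul_comm y⁻¹, mul_assoc, mul_inv_cancel_left]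
  rw [h8, mul_pow, inv_pow, ← zpow_natCast, ← zpow_natCast, Nat.cast_mul, zpow_mul, hca,
    mul_comm (a : ℤ), zpow_mul y, hdb, ← zpow_mul, ← zpow_mul, ← zpow_neg, ← zpow_add]
  have h9 : m * b + -(n * a) = 1 := by linarith
  rw [h9, zpow_one]

/-- On the boundary torus the push-off has slope e: it is the orbit plus e meridians, and the orbit
is ab meridians. -/
theorem torusFramedNhd_hasFraming (ha : a ≠ 0) (hb : b ≠ 0) (hab : Nat.Coprime a b) (e : ℤ) :
    (torusFramedNhd ha hb hab e).HasFraming (a * b + e) := by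
  set ν := torusFramedNhd ha hb hab e with hν
  let χ : FundamentalGroup {x : S3 // x ∉ torusKnot a b} ν.basePoint →* _ := Abelianization.of
  have hT := fun x (_ : x ∈ (Set.univ : Set (ℝ × ℝ))) => boundaryTorus_notMem ha hb hab x
  set G := (angularS3 a b).comp (boundaryTorus a b) with hG
  have hper : ∀ x : ℝ × ℝ, G (x + (0, 2 * Real.pi)) = G x := fun x => by
    simp only [hG, ContinuousMap.comp_apply, boundaryTorus_period]
  have hper' : ∀ x : ℝ × ℝ, G (x + (2 * Real.pi, 0)) = G x := boundaryTorus_comp_period₁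
  have hl : pathChar χ ν.longitude = segChar χ G (0, 0) (2 * Real.pi, e * (2 * Real.pi)) := by
    refine pathChar_eq_segChar χ G convex_univ hT (Path.segment _ _) (fun _ => trivial) _ fun t => ?_
    rw [hG, angularS3_boundaryTorus, Path.segment_apply, AffineMap.lineMap_apply_module]
    change knotNhd a b (Circle.exp (2 * Real.pi * t),
      ((Circle.exp (2 * Real.pi * t) ^ e : Circle) : ℂ) * 1) = _
    rw [mul_one, ← Circle.exp_intCast_mul]
    simp only [zero_add, Prod.smul_mk, smul_eq_mul, Prod.mk_add_mk, mul_zero]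
    rw [mul_comm (2 * Real.pi), mul_left_comm (e : ℝ)]
  have hm : pathChar χ ν.meridian = segChar χ G (0, 0) (0, 2 * Real.pi) := by
    refine pathChar_eq_segChar χ G convex_univ hT (Path.segment _ _) (fun _ => trivial) _ fun t => ?_
    rw [hG, angularS3_boundaryTorus, Path.segment_apply, AffineMap.lineMap_apply_module]
    change knotNhd a b (1, ((1 ^ e : Circle) : ℂ) * (Circle.exp (2 * Real.pi * t) : ℂ)) = _
    rw [one_zpow, Circle.coe_one, one_mul]
    simp only [zero_add, Prod.smul_mk, smul_eq_mul, Prod.mk_add_mk, mul_zero,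
      Circle.exp_zero]
    congr 4
    ring
  have h1 : segChar χ G (0, 0) (2 * Real.pi, e * (2 * Real.pi)) =
      segChar χ G (0, 0) (2 * Real.pi, 0) * segChar χ G (0, 0) (0, 2 * Real.pi) ^ e := by
    rw [← segChar_trans χ G convex_univ hT (x := (0, 0)) (y := (2 * Real.pi, 0)) trivial trivial
      trivial]
    congr 1
    have h2 := segChar_zsmul χ G convex_univ hT hper (x := (0, 0)) (fun _ => trivial) e
    have h3 := segChar_add_right χ G hper' (0, 0) (0, e * (2 * Real.pi))
    simp only [Prod.mk_add_mk, zero_add, Prod.smul_mk, smul_zero, zsmul_eq_mul, add_zero] at h2 h3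
    rw [h3, h2]
  unfold FramedNhd.HasFraming
  have h2 := pathChar_loop χ ν.longitude
  have h3 := pathChar_loop χ ν.meridian
  change Abelianization.of _ = Abelianization.of _ ^ _
  refine h2.symm.trans ?_
  rw [hl, h1, segChar_longitude χ ha hb hab, ← zpow_natCast, ← zpow_add, ← hm, h3]
  push_cast
  rfl

end

/-! ### Continuous roots -/

/-- Lift through the covering z ↦ z^b of the punctured plane; the domain is simply connected. -/
theorem exists_continuous_root {b : ℕ} (hb : b ≠ 0) (g : C(ℝ × ℝ, ℂ)) (hg : ∀ x, g x ≠ 0)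
    {c : ℂ} (hc : c ^ b = g 0) : ∃ v : C(ℝ × ℝ, ℂ), (∀ x, v x ^ b = g x) ∧ v 0 = c := by
  have hcov := isCoveringMap_npow (𝕜 := ℂ) b (Nat.cast_ne_zero.mpr hb)
  have hc0 : c ≠ 0 := by
    rintro rfl
    rw [zero_pow hb] at hc
    exact hg 0 hc.symm
  obtain ⟨F, ⟨h0, hF⟩, -⟩ := hcov.existsUnique_continuousMap_lifts
    ⟨fun x => ⟨g x, hg x⟩, Continuous.subtype_mk g.continuous _⟩ (0 : ℝ × ℝ) ⟨c, hc0⟩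
    (Subtype.ext hc)
  refine ⟨⟨fun x => (F x).1, by fun_prop⟩, fun x => ?_, congrArg Subtype.val h0⟩
  exact congrArg Subtype.val (congrFun hF x)

/-- The ratio of two continuous roots is a root of unity, hence constant; the claim is this,
cross-multiplied. -/
theorem root_eq_mul {b : ℕ} (hb : b ≠ 0) {v w : ℝ → ℂ} (hv : Continuous v) (hw : Continuous w)
    (h : ∀ t, v t ^ b = w t ^ b) (h0 : ∀ t, w t ≠ 0) (t : ℝ) : v t * w 0 = v 0 * w t := by
  have hcov := isCoveringMap_npow (𝕜 := ℂ) b (Nat.cast_ne_zero.mpr hb)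
  have hne (t) : v t ≠ 0 := fun h' => h0 t (pow_eq_zero_iff hb |>.mp (by rw [← h, h', zero_pow hb]))
  have h1 := hcov.eq_of_comp_eq (g₁ := fun t => ⟨v t * w 0, mul_ne_zero (hne t) (h0 0)⟩)
    (g₂ := fun t => ⟨v 0 * w t, mul_ne_zero (hne 0) (h0 t)⟩)
    (Continuous.subtype_mk (by fun_prop) _) (Continuous.subtype_mk (by fun_prop) _)
    (funext fun t => Subtype.ext (by simp [mul_pow, h, mul_comm])) 0 rfl
  exact congrArg Subtype.val (congrFun h1 t)

/-! ### A covering by the complement of the origin in the plane -/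

/-- The invariants of the action of the `a`-th roots of unity on `ℂ²` with weights `1`, `-1`. -/
def rootMap (a : ℕ) (x : ℂ × ℂ) : ℂ × ℂ × ℂ := (x.1 ^ a, x.2 ^ a, x.1 * x.2)

/-- The image of the complement of the origin under `rootMap`. -/
def rootSet (a : ℕ) : Set (ℂ × ℂ × ℂ) := {y | y.1 * y.2.1 = y.2.2 ^ a ∧ ¬ (y.1 = 0 ∧ y.2.1 = 0)}

/-- The complement of the origin in `ℂ²`. -/
abbrev RootCover (a : ℕ) : Type := ↥(rootMap a ⁻¹' rootSet a)

theorem mem_rootCover {a : ℕ} (ha : a ≠ 0) {x : ℂ × ℂ} :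
    x ∈ rootMap a ⁻¹' rootSet a ↔ ¬ (x.1 = 0 ∧ x.2 = 0) := by
  simp [rootMap, rootSet, mul_pow, ha]

theorem continuous_rootMap (a : ℕ) : Continuous (rootMap a) := by
  unfold rootMap; fun_prop

/-- Where ‖x‖ ≥ 1 the a-th power of the larger coordinate already has norm at least ‖x‖. Properness
makes the map closed, hence a quotient map onto its image. -/
theorem isProperMap_rootMap {a : ℕ} (ha : a ≠ 0) : IsProperMap (rootMap a) := by
  rw [isProperMap_iff_tendsto_cocompact]
  refine ⟨continuous_rootMap a, ?_⟩
  rw [← Metric.cobounded_eq_cocompact, ← Metric.cobounded_eq_cocompact,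
    ← tendsto_norm_atTop_iff_cobounded]
  refine Filter.tendsto_atTop_mono' _ ?_ tendsto_norm_cobounded_atTop
  filter_upwards [tendsto_norm_cobounded_atTop.eventually (Filter.eventually_ge_atTop (1 : ℝ))]
    with x hx
  refine (le_self_pow₀ hx ha).trans ?_
  rcases le_total ‖x.1‖ ‖x.2‖ with h | h
  · rw [Prod.norm_def, max_eq_right h, ← norm_pow]
    exact (norm_fst_le (x.2 ^ a, x.1 * x.2)).trans (norm_snd_le (rootMap a x))
  · rw [Prod.norm_def, max_eq_left h, ← norm_pow]
    exact norm_fst_le (rootMap a x)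

theorem rootMap_eq_iff {a : ℕ} (ha : a ≠ 0) {x y : ℂ × ℂ} (hy : ¬ (y.1 = 0 ∧ y.2 = 0)) :
    rootMap a x = rootMap a y ↔ ∃ g : rootsOfUnity a ℂ,
      x = (((g : ℂˣ) : ℂ) * y.1, ((g⁻¹ : ℂˣ) : ℂ) * y.2) := by
  obtain ⟨u, s⟩ := x
  obtain ⟨u', s'⟩ := y
  simp only [rootMap, Prod.mk.injEq] at hy ⊢
  constructor
  · rintro ⟨h1, h2, h3⟩
    have hmk (z : ℂ) (hz : z ^ a = 1) : ∃ g : rootsOfUnity a ℂ, ((g : ℂˣ) : ℂ) = z := by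
      have : NeZero a := ⟨ha⟩
      exact ⟨rootsOfUnity.mkOfPowEq z hz, rootsOfUnity.coe_mkOfPowEq hz⟩
    by_cases hu : u' = 0
    · have hs : s' ≠ 0 := fun h => hy ⟨hu, h⟩
      rw [hu, zero_pow ha, pow_eq_zero_iff ha] at h1
      have hs' : s ≠ 0 := by
        rintro rfl
        rw [zero_pow ha, eq_comm, pow_eq_zero_iff ha] at h2
        exact hs h2
      obtain ⟨g, hg⟩ := hmk (s' / s) (by rw [div_pow, h2, div_self (pow_ne_zero _ hs)])
      refine ⟨g, by rw [h1, hu, mul_zero], ?_⟩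
      rw [Units.val_inv_eq_inv_val, hg]
      field_simp
    · have hu' : u ≠ 0 := by
        rintro rfl
        rw [zero_pow ha, eq_comm, pow_eq_zero_iff ha] at h1
        exact hu h1
      obtain ⟨g, hg⟩ := hmk (u / u') (by rw [div_pow, h1, div_self (pow_ne_zero _ hu)])
      refine ⟨g, by rw [hg]; field_simp, ?_⟩
      rw [Units.val_inv_eq_inv_val, hg]
      field_simp
      linear_combination h3
  · rintro ⟨g, h1, h2⟩
    have hg : ((g : ℂˣ) : ℂ) ^ a = 1 := by
      have := congrArg Units.val ((mem_rootsOfUnity a (g : ℂˣ)).mp g.2)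
      rwa [Units.val_pow_eq_pow_val, Units.val_one] at this
    subst h1 h2
    refine ⟨by rw [mul_pow, hg, one_mul], by
      rw [mul_pow, Units.val_inv_eq_inv_val, inv_pow, hg, inv_one, one_mul], ?_⟩
    rw [mul_mul_mul_comm, Units.mul_inv, one_mul]

theorem rootMap_surjOn {a : ℕ} (ha : a ≠ 0) {y : ℂ × ℂ × ℂ} (hy : y ∈ rootSet a) :
    ∃ x, rootMap a x = y := by
  obtain ⟨A, S, W⟩ := y
  obtain ⟨h1, h2⟩ := hy
  simp only at h1 h2
  by_cases hA : A = 0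
  · have hS : S ≠ 0 := fun h => h2 ⟨hA, h⟩
    obtain ⟨s, hs⟩ := IsAlgClosed.exists_pow_nat_eq S (Nat.pos_of_ne_zero ha)
    have hW : W = 0 := by
      rw [hA, zero_mul] at h1
      exact (pow_eq_zero_iff ha).mp h1.symm
    exact ⟨(0, s), by simp [rootMap, ha, hA, hs, hW]⟩
  · obtain ⟨u, hu⟩ := IsAlgClosed.exists_pow_nat_eq A (Nat.pos_of_ne_zero ha)
    have hu0 : u ≠ 0 := by
      rintro rfl
      rw [zero_pow ha] at hu
      exact hA hu.symm
    refine ⟨(u, W / u), ?_⟩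
    simp only [rootMap, hu, div_pow, Prod.mk.injEq, true_and]
    rw [← h1]
    constructor <;> field_simp

/-! ### The free action of the roots of unity and its quotient covering -/

namespace RootCover

variable {a : ℕ} [NeZero a]

instance : MulAction (rootsOfUnity a ℂ) (RootCover a) where
  smul g x := ⟨(((g : ℂˣ) : ℂ) * x.1.1, ((g⁻¹ : ℂˣ) : ℂ) * x.1.2), by
    rw [mem_rootCover (NeZero.ne a)]
    have := (mem_rootCover (NeZero.ne a)).mp x.2
    simpa using this⟩
  one_smul x := by
    apply Subtype.ext
    change (_ * _, _ * _) = _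
    simp
  mul_smul g h x := by
    apply Subtype.ext
    change (_ * _, _ * _) = (_ * (_ * _), _ * (_ * _))
    simp only [Subgroup.coe_mul, Units.val_mul, mul_inv, Prod.mk.injEq]
    constructor <;> ring

theorem coe_smul (g : rootsOfUnity a ℂ) (x : RootCover a) :
    (g • x).1 = (((g : ℂˣ) : ℂ) * x.1.1, ((g⁻¹ : ℂˣ) : ℂ) * x.1.2) := rfl

instance : ContinuousConstSMul (rootsOfUnity a ℂ) (RootCover a) where
  continuous_const_smul g := by
    refine Topology.IsInducing.subtypeVal.continuous_iff.mpr ?_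
    change Continuous fun x : RootCover a => (_ * x.1.1, _ * x.1.2)
    fun_prop

instance : LocallyCompactSpace (RootCover a) := by
  refine IsOpen.locallyCompactSpace ?_
  have h : rootMap a ⁻¹' rootSet a = {(0 : ℂ × ℂ)}ᶜ := by
    ext x
    rw [mem_rootCover (NeZero.ne a), Set.mem_compl_iff, Set.mem_singleton_iff, Prod.ext_iff]
    rfl
  rw [h]
  exact isOpen_compl_singleton

instance : IsCancelSMul (rootsOfUnity a ℂ) (RootCover a) where
  right_cancel' g g' x h := by
    have h1 := congrArg Subtype.val h
    rw [coe_smul, coe_smul, Prod.mk.injEq] at h1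
    by_cases hx : x.1.1 = 0
    · have hx2 : x.1.2 ≠ 0 := fun h' => (mem_rootCover (NeZero.ne a)).mp x.2 ⟨hx, h'⟩
      have h2 := Units.ext (mul_right_cancel₀ hx2 h1.2)
      exact Subtype.ext (inv_injective h2)
    · exact Subtype.ext (Units.ext (mul_right_cancel₀ hx h1.1))

theorem isCoveringMap (a : ℕ) [NeZero a] : IsCoveringMap ((rootSet a).restrictPreimage (rootMap a)) := by
  have ha : a ≠ 0 := NeZero.ne a
  have hq : Topology.IsQuotientMap ((rootSet a).restrictPreimage (rootMap a)) := by
    refine IsClosedMap.isQuotientMap ((isProperMap_rootMap ha).isClosedMap.restrictPreimage _)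
      ((continuous_rootMap a).restrictPreimage) fun y => ?_
    obtain ⟨x, hx⟩ := rootMap_surjOn ha y.2
    exact ⟨⟨x, by rw [Set.mem_preimage, hx]; exact y.2⟩, Subtype.ext hx⟩
  refine (hq.isQuotientCoveringMap_of_properlyDiscontinuousSMul
    (G := rootsOfUnity a ℂ) fun {x y} => ?_).isCoveringMap
  rw [MulAction.mem_orbit_iff, Subtype.ext_iff]
  refine (rootMap_eq_iff ha ((mem_rootCover ha).mp y.2)).trans ?_
  refine exists_congr fun g => ?_
  rw [Subtype.ext_iff, coe_smul, eq_comm]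

end RootCover

/-- A and S may vanish, though not together, so neither need have a continuous root obtainable by
itself; the pair lifts through `rootMap`. -/
theorem exists_root_pair {a : ℕ} (ha : a ≠ 0) (A S W : C(ℝ × ℝ, ℂ)) (h : ∀ x, A x * S x = W x ^ a)
    (h0 : ∀ x, ¬ (A x = 0 ∧ S x = 0)) :
    ∃ u s : C(ℝ × ℝ, ℂ), ∀ x, u x ^ a = A x ∧ s x ^ a = S x ∧ u x * s x = W x := by
  have : NeZero a := ⟨ha⟩
  let G : C(ℝ × ℝ, rootSet a) := ⟨fun x => ⟨(A x, S x, W x), h x, h0 x⟩,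
    Continuous.subtype_mk (by fun_prop) _⟩
  obtain ⟨e, he⟩ := rootMap_surjOn ha (G 0).2
  obtain ⟨F, ⟨-, hF⟩, -⟩ := (RootCover.isCoveringMap a).existsUnique_continuousMap_lifts G
    (0 : ℝ × ℝ) ⟨e, by rw [Set.mem_preimage, he]; exact (G 0).2⟩ (Subtype.ext he)
  refine ⟨⟨fun x => (F x).1.1, by fun_prop⟩, ⟨fun x => (F x).1.2, by fun_prop⟩, fun x => ?_⟩
  have h1 := congrArg Subtype.val (congrFun hF x)
  exact ⟨congrArg Prod.fst h1, congrArg (fun y => y.2.1) h1, congrArg (fun y => y.2.2) h1⟩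

theorem root_pair_eq_mul {a : ℕ} (ha : a ≠ 0) {u s u' s' : ℝ → ℂ} (hu : Continuous u)
    (hs : Continuous s) (hu' : Continuous u') (hs' : Continuous s')
    (h₁ : ∀ t, u t ^ a = u' t ^ a) (h₂ : ∀ t, s t ^ a = s' t ^ a)
    (h₃ : ∀ t, u t * s t = u' t * s' t) (h0 : ∀ t, ¬ (u' t = 0 ∧ s' t = 0)) :
    ∃ ζ : ℂ, ∀ t, u t = ζ * u' t ∧ ζ * s t = s' t := by
  have : NeZero a := ⟨ha⟩
  have hmem (t) : ¬ (u t = 0 ∧ s t = 0) := by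
    rintro ⟨h, h'⟩
    refine h0 t ⟨(pow_eq_zero_iff ha).mp ?_, (pow_eq_zero_iff ha).mp ?_⟩
    · rw [← h₁, h, zero_pow ha]
    · rw [← h₂, h', zero_pow ha]
  obtain ⟨g, hg⟩ := (rootMap_eq_iff ha (x := (u 0, s 0)) (y := (u' 0, s' 0)) (h0 0)).mp
    (by simp [rootMap, h₁, h₂, h₃])
  let F (t : ℝ) : RootCover a := ⟨(u t, s t), (mem_rootCover ha).mpr (hmem t)⟩
  let F' (t : ℝ) : RootCover a := ⟨(u' t, s' t), (mem_rootCover ha).mpr (h0 t)⟩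
  have hF' : Continuous F' := Continuous.subtype_mk (by fun_prop) _
  have h1 := (RootCover.isCoveringMap a).eq_of_comp_eq (g₁ := F) (g₂ := fun t => g • F' t)
    (Continuous.subtype_mk (by fun_prop) _) (hF'.const_smul g) (funext fun t => Subtype.ext ?_)
    0 (Subtype.ext hg)
  · refine ⟨((g : ℂˣ) : ℂ), fun t => ?_⟩
    have h2 := congrArg Subtype.val (congrFun h1 t)
    rw [RootCover.coe_smul, Prod.ext_iff] at h2
    refine ⟨h2.1, ?_⟩
    have h3 : s t = ((g⁻¹ : ℂˣ) : ℂ) * s' t := h2.2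
    rw [h3, Units.mul_inv_cancel_left]
  · change rootMap a (u t, s t) = rootMap a (g • F' t).1
    rw [(rootMap_eq_iff ha (h0 t)).mpr ⟨g, RootCover.coe_smul g (F' t)⟩]
    simp [rootMap, h₁, h₂, h₃, F']

/-! ### Loops in the complement of a trivial knot bound a torus -/

/-- The radial projection to the sphere. -/
noncomputable def toS3 (x : ℂ × ℂ) (hx : x ≠ 0) : S3 :=
  ⟨(√(sqNorm x))⁻¹ • x, by
    have h : 0 < sqNorm x := by
      have h1 : ¬ (x.1 = 0 ∧ x.2 = 0) := fun h => hx (Prod.ext h.1 h.2)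
      rw [not_and_or] at h1
      unfold sqNorm
      rcases h1 with h1 | h1
      · have := norm_pos_iff.mpr h1; positivity
      · have := norm_pos_iff.mpr h1; positivity
    have h2 : sqNorm ((√(sqNorm x))⁻¹ • x) = 1 := by
      rw [sqNorm_smul, inv_pow, Real.sq_sqrt h.le, inv_mul_cancel₀ h.ne']
    exact h2⟩

theorem continuous_sqNorm : Continuous sqNorm := by
  unfold sqNorm; fun_prop

theorem toS3_smul (y : S3) {r : ℝ} (hr : 0 < r) (h : r • y.1 ≠ 0) : toS3 (r • y.1) h = y := by
  have hy : sqNorm y.1 = 1 := y.2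
  apply Subtype.ext
  simp only [toS3]
  rw [sqNorm_smul, hy, mul_one, Real.sqrt_sq hr.le, smul_smul, inv_mul_cancel₀ hr.ne', one_smul]

theorem continuous_toS3 {T : Type*} [TopologicalSpace T] {f : T → ℂ × ℂ} (hf : Continuous f)
    (h : ∀ t, f t ≠ 0) : Continuous fun t => toS3 (f t) (h t) := by
  have h1 : Continuous fun t => √(sqNorm (f t)) := (continuous_sqNorm.comp hf).sqrt
  refine Continuous.subtype_mk (Continuous.smul (Continuous.inv₀ h1 fun t h0 => ?_) hf) _
  have h1 := (toS3 (f t) (h t)).2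
  simp only [toS3] at h1
  rw [h0, inv_zero, zero_smul] at h1
  simp at h1

/-- Off the great circle the second coordinate is nonzero. After rescaling, the points lie in the
abelian group ℂ × ℂˣ, where two loops with a common base point span a torus by multiplying them;
radial projection returns to the sphere. -/
theorem IsTrivialKnot.exists_torus {K : Set S3} (hK : IsTrivialKnot K) {α β : ℝ → S3}
    (hα : Continuous α) (hβ : Continuous β) (hαK : ∀ s, α s ∉ K) (hβK : ∀ t, β t ∉ K)
    (h0 : β 0 = α 0) (hα1 : α 1 = α 0) (hβ1 : β 1 = α 0) :
    ∃ F : C(ℝ × ℝ, S3), (∀ x, F x ∉ K) ∧ (∀ s, F (s, 0) = α s) ∧ (∀ s, F (s, 1) = α s) ∧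
      (∀ t, F (0, t) = β t) ∧ ∀ t, F (1, t) = β t := by
  obtain ⟨h, hh⟩ := hK
  have hmem (x : S3) : x ∈ K ↔ (h x).1.2 = 0 := by
    have h1 : h x ∈ h '' K ↔ x ∈ K := h.injective.mem_set_image
    rw [← h1, hh]
    rfl
  set c : ℂ × ℂ := (h (α 0)).1 with hc
  have hc2 : c.2 ≠ 0 := fun h' => hαK 0 ((hmem _).mpr h')
  have hA (s) : (h (α s)).1.2 ≠ 0 := fun h' => hαK s ((hmem _).mpr h')
  have hB (t) : (h (β t)).1.2 ≠ 0 := fun h' => hβK t ((hmem _).mpr h')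
  set A : ℝ → ℂ × ℂ := fun s => (‖(h (α s)).1.2‖)⁻¹ • (h (α s)).1 with hAdef
  set B : ℝ → ℂ × ℂ := fun t => (‖(h (β t)).1.2‖)⁻¹ • (h (β t)).1 with hBdef
  have hAc : Continuous A := by
    refine Continuous.smul (Continuous.inv₀ (by fun_prop) fun s => norm_ne_zero_iff.mpr (hA s)) ?_
    fun_prop
  have hBc : Continuous B := by
    refine Continuous.smul (Continuous.inv₀ (by fun_prop) fun s => norm_ne_zero_iff.mpr (hB s)) ?_
    fun_prop
  have hA2 (s) : (A s).2 ≠ 0 :=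
    smul_ne_zero (inv_ne_zero (norm_ne_zero_iff.mpr (hA s))) (hA s)
  have hB2 (t) : (B t).2 ≠ 0 :=
    smul_ne_zero (inv_ne_zero (norm_ne_zero_iff.mpr (hB t))) (hB t)
  have hB0 : B 0 = A 0 := by simp only [hAdef, hBdef, h0]
  have hA1 : A 1 = A 0 := by simp only [hAdef, hα1]
  have hB1 : B 1 = A 0 := by simp only [hAdef, hBdef, hβ1]
  set P : ℝ × ℝ → ℂ × ℂ := fun x =>
    ((A x.1).1 + (B x.2).1 - (A 0).1, (A x.1).2 * (B x.2).2 / (A 0).2) with hP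
  have hP2 (x) : (P x).2 ≠ 0 := div_ne_zero (mul_ne_zero (hA2 _) (hB2 _)) (hA2 0)
  have hPc : Continuous P := by
    refine Continuous.prodMk (by fun_prop) (Continuous.div_const ?_ _)
    fun_prop
  have hP0 (x) : P x ≠ 0 := fun h' => hP2 x (by rw [h']; rfl)
  have hbackA (s) (h' : A s ≠ 0) : h.symm (toS3 (A s) h') = α s := by
    rw [toS3_smul (h (α s)) (inv_pos.mpr (norm_pos_iff.mpr (hA s))), h.symm_apply_apply]
  have hbackB (t) (h' : B t ≠ 0) : h.symm (toS3 (B t) h') = β t := by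
    rw [toS3_smul (h (β t)) (inv_pos.mpr (norm_pos_iff.mpr (hB t))), h.symm_apply_apply]
  refine ⟨⟨fun x => h.symm (toS3 (P x) (hP0 x)), h.symm.continuous.comp (continuous_toS3 hPc hP0)⟩,
    fun x => ?_, fun s => ?_, fun s => ?_, fun t => ?_, fun t => ?_⟩
  · rw [hmem]
    simp only [ContinuousMap.coe_mk, h.apply_symm_apply, toS3]
    intro h'
    have h2 := (smul_eq_zero.mp (h' : (√(sqNorm (P x)))⁻¹ • (P x).2 = 0)).resolve_right (hP2 x)
    have h3 := (toS3 (P x) (hP0 x)).2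
    simp only [toS3, h2] at h3
    simp at h3
  · have h1 : P (s, 0) = A s := by
      simp only [hP, hB0]
      rw [add_sub_cancel_right, mul_div_cancel_right₀ _ (hA2 0)]
    simp only [ContinuousMap.coe_mk, h1, hbackA]
  · have h1 : P (s, 1) = A s := by
      simp only [hP, hB1]
      rw [add_sub_cancel_right, mul_div_cancel_right₀ _ (hA2 0)]
    simp only [ContinuousMap.coe_mk, h1, hbackA]
  · have h1 : P (0, t) = B t := by
      simp only [hP]
      rw [add_sub_cancel_left, mul_div_cancel_left₀ _ (hA2 0)]
    simp only [ContinuousMap.coe_mk, h1, hbackB]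
  · have h1 : P (1, t) = B t := by
      simp only [hP, hA1]
      rw [add_sub_cancel_left, mul_div_cancel_left₀ _ (hA2 0)]
    simp only [ContinuousMap.coe_mk, h1, hbackB]

/-! ### Torus knots are nontrivial -/

theorem eq_exp_mul_of_pow_eq {a : ℕ} (ha : a ≠ 0) {f : ℝ → ℂ} (hf : Continuous f) {c : ℂ}
    (hc : c ≠ 0) (k : ℕ) (h : ∀ s, f s ^ a = c * Complex.exp (2 * Real.pi * Complex.I * s) ^ k) :
    f 0 ≠ 0 ∧ f 1 = Complex.exp (2 * Real.pi * Complex.I / a) ^ k * f 0 := by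
  have ha' : (a : ℂ) ≠ 0 := Nat.cast_ne_zero.mpr ha
  have h0 : f 0 ^ a = c := by rw [h]; simp
  have hf0 : f 0 ≠ 0 := by
    intro h'
    rw [h', zero_pow ha] at h0
    exact hc h0.symm
  refine ⟨hf0, ?_⟩
  have h1 := root_eq_mul ha hf
    (w := fun s : ℝ => f 0 * Complex.exp (2 * Real.pi * Complex.I / a * s) ^ k) (by fun_prop)
    (fun s => by
      rw [h, mul_pow, h0, ← pow_mul, mul_comm k a, pow_mul]
      have : (a : ℂ) * (2 * Real.pi * Complex.I / a * s) = 2 * Real.pi * Complex.I * s := by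
        field_simp
      rw [← this, Complex.exp_nat_mul])
    (fun s => mul_ne_zero hf0 (pow_ne_zero _ (Complex.exp_ne_zero _))) 1
  simp only [Complex.ofReal_zero, mul_zero, Complex.exp_zero, one_pow, mul_one,
    Complex.ofReal_one] at h1
  apply mul_right_cancel₀ hf0
  rw [h1]; ring

/-- The root v of Z^b - W^a equals Z on the bottom edge and ηZ on the top edge. The simultaneous
a-th roots u, σ of the two factors of Z^b - v^b = W^a change in the s-direction by ξ and ξ⁻¹, with ξ
independent of t. With ω = exp(2πi/a), the top edge gives ξ = ω and the bottom edge ξ ω^{b-1} = 1,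
so ω^b = 1. -/
theorem dvd_of_torus {a b : ℕ} (ha : a ≠ 0) (hb : b ≠ 0) (Z W : C(ℝ × ℝ, ℂ))
    (h0 : ∀ x, Z x ^ b - W x ^ a ≠ 0) {c : ℂ} (hc : c ≠ 0)
    (hZ1 : ∀ t, Z (1, t) = Z (0, t)) (hW1 : ∀ t, W (1, t) = W (0, t))
    (hZ₀ : ∀ s : ℝ, Z (s, 0) = c * Complex.exp (2 * Real.pi * Complex.I * s))
    (hZ₁ : ∀ s : ℝ, Z (s, 1) = c * Complex.exp (2 * Real.pi * Complex.I * s))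
    (hW₀ : ∀ s : ℝ, W (s, 0) = 0) (hW₁ : ∀ s : ℝ, W (s, 1) = 0)
    {w : ℝ → ℂ} (hw : Continuous w) (hwb : ∀ t, w t ^ b = Z (0, t) ^ b - W (0, t) ^ a)
    {η : ℂ} (hη : η ≠ 1) (hw1 : w 1 = η * w 0) : a ∣ b := by
  have hw0 (t) : w t ≠ 0 := fun h => h0 (0, t) (by rw [← hwb, h, zero_pow hb])
  have hZne₀ (s : ℝ) : Z (s, 0) ≠ 0 := by rw [hZ₀]; exact mul_ne_zero hc (Complex.exp_ne_zero _)
  have hZne₁ (s : ℝ) : Z (s, 1) ≠ 0 := by rw [hZ₁]; exact mul_ne_zero hc (Complex.exp_ne_zero _)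
  obtain ⟨v, hv, hv0⟩ := exists_continuous_root hb
    ⟨fun x => Z x ^ b - W x ^ a, by fun_prop⟩ h0 (c := Z 0) (by
      have := hW₀ 0
      rw [← Prod.zero_eq_mk] at this
      simp [this, zero_pow ha])
  simp only [ContinuousMap.coe_mk] at hv
  rw [Prod.zero_eq_mk] at hv0
  have hv₀ (s) : v (s, 0) = Z (s, 0) := by
    have := root_eq_mul hb (v := fun s => v (s, 0)) (w := fun s => Z (s, 0)) (by fun_prop)
      (by fun_prop) (fun s => by rw [hv, hW₀, zero_pow ha, sub_zero]) hZne₀ s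
    rw [hv0, mul_comm] at this
    exact mul_left_cancel₀ (hZne₀ 0) this
  have hv1 (t) : v (1, t) = v (0, t) := by
    have hne (t) : v (0, t) ≠ 0 := fun h => h0 (0, t) (by rw [← hv, h, zero_pow hb])
    have := root_eq_mul hb (v := fun t => v (1, t)) (w := fun t => v (0, t)) (by fun_prop)
      (by fun_prop) (fun s => by rw [hv, hv, hZ1, hW1]) hne t
    rw [hv₀ 1, hZ1, ← hv₀ 0, mul_comm] at this
    exact mul_left_cancel₀ (hne 0) this
  have hv01 : v (0, 1) = η * Z (0, 1) := by
    have := root_eq_mul hb (v := fun t => v (0, t)) (by fun_prop) hw (fun t => by rw [hv, hwb])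
      hw0 1
    rw [hw1, hv0, hZ₀, ← hZ₁] at this
    apply mul_right_cancel₀ (hw0 0)
    rw [this]; ring
  have hv₁ (s) : v (s, 1) = η * Z (s, 1) := by
    have := root_eq_mul hb (v := fun s => v (s, 1)) (w := fun s => Z (s, 1)) (by fun_prop)
      (by fun_prop) (fun s => by rw [hv, hW₁, zero_pow ha, sub_zero]) hZne₁ s
    rw [hv01] at this
    apply mul_right_cancel₀ (hZne₁ 0)
    rw [this]; ring
  -- If Z = v, the cofactor is b Z^{b-1}; its vanishing would make v^b = Z^b - W^a vanish.
  have hne (x) : ¬ (Z x - v x = 0 ∧ ∑ i ∈ Finset.range b, Z x ^ i * v x ^ (b - 1 - i) = 0) := by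
    rintro ⟨h1, h2⟩
    rw [sub_eq_zero] at h1
    rw [← h1, geom_sum₂_self, mul_eq_zero, or_iff_right (Nat.cast_ne_zero.mpr hb)] at h2
    refine h0 x ?_
    rw [← hv, ← h1, ← Nat.sub_add_cancel (Nat.one_le_iff_ne_zero.mpr hb), pow_succ, h2, zero_mul]
  obtain ⟨u, σ, huσ⟩ := exists_root_pair ha ⟨fun x => Z x - v x, by fun_prop⟩
    ⟨fun x => ∑ i ∈ Finset.range b, Z x ^ i * v x ^ (b - 1 - i), by fun_prop⟩ W
    (fun x => by
      simp only [ContinuousMap.coe_mk]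
      rw [mul_comm, geom_sum₂_mul, hv]; ring)
    hne
  simp only [ContinuousMap.coe_mk] at huσ
  obtain ⟨ξ, hξ⟩ := root_pair_eq_mul ha (u := fun t => u (1, t)) (s := fun t => σ (1, t))
    (u' := fun t => u (0, t)) (s' := fun t => σ (0, t)) (by fun_prop) (by fun_prop) (by fun_prop)
    (by fun_prop) (fun t => by rw [(huσ _).1, (huσ _).1, hZ1, hv1])
    (fun t => by rw [(huσ _).2.1, (huσ _).2.1, hZ1, hv1])
    (fun t => by rw [(huσ _).2.2, (huσ _).2.2, hW1])
    (fun t h => hne (0, t) (by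
      rw [← (huσ (0, t)).1, ← (huσ (0, t)).2.1, h.1, h.2]
      exact ⟨zero_pow ha, zero_pow ha⟩))
  -- On the bottom edge v = Z, so σ^a = b Z^{b-1} winds b - 1 times.
  have h₀ := eq_exp_mul_of_pow_eq ha (f := fun s => σ (s, 0)) (by fun_prop)
    (c := b * c ^ (b - 1)) (mul_ne_zero (Nat.cast_ne_zero.mpr hb) (pow_ne_zero _ hc)) (b - 1)
    (fun s => by rw [(huσ _).2.1, hv₀, geom_sum₂_self, hZ₀]; ring)
  -- On the top edge v = ηZ, so u^a = (1-η) Z winds once; this is nonzero because η ≠ 1.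
  have h₁ := eq_exp_mul_of_pow_eq ha (f := fun s => u (s, 1)) (by fun_prop)
    (c := (1 - η) * c) (mul_ne_zero (sub_ne_zero.mpr hη.symm) hc) 1
    (fun s => by rw [(huσ _).1, hv₁, hZ₁]; ring)
  rw [← (Complex.isPrimitiveRoot_exp a ha).pow_eq_one_iff_dvd]
  have h2 := (hξ 1).1
  have h3 := (hξ 0).2
  rw [h₁.2, pow_one] at h2
  rw [← mul_right_cancel₀ h₁.1 h2, h₀.2, ← mul_assoc, ← pow_succ', Nat.sub_add_cancel
    (Nat.one_le_iff_ne_zero.mpr hb)] at h3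
  exact mul_right_cancel₀ h₀.1 (by rw [h3, one_mul])

/-- Go from (1, 0) to the circle z = 0, run around it once, and return. There f = -(√2 w)^a, so f
winds a times. -/
theorem exists_loop_knotPoly {a b : ℕ} (ha : a ≠ 0) (hb : b ≠ 0) :
    ∃ β : ℝ → S3, ∃ H κ : ℝ → ℝ, Continuous β ∧ Continuous H ∧ Continuous κ ∧ (∀ t, 0 < H t) ∧
      κ 0 = 0 ∧ κ 1 = 1 ∧ (β 0).1 = (1, 0) ∧ (β 1).1 = (1, 0) ∧
      ∀ t, knotPoly a b (β t).1 = H t * Complex.exp (2 * Real.pi * Complex.I * (a * κ t)) := by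
  set ρ : ℝ → ℝ := fun t => max 0 (min 1 (3 * min t (1 - t))) with hρ
  set κ : ℝ → ℝ := fun t => max 0 (min 1 (3 * t - 1)) with hκ
  have hρ0 (t) : 0 ≤ ρ t := le_max_left _ _
  have hρ1 (t) : ρ t ≤ 1 := max_le zero_le_one (min_le_left _ _)
  have hρc : Continuous ρ := by fun_prop
  have hκc : Continuous κ := by fun_prop
  have hρ2 (t) : 0 ≤ 1 - ρ t ^ 2 := by nlinarith [hρ0 t, hρ1 t]
  have hcase (t) : κ t = 0 ∨ κ t = 1 ∨ ρ t = 1 := by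
    by_cases h1 : t ≤ 1 / 3
    · left
      simp only [hκ]
      exact max_eq_left ((min_le_right _ _).trans (by linarith))
    · by_cases h2 : 2 / 3 ≤ t
      · right; left
        simp only [hκ]
        rw [min_eq_left (by linarith), max_eq_right zero_le_one]
      · right; right
        have h3 : (1 : ℝ) ≤ 3 * min t (1 - t) := by
          have : (1 / 3 : ℝ) ≤ min t (1 - t) := le_min (by linarith) (by linarith)
          linarith
        simp only [hρ]
        rw [min_eq_left h3, max_eq_right zero_le_one]
  -- The phase π/a makes -w^a positive on the way out and back, so the two terms of f add and f does
  -- not vanish.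
  set e : ℝ → ℂ := fun t => Complex.exp (((Real.pi / a + 2 * Real.pi * κ t : ℝ) : ℂ) * Complex.I)
    with he
  have hec : Continuous e := by fun_prop
  have hen (t) : ‖e t‖ = 1 := Complex.norm_exp_ofReal_mul_I _
  have hea (t) : e t ^ a = -Complex.exp (2 * Real.pi * Complex.I * (a * κ t)) := by
    have ha' : (a : ℂ) ≠ 0 := Nat.cast_ne_zero.mpr ha
    simp only [he]
    rw [← Complex.exp_nat_mul, ← neg_one_mul, ← Complex.exp_pi_mul_I, ← Complex.exp_add]
    congr 1
    push_cast
    field_simp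
  have hee (t) (h : κ t = 0 ∨ κ t = 1) :
      Complex.exp (2 * Real.pi * Complex.I * (a * κ t)) = 1 := by
    rcases h with h | h
    · simp [h]
    · rw [h, Complex.ofReal_one, mul_one, mul_comm, Complex.exp_nat_mul_two_pi_mul_I]
  have hmem (t) : ‖((√(1 - ρ t ^ 2) : ℝ) : ℂ)‖ ^ 2 + ‖(ρ t : ℂ) * e t‖ ^ 2 = 1 := by
    rw [norm_mul, hen, mul_one, Complex.norm_real, Complex.norm_real, Real.norm_eq_abs,
      Real.norm_eq_abs, sq_abs, sq_abs, Real.sq_sqrt (hρ2 t)]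
    ring
  have hρz : ρ 0 = 0 := by simp [hρ]
  have hρo : ρ 1 = 0 := by simp [hρ]
  refine ⟨fun t => ⟨(((√(1 - ρ t ^ 2) : ℝ) : ℂ), (ρ t : ℂ) * e t), hmem t⟩,
    fun t => (√2 * √(1 - ρ t ^ 2)) ^ b + (√2 * ρ t) ^ a, κ, ?_, ?_, hκc, fun t => ?_, ?_, ?_, ?_, ?_,
    fun t => ?_⟩
  · exact Continuous.subtype_mk (by fun_prop) _
  · fun_prop
  · beta_reduce
    rcases (hρ0 t).eq_or_lt with h | h
    · rw [← h]; simp [ha]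
    · positivity
  · simp [hκ]
  · norm_num [hκ]
  · simp [hρz]
  · simp [hρo]
  · simp only [knotPoly]
    push_cast
    have h1 : (((√2 : ℝ) : ℂ) * (√(1 - ρ t ^ 2) : ℝ)) ^ b =
        (((√2 : ℝ) : ℂ) * (√(1 - ρ t ^ 2) : ℝ)) ^ b *
          Complex.exp (2 * Real.pi * Complex.I * (a * κ t)) := by
      rcases hcase t with h | h | h
      · rw [hee t (Or.inl h), mul_one]
      · rw [hee t (Or.inr h), mul_one]
      · simp [h, hb]
    rw [← mul_assoc (((√2 : ℝ) : ℂ)) (ρ t : ℂ), mul_pow _ (e t), hea]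
    linear_combination h1

theorem not_isTrivialKnot_torusKnot {a b : ℕ} (ha : 2 ≤ a) (hb : 2 ≤ b) (hab : Nat.Coprime a b) :
    ¬ IsTrivialKnot (torusKnot a b) := by
  intro hK
  have ha0 : a ≠ 0 := by omega
  have hb0 : b ≠ 0 := by omega
  have hbC : (b : ℂ) ≠ 0 := Nat.cast_ne_zero.mpr hb0
  obtain ⟨β, H, κ, hβ, hH, hκ, hHp, hκ0, hκ1, hβ0, hβ1, hf⟩ := exists_loop_knotPoly ha0 hb0
  have hnot (x : S3) (hx : knotPoly a b x.1 ≠ 0) : x ∉ torusKnot a b := fun h =>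
    hx ((knotPoly_eq_zero_iff ha0 hb0 hab).mpr h)
  set α : ℝ → S3 := fun s => ⟨(Complex.exp (2 * Real.pi * Complex.I * s), 0), by
    have : 2 * Real.pi * Complex.I * s = ((2 * Real.pi * s : ℝ) : ℂ) * Complex.I := by
      push_cast; ring
    rw [this, Complex.norm_exp_ofReal_mul_I]; simp⟩ with hαdef
  have hα : Continuous α := Continuous.subtype_mk (by fun_prop) _
  have hα0 : (α 0).1 = (1, 0) := by simp [hαdef]
  have hα1 : (α 1).1 = (1, 0) := by simp [hαdef, Complex.exp_two_pi_mul_I]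
  obtain ⟨F, hF, hF0, hF1, hFl, hFr⟩ := hK.exists_torus hα hβ
    (fun s => hnot _ (by simp [knotPoly, hαdef, ha0, Complex.exp_ne_zero]))
    (fun t => hnot _ (by
      rw [hf]
      exact mul_ne_zero (Complex.ofReal_ne_zero.mpr (hHp t).ne') (Complex.exp_ne_zero _)))
    (Subtype.ext (hβ0.trans hα0.symm)) (Subtype.ext (hα1.trans hα0.symm))
    (Subtype.ext (hβ1.trans hα0.symm))
  have hH1 : H 1 = H 0 := by
    have h0 := hf 0
    have h1 := hf 1
    rw [hβ1, ← hβ0, h0, hκ0, hκ1, Complex.ofReal_one, mul_one, mul_comm _ (a : ℂ),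
      Complex.exp_nat_mul_two_pi_mul_I, mul_one] at h1
    simpa using h1.symm
  have hdvd : a ∣ b := by
    refine dvd_of_torus ha0 hb0 ⟨fun x => (√2 : ℝ) * (F x).1.1, by fun_prop⟩
      ⟨fun x => (√2 : ℝ) * (F x).1.2, by fun_prop⟩
      (fun x h => hF x ((knotPoly_eq_zero_iff ha0 hb0 hab).mp h)) (c := (√2 : ℝ)) (by simp)
      (fun t => by simp only [ContinuousMap.coe_mk, hFl, hFr])
      (fun t => by simp only [ContinuousMap.coe_mk, hFl, hFr])
      (fun s => by simp only [ContinuousMap.coe_mk, hF0, hαdef])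
      (fun s => by simp only [ContinuousMap.coe_mk, hF1, hαdef])
      (fun s => by simp only [ContinuousMap.coe_mk, hF0, hαdef, mul_zero])
      (fun s => by simp only [ContinuousMap.coe_mk, hF1, hαdef, mul_zero])
      (w := fun t => ((H t ^ (1 / b : ℝ) : ℝ) : ℂ) *
        Complex.exp (2 * Real.pi * Complex.I / b * (a * κ t))) ?_ (fun t => ?_)
      (η := Complex.exp (2 * Real.pi * Complex.I / b) ^ a) (fun h => ?_) ?_
    · refine Continuous.mul (Complex.continuous_ofReal.comp
        (hH.rpow_const fun t => Or.inl (hHp t).ne')) (by fun_prop)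
    · have h1 : (H t ^ (1 / b : ℝ)) ^ b = H t := by
        rw [one_div, Real.rpow_inv_natCast_pow (hHp t).le hb0]
      have h2 := hf t
      rw [← hFl] at h2
      simp only [ContinuousMap.coe_mk]
      rw [mul_pow, ← Complex.ofReal_pow, h1, ← Complex.exp_nat_mul]
      refine Eq.trans ?_ h2.symm
      congr 2
      field_simp
    -- Here η = exp(2πia/b), the change of the b-th root while f winds a times; η = 1 would give b ∣
    -- a.
    · rw [(Complex.isPrimitiveRoot_exp b hb0).pow_eq_one_iff_dvd] at h
      have := Nat.eq_one_of_dvd_coprimes hab h dvd_rfl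
      omega
    · simp only [hH1, hκ0, hκ1]
      rw [← Complex.exp_nat_mul]
      simp
      ring_nf
  have := Nat.eq_one_of_dvd_coprimes hab dvd_rfl hdvd
  omega

/-! ### The main theorem -/

theorem isSurgery_add_one {a b : ℕ} (ha : a ≠ 0) (hb : b ≠ 0) (h : Nat.Coprime a b)
    {p q : ℤ} (hp : p = a * b + 1) (hq : p ∣ q + b ^ 2) :
    IsSurgery p (torusKnot a b) (LensSpace p q) :=
  ⟨_, hp ▸ torusFramedNhd_hasFraming ha hb h 1,
    (lensModelAddOne ha hb h hp hq).orientedDiffeomorphic⟩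

theorem isSurgery_sub_one {a b : ℕ} (ha : 2 ≤ a) (hb : 2 ≤ b) (h : Nat.Coprime a b)
    {p q : ℤ} (hp : p = a * b - 1) (hq : p ∣ q + a ^ 2) :
    IsSurgery p (torusKnot a b) (LensSpace p q) :=
  ⟨_, hp ▸ torusFramedNhd_hasFraming (by omega) (by omega) h (-1),
    (lensModelSubOne ha hb h hp hq).orientedDiffeomorphic⟩

theorem mainTheorem11 :
    ∃ P : ℕ → Tuple ℤ[X],
      (∀ j : ℕ, ratTuple j = (P j).map (algebraMap ℤ[X] (FractionRing ℤ[X]))) ∧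
      (∀ k : ℕ,
        ((P (k + 1)).a.Monic ∧ (P (k + 1)).a.natDegree = k) ∧
        ((P (k + 1)).b.Monic ∧ (P (k + 1)).b.natDegree = k + 1) ∧
        ((P (k + 1)).c.Monic ∧ (P (k + 1)).c.natDegree = k) ∧
        ((P (k + 1)).d.Monic ∧ (P (k + 1)).d.natDegree = k + 1) ∧
        ((P (k + 1)).p.Monic ∧ (P (k + 1)).p.natDegree = 2 * k + 1) ∧
        ((P (k + 1)).q.Monic ∧ (P (k + 1)).q.natDegree = 2 * k + 3)) ∧
      (∀ k : ℕ, 1 ≤ k →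
        (P (k + 1)).a ≠ (P (k + 1)).c ∧ (P (k + 1)).b ≠ (P (k + 1)).d ∧
        ∀ n a b c d p : ℤ, 2 ≤ n →
          a = (P (k + 1)).a.eval n → b = (P (k + 1)).b.eval n →
          c = (P (k + 1)).c.eval n → d = (P (k + 1)).d.eval n →
          p = (P (k + 1)).p.eval n →
          a ≠ c ∧ b ≠ d ∧ ¬ (a = d ∧ b = c) ∧
          (2 ≤ a ∧ 2 ≤ b ∧ IsCoprime a b ∧ ¬ IsTrivialKnot (torusKnot a b)) ∧
          (2 ≤ c ∧ 2 ≤ d ∧ IsCoprime c d ∧ ¬ IsTrivialKnot (torusKnot c d)) ∧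
          SurgeriesDiffeomorphic p (torusKnot a b) (torusKnot c d) ∧
          2 ≤ p ∧ ∃ q : ℤ, IsCoprime p q ∧
            IsSurgery p (torusKnot a b) (LensSpace p q) ∧
            IsSurgery p (torusKnot c d) (LensSpace p q)) := by
  refine ⟨polyTuple, ratTuple_eq_map, fun k => ?_, fun k hk => ?_⟩
  · exact ⟨polyD_monic k, polyB_monic (k + 1), polyB_monic k, polyD_monic (k + 1),
      polyTuple_p_monic k, polyTuple_p_monic (k + 1)⟩
  · obtain ⟨k, rfl⟩ := Nat.exists_eq_add_of_le' hk
    have hne (n : ℤ) (hn : 2 ≤ n) : (polyD (k + 1)).eval n ≠ (polyB (k + 1)).eval n ∧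
        (polyB (k + 2)).eval n ≠ (polyD (k + 2)).eval n := by
      obtain ⟨a, b, c, d, ha, hb, hc, hd, h2a, h2b, h2c, h2d, hca, hcb, hbd, -⟩ :=
        polyTuple_eval_facts hn k
      rw [ha, hb, hc, hd]
      exact ⟨by exact_mod_cast hca.ne', by exact_mod_cast hbd.ne⟩
    refine ⟨fun h => (hne 2 le_rfl).1 (congrArg (Polynomial.eval 2) h),
      fun h => (hne 2 le_rfl).2 (congrArg (Polynomial.eval 2) h), ?_⟩
    rintro n _ _ _ _ _ hn rfl rfl rfl rfl rfl
    change (polyD (k + 1)).eval n ≠ (polyB (k + 1)).eval n ∧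
      (polyB (k + 2)).eval n ≠ (polyD (k + 2)).eval n ∧ _
    have hp : (polyTuple (k + 1 + 1)).p.eval n =
        (polyB (k + 2)).eval n * (polyD (k + 1)).eval n + 1 := by
      simp [polyTuple]
    change _ ∧ _ ∧ ¬ ((polyD (k + 1)).eval n = (polyD (k + 2)).eval n ∧
      (polyB (k + 2)).eval n = (polyB (k + 1)).eval n) ∧
      (2 ≤ (polyD (k + 1)).eval n ∧ 2 ≤ (polyB (k + 2)).eval n ∧
        IsCoprime ((polyD (k + 1)).eval n) ((polyB (k + 2)).eval n) ∧
        ¬ IsTrivialKnot (torusKnot ((polyD (k + 1)).eval n) ((polyB (k + 2)).eval n))) ∧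
      (2 ≤ (polyB (k + 1)).eval n ∧ 2 ≤ (polyD (k + 2)).eval n ∧
        IsCoprime ((polyB (k + 1)).eval n) ((polyD (k + 2)).eval n) ∧
        ¬ IsTrivialKnot (torusKnot ((polyB (k + 1)).eval n) ((polyD (k + 2)).eval n))) ∧
      SurgeriesDiffeomorphic _
        (torusKnot ((polyD (k + 1)).eval n) ((polyB (k + 2)).eval n))
        (torusKnot ((polyB (k + 1)).eval n) ((polyD (k + 2)).eval n)) ∧
      _ ∧ ∃ q : ℤ, IsCoprime _ q ∧
        IsSurgery _ (torusKnot ((polyD (k + 1)).eval n) ((polyB (k + 2)).eval n))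
          (LensSpace _ q) ∧
        IsSurgery _ (torusKnot ((polyB (k + 1)).eval n) ((polyD (k + 2)).eval n))
          (LensSpace _ q)
    rw [hp]
    obtain ⟨a, b, c, d, ha, hb, hc, hd, h2a, h2b, h2c, h2d, hca, hcb, hbd, hab, hcd, hp', r, hr⟩ :=
      polyTuple_eval_facts hn k
    rw [ha, hb, hc, hd, mul_comm (b : ℤ)]
    have hab' := Nat.isCoprime_iff_coprime.mp hab
    have hcd' := Nat.isCoprime_iff_coprime.mp hcd
    have h₁ : IsSurgery (a * b + 1 : ℤ) (torusKnot a b) (LensSpace (a * b + 1) (-(b : ℤ) ^ 2)) :=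
      isSurgery_add_one (by omega) (by omega) hab' rfl (by simp)
    have h₂ : IsSurgery (a * b + 1 : ℤ) (torusKnot c d) (LensSpace (a * b + 1) (-(b : ℤ) ^ 2)) := by
      -- With p = ab + 1, multiplying p r = b²d² - 1 by c² and using cd = p + 1 gives c² - b² =
      -- b²((p+1)² - 1) - c² p r, in which p factors out.
      refine isSurgery_sub_one h2c h2d hcd' hp' ⟨b ^ 2 * (a * b + 1 + 2) - c ^ 2 * r, ?_⟩
      have hcd2 : (c * d : ℤ) = a * b + 1 + 1 := by linarith
      have : (c : ℤ) ^ 2 * (b ^ 2 * d ^ 2) = b ^ 2 * (a * b + 1 + 1) ^ 2 := by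
        rw [← hcd2]; ring
      linear_combination (c : ℤ) ^ 2 * hr + this
    refine ⟨by exact_mod_cast hca.ne', by exact_mod_cast hbd.ne, ?_,
      ⟨by exact_mod_cast h2a, by exact_mod_cast h2b, hab, not_isTrivialKnot_torusKnot h2a h2b hab'⟩,
      ⟨by exact_mod_cast h2c, by exact_mod_cast h2d, hcd, not_isTrivialKnot_torusKnot h2c h2d hcd'⟩,
      surgeriesDiffeomorphic_of_lensSpace h₁ h₂, by nlinarith, _, ?_, h₁, h₂⟩
    · rintro ⟨-, h⟩
      exact hcb.ne' (by exact_mod_cast h)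
    · have h3 : IsCoprime (a * b + 1 : ℤ) b := ⟨1, -a, by ring⟩
      exact (h3.pow_right (n := 2)).neg_right
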